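/- **Conventions.** Let $k$ be a commutative ring and let $R=R_*=\bigoplus_{n\in\mathbb Z}R_n$ be a $\mathbb Z$-graded commutative $k$-algebra that is even-periodic: $R_n=0$ for $n$ odd, and $R_2$ contains a unit of $R$. Suppose that $R_0$ is a local ring with maximal ideal $\mathfrak m_0$ and that $R_0$ is $\mathfrak m_0$-adically complete and separated. Put $\mathfrak m=\mathfrak m_0R$ and let $R^c_*$ be $R_*$ with the $\mathfrak m$-adic topology. Let $G$ be a profinite group with a right action $(a,g)\mapsto a^g$ on $R$ by degree-preserving $k$-algebra automorphisms such that $R_n\times G\to R_n$ is continuous for every $n$. Topologies, completeness, function spaces and completions of graded objects are taken degree by degree. *Complete Hausdorff filtered $R^c_*$-modules.* These are the $\mathbb Z$-graded $R_*$-modules $M$ with a complete Hausdorff group topology on every $M_n$ such that the open graded submodules form a fundamental system of neighbourhoods of $0$ and every open graded submodule contains $\mathfrak m^iM$ for some $i$. Morphisms are the continuous $R_*$-linear maps of degree $0$. The completed tensor product $M\widehat\otimes_{R}N$ is the completion of the graded tensor product $M\otimes_RN$ with respect to the images of $F\otimes_R N+M\otimes_R F'$, where $F\subseteq M$ and $F'\subseteq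 N$ are open graded submodules. With $\widehat\otimes_{R}$, unit object $R^c_*$ and symmetry $x\otimes y\mapsto(-1)^{|x||y|}y\otimes x$ these modules form a symmetric monoidal category. *Twisted modules.* A complete twisted right $R^c_*$-$G$-module is such a module $M$ with a right action of $G$ by additive maps of degree $0$, such that $M_n\times G\to M_n$ is continuous for every $n$ and $(am)g=a^g\cdot(mg)$ for $a\in R_*$, $m\in M$, $g\in G$. Morphisms are the $G$-equivariant morphisms of modules. The tensor product is $\widehat\otimes_R$ with the diagonal action, the unit object is $R^c_*$ with its given action, and the associativity, unit and symmetry isomorphisms are those of the underlying modules. *Comodules.* Let $C=C(G,R^c_*)$ be the graded ring of continuous functions (degree by degree) with the topology of uniform convergence, with $\eta_R(a)(g)=a$, $\eta_L(a)(g)=a^g$, $\varepsilon(\alpha)=\alpha(e)$ and $\psi=m^{-1}\widetilde\psi\colon C\to C\widehat\otimes_RC$, where $m\colon C\widehat\otimes_RC\cong C(G\times G,R^c_*)$ is the isomorphism $m(\alpha\otimes\beta)(g_1,g_2)=\alpha(g_1)^{g_2}\beta(g_2)$ and $\widetilde\psi(\alpha)(g_1,g_2)=\alpha(g_1g_2)$.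 In $C\widehat\otimes_RM$ the factor $C$ is an $R$-module through $\eta_R$, and $C\widehat\otimes_R M$ is a left $R$-module through $\eta_L$. A complete left $C$-comodule is a complete Hausdorff filtered $R^c_*$-module $M$ with a continuous left $R$-linear map $\rho\colon M\to C\widehat\otimes_RM$ of degree $0$ such that $(\psi\otimes1)\rho=(1\otimes\rho)\rho$ and $(\varepsilon\otimes1)\rho=1$. Morphisms are the morphisms of modules that commute with the coactions. The coaction on $M\widehat\otimes_RN$ is $\rho_M\otimes\rho_N$ followed by $(\alpha\otimes x)\otimes(\beta\otimes y)\mapsto\alpha\beta\otimes(x\otimes y)$, the unit object is $R^c_*$ with the coaction $a\mapsto\eta_L(a)\otimes1$, and the associativity, unit and symmetry isomorphisms are those of the underlying modules. **Theorem.** There is an equivalence of symmetric monoidal categories (an equivalence of categories whose functor is strong monoidal and compatible with the symmetries) between the category of complete twisted right $R^c_*$-$G$-modules and the category of complete left $C(G,R^c_*)$-comodules. -/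

import Mathlib

open CategoryTheory TopologicalSpace Topology UniformSpace

set_option linter.unusedSectionVars false

universe w u

namespace GradedTwist

section Ring

variable {k : Type w} {A : Type u} [CommRing k] [CommRing A] [Algebra k A]
  (𝒜 : ℤ → Submodule k A) [GradedAlgebra 𝒜]

/-- A graded ring is even-periodic if it is concentrated in even degrees and its degree `2` part
contains a unit of the ring. -/
class EvenPeriodic : Prop where
  odd_eq_bot : ∀ n : ℤ, Odd n → 𝒜 n = ⊥
  exists_unit : ∃ v : Aˣ, (v : A) ∈ 𝒜 2

/-- Multiplication of homogeneous elements. -/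
def gmul {d e f : ℤ} (h : d + e = f) : 𝒜 d →+ 𝒜 e →+ 𝒜 f :=
  AddMonoidHom.mk' (fun a => AddMonoidHom.mk'
    (fun b => ⟨(a : A) * (b : A), h ▸ SetLike.mul_mem_graded a.2 b.2⟩)
    (fun _ _ => Subtype.ext (mul_add _ _ _)))
    (fun _ _ => AddMonoidHom.ext fun _ => Subtype.ext (add_mul _ _ _))

@[simp] theorem coe_gmul {d e f : ℤ} (h : d + e = f) (a : 𝒜 d) (b : 𝒜 e) :
    (gmul 𝒜 h a b : A) = a * b := rfl

/-- The ideal `𝔪 = 𝔪₀ R` generated by the maximal ideal `𝔪₀` of the degree `0` subring. -/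
def maxIdeal [IsLocalRing (𝒜 0)] : Ideal A :=
  (IsLocalRing.maximalIdeal (𝒜 0)).map (algebraMap (𝒜 0) A)

/-- The degree `d` part of `𝔪 ^ i`. -/
def mpow [IsLocalRing (𝒜 0)] (i : ℕ) (d : ℤ) : AddSubgroup (𝒜 d) :=
  (Submodule.toAddSubgroup (maxIdeal 𝒜 ^ i)).comap (𝒜 d).subtype.toAddMonoidHom

theorem mem_mpow [IsLocalRing (𝒜 0)] {i : ℕ} {d : ℤ} {a : 𝒜 d} :
    a ∈ mpow 𝒜 i d ↔ (a : A) ∈ maxIdeal 𝒜 ^ i := Iff.rfl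

theorem mpow_mono [IsLocalRing (𝒜 0)] {i j : ℕ} (h : i ≤ j) (d : ℤ) :
    mpow 𝒜 j d ≤ mpow 𝒜 i d := fun _ ha => Ideal.pow_le_pow_right h ha

theorem exists_unit_deg [EvenPeriodic 𝒜] (m : ℤ) :
    ∃ (a : 𝒜 (2 * m)) (b : 𝒜 (-(2 * m))), (a : A) * b = 1 := by
  obtain ⟨v, hv⟩ := EvenPeriodic.exists_unit (𝒜 := 𝒜)
  have hv' : ((v⁻¹ : Aˣ) : A) ∈ 𝒜 (-2) := by
    have h1 : (v : A) * (DirectSum.decompose 𝒜 ((v⁻¹ : Aˣ) : A) (-2) : A) = 1 := by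
      have := DirectSum.coe_decompose_mul_add_of_left_mem 𝒜 (i := 2) (j := -2)
        (b := ((v⁻¹ : Aˣ) : A)) hv
      rw [← this, Units.mul_inv]
      exact DirectSum.decompose_of_mem_same 𝒜 (SetLike.one_mem_graded 𝒜)
    have : ((v⁻¹ : Aˣ) : A) = (DirectSum.decompose 𝒜 ((v⁻¹ : Aˣ) : A) (-2) : A) :=
      Units.inv_eq_of_mul_eq_one_right h1
    rw [this]; exact SetLike.coe_mem _
  have key : ∀ n : ℕ, ∃ (a : 𝒜 (2 * n)) (b : 𝒜 (-(2 * n))), (a : A) * b = 1 := by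
    intro n
    refine ⟨⟨(v : A) ^ n, ?_⟩, ⟨((v⁻¹ : Aˣ) : A) ^ n, ?_⟩, ?_⟩
    · simpa [mul_comm] using SetLike.pow_mem_graded n hv
    · simpa [mul_comm] using SetLike.pow_mem_graded n hv'
    · simp [← mul_pow]
  obtain ⟨n, rfl | rfl⟩ := m.eq_nat_or_neg
  · exact key n
  · obtain ⟨a, b, h⟩ := key n
    refine ⟨⟨b, ?_⟩, ⟨a, ?_⟩, by rw [mul_comm]; exact h⟩
    · have := b.2; rwa [show 2 * (-(n : ℤ)) = -(2 * n) by ring]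
    · have := a.2; rwa [show -(2 * (-(n : ℤ))) = (2 * n) by ring]

end Ring

section Modules

variable {k : Type w} {A : Type u} [CommRing k] [CommRing A] [Algebra k A]
  (𝒜 : ℤ → Submodule k A) [GradedAlgebra 𝒜]

/-- A graded module `(M_n)_{n ∈ ℤ}` over the graded ring `𝒜` whose components are topological
abelian groups (with their uniform structure). The action `R_d × M_j ⟶ M_i` is
indexed by the relation `d + j = i`. -/
structure GMod where
  X : ℤ → Type u
  [grp : ∀ n, AddCommGroup (X n)]
  [unif : ∀ n, UniformSpace (X n)]
  [ug : ∀ n, IsUniformAddGroup (X n)]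
  act : ∀ {d j i : ℤ}, d + j = i → 𝒜 d →+ X j →+ X i
  one_act : ∀ {j : ℤ} (h : 0 + j = j) (x : X j), act h (1 : 𝒜 0) x = x
  mul_act : ∀ {d e f j l i : ℤ} (h₁ : d + e = f) (h₂ : e + j = l) (h₃ : d + l = i)
    (h₄ : f + j = i) (a : 𝒜 d) (b : 𝒜 e) (x : X j),
    act h₄ (gmul 𝒜 h₁ a b) x = act h₃ a (act h₂ b x)

attribute [instance] GMod.grp GMod.unif GMod.ug

variable {𝒜}

/-- Open graded `𝒜`-submodules. -/
@[ext] structure OpenSub (M : GMod 𝒜) where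
  N : ∀ n, AddSubgroup (M.X n)
  isOpen : ∀ n, IsOpen (N n : Set (M.X n))
  act_mem : ∀ {d j i : ℤ} (h : d + j = i) (a : 𝒜 d) {x : M.X j}, x ∈ N j → M.act h a x ∈ N i

namespace OpenSub

variable {M : GMod 𝒜}

instance : LE (OpenSub M) := ⟨fun F F' => ∀ n, F.N n ≤ F'.N n⟩

instance : Min (OpenSub M) := ⟨fun F F' =>
  { N := fun n => F.N n ⊓ F'.N n
    isOpen := fun n => (F.isOpen n).inter (F'.isOpen n)
    act_mem := fun h a _ hx => ⟨F.act_mem h a hx.1, F'.act_mem h a hx.2⟩ }⟩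

instance : Top (OpenSub M) := ⟨
  { N := fun _ => ⊤
    isOpen := fun _ => isOpen_univ
    act_mem := fun _ _ _ _ => trivial }⟩

theorem inf_le_left (F F' : OpenSub M) : F ⊓ F' ≤ F := fun _ _ hx => hx.1
theorem inf_le_right (F F' : OpenSub M) : F ⊓ F' ≤ F' := fun _ _ hx => hx.2
theorem mem_top {n : ℤ} (x : M.X n) : x ∈ (⊤ : OpenSub M).N n := trivial

end OpenSub

variable (𝒜) in
/-- Complete Hausdorff filtered graded modules over `𝒜` with its `𝔪`-adic topology: the
topology is linear, that is, the open graded submodules form a fundamental system of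
neighbourhoods of `0`, it is complete and Hausdorff, and every open graded submodule contains
`𝔪 ^ i M` for some `i`. -/
structure CMod [IsLocalRing (𝒜 0)] extends GMod 𝒜 where
  [cpl : ∀ n, CompleteSpace (X n)]
  [t0 : ∀ n, T0Space (X n)]
  lin : ∀ (n : ℤ), ∀ U ∈ 𝓝 (0 : X n), ∃ F : OpenSub toGMod, (F.N n : Set (X n)) ⊆ U
  adic : ∀ F : OpenSub toGMod, ∃ p : ℕ, ∀ {d j i : ℤ} (h : d + j = i), ∀ a ∈ mpow 𝒜 p d,
    ∀ x : X j, act h a x ∈ F.N i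

attribute [instance] CMod.cpl CMod.t0

section Basic

variable [IsLocalRing (𝒜 0)]

theorem CMod.exists_le (M : CMod 𝒜) {n : ℤ} (L : AddSubgroup (M.X n))
    (hL : IsOpen (L : Set (M.X n))) : ∃ F : OpenSub M.toGMod, F.N n ≤ L :=
  M.lin n L (hL.mem_nhds L.zero_mem)

instance (M : CMod 𝒜) (n : ℤ) : NonarchimedeanAddGroup (M.X n) where
  is_nonarchimedean U hU := by
    obtain ⟨F, hF⟩ := M.lin n U hU
    exact ⟨⟨F.N n, F.isOpen n⟩, hF⟩

theorem continuous_of_open {S Y : Type*} [AddCommGroup S] [TopologicalSpace S]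
    [IsTopologicalAddGroup S] [AddCommGroup Y] [TopologicalSpace Y] [NonarchimedeanAddGroup Y]
    (f : S →+ Y) (h : ∀ L : AddSubgroup Y, IsOpen (L : Set Y) → ∃ K : AddSubgroup S,
      IsOpen (K : Set S) ∧ ∀ x ∈ K, f x ∈ L) : Continuous f := by
  refine continuous_of_continuousAt_zero f ?_
  rw [ContinuousAt, map_zero]
  intro U hU
  obtain ⟨V, hV⟩ := NonarchimedeanAddGroup.is_nonarchimedean U hU
  obtain ⟨K, hK, hKL⟩ := h V V.isOpen
  refine Filter.mem_map.2 ?_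
  exact Filter.mem_of_superset (hK.mem_nhds K.zero_mem) fun x hx => hV (hKL x hx)

theorem CMod.continuous_act (M : CMod 𝒜) {d j i : ℤ} (h : d + j = i) (a : 𝒜 d) :
    Continuous (M.act h a) := by
  refine continuous_of_open _ fun L hL => ?_
  obtain ⟨F, hF⟩ := M.exists_le L hL
  exact ⟨F.N j, F.isOpen j, fun x hx => hF (F.act_mem h a hx)⟩

/-- In the even-periodic case, inclusions of open submodules can be checked in degrees 0, 1. -/
theorem le_of_zero_one [EvenPeriodic 𝒜] (M : GMod 𝒜) (P Q : ∀ n, AddSubgroup (M.X n))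
    (hP : ∀ {d j i : ℤ} (h : d + j = i) (a : 𝒜 d) {x : M.X j}, x ∈ P j → M.act h a x ∈ P i)
    (hQ : ∀ {d j i : ℤ} (h : d + j = i) (a : 𝒜 d) {x : M.X j}, x ∈ Q j → M.act h a x ∈ Q i)
    (h0 : P 0 ≤ Q 0) (h1 : P 1 ≤ Q 1) (n : ℤ) : P n ≤ Q n := by
  intro x hx
  have key : ∀ m r : ℤ, 2 * m + r = n → P r ≤ Q r → x ∈ Q n := by
    intro m r hr hle
    obtain ⟨a, b, hab⟩ := exists_unit_deg 𝒜 m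
    have hb : -(2 * m) + n = r := by omega
    have := M.mul_act (by omega : 2 * m + -(2 * m) = 0) hb hr (zero_add n) a b x
    rw [show gmul 𝒜 (by omega : 2 * m + -(2 * m) = 0) a b = 1 from Subtype.ext hab,
      M.one_act] at this
    rw [this]
    exact hQ hr a (hle (hP hb b hx))
  obtain ⟨m, hm | hm⟩ := Int.even_or_odd' n
  · exact key m 0 (by omega) h0
  · exact key m 1 (by omega) h1

/-- Morphisms are the continuous `𝒜`-linear maps of degree `0`. -/
@[ext] structure CMod.Hom (M N : CMod 𝒜) where
  f : ∀ n, M.X n →+ N.X n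
  cont : ∀ n, Continuous (f n)
  map_act : ∀ {d j i : ℤ} (h : d + j = i) (a : 𝒜 d) (x : M.X j),
    f i (M.act h a x) = N.act h a (f j x)

instance : Category (CMod 𝒜) where
  Hom M N := CMod.Hom M N
  id M := ⟨fun _ => AddMonoidHom.id _, fun _ => continuous_id, fun _ _ _ => rfl⟩
  comp φ ψ := ⟨fun n => (ψ.f n).comp (φ.f n), fun n => (ψ.cont n).comp (φ.cont n),
    fun h a x => by simp [φ.map_act, ψ.map_act]⟩

theorem CMod.hom_ext {M N : CMod 𝒜} {φ ψ : M ⟶ N} (h : ∀ n x, φ.f n x = ψ.f n x) : φ = ψ :=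
  CMod.Hom.ext (funext fun n => AddMonoidHom.ext (h n))

@[simp] theorem CMod.id_f (M : CMod 𝒜) (n : ℤ) (x : M.X n) : CMod.Hom.f (𝟙 M) n x = x := rfl
@[simp] theorem CMod.comp_f {M N P : CMod 𝒜} (φ : M ⟶ N) (ψ : N ⟶ P) (n : ℤ) (x : M.X n) :
    (φ ≫ ψ).f n x = ψ.f n (φ.f n x) := rfl

/-- The preimage of an open submodule. -/
def OpenSub.comap {M N : CMod 𝒜} (φ : M ⟶ N) (F : OpenSub N.toGMod) : OpenSub M.toGMod where
  N n := (F.N n).comap (φ.f n)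
  isOpen n := (F.isOpen n).preimage (φ.cont n)
  act_mem h a x hx := by
    rw [AddSubgroup.mem_comap, φ.map_act]; exact F.act_mem h a hx

end Basic

end Modules

noncomputable section

section Tensor

variable {k : Type w} {A : Type u} [CommRing k] [CommRing A] [Algebra k A]
  {𝒜 : ℤ → Submodule k A} [GradedAlgebra 𝒜]

theorem GMod.act_comm (M : GMod 𝒜) {d e j l l' i : ℤ} (h₁ : e + j = l) (h₂ : d + l = i)
    (h₃ : d + j = l') (h₄ : e + l' = i) (a : 𝒜 d) (b : 𝒜 e) (x : M.X j) :
    M.act h₂ a (M.act h₁ b x) = M.act h₄ b (M.act h₃ a x) := by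
  have e1 : d + e + j = i := by omega
  rw [← M.mul_act rfl h₁ h₂ e1 a b x, ← M.mul_act (add_comm e d) h₃ h₄ e1 b a x]
  congr 2
  exact Subtype.ext (mul_comm _ _)

variable [IsLocalRing (𝒜 0)] (M N : CMod 𝒜)

/-- Generators `x ⊗ y` of the degree `n` part of the tensor product. -/
structure TGen (n : ℤ) where
  i : ℤ
  j : ℤ
  h : i + j = n
  x : M.X i
  y : N.X j

/-- The relations of the graded tensor product over `𝒜`. -/
inductive TRel (n : ℤ) : FreeAbelianGroup (TGen M N n) → Prop
  | add_left {i j : ℤ} (h : i + j = n) (x x' : M.X i) (y : N.X j) :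
      TRel n (.of ⟨i, j, h, x + x', y⟩ - (.of ⟨i, j, h, x, y⟩ + .of ⟨i, j, h, x', y⟩))
  | add_right {i j : ℤ} (h : i + j = n) (x : M.X i) (y y' : N.X j) :
      TRel n (.of ⟨i, j, h, x, y + y'⟩ - (.of ⟨i, j, h, x, y⟩ + .of ⟨i, j, h, x, y'⟩))
  | bal {d i j i' j' : ℤ} (h₁ : d + i = i') (h₂ : d + j = j') (h : i' + j = n) (h' : i + j' = n)
      (a : 𝒜 d) (x : M.X i) (y : N.X j) :
      TRel n (.of ⟨i', j, h, M.act h₁ a x, y⟩ - .of ⟨i, j', h', x, N.act h₂ a y⟩)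

/-- The degree `n` part of the (uncompleted) tensor product of `M` and `N` over `𝒜`. -/
def T (n : ℤ) : Type u :=
  FreeAbelianGroup (TGen M N n) ⧸ AddSubgroup.closure {z | TRel M N n z}

instance (n : ℤ) : AddCommGroup (T M N n) :=
  inferInstanceAs (AddCommGroup (_ ⧸ AddSubgroup.closure {z | TRel M N n z}))

variable {M N} in
theorem T.rel {n : ℤ} {z z' : FreeAbelianGroup (TGen M N n)} (h : TRel M N n (z - z')) :
    (QuotientAddGroup.mk z : T M N n) = QuotientAddGroup.mk z' := by
  rw [eq_comm]
  refine QuotientAddGroup.eq.2 (AddSubgroup.subset_closure ?_)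
  rwa [neg_add_eq_sub]

/-- The class of `x ⊗ y`. -/
def T.mk {i j n : ℤ} (h : i + j = n) : M.X i →+ N.X j →+ T M N n :=
  AddMonoidHom.mk' (fun x => AddMonoidHom.mk'
    (fun y => (QuotientAddGroup.mk (.of ⟨i, j, h, x, y⟩) : T M N n))
    (fun _ _ => T.rel (.add_right h _ _ _)))
    (fun _ _ => AddMonoidHom.ext fun _ => T.rel (.add_left h _ _ _))

variable {M N} in
theorem T.ext {n : ℤ} {Q : Type*} [AddCommGroup Q] {f g : T M N n →+ Q}
    (h : ∀ {i j : ℤ} (h : i + j = n) x y, f (T.mk M N h x y) = g (T.mk M N h x y)) : f = g := by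
  refine QuotientAddGroup.addMonoidHom_ext _ ?_
  ext ⟨i, j, h', x, y⟩
  exact h h' x y

variable {M N} in
/-- The universal property of the uncompleted tensor product. -/
def T.lift {n : ℤ} {Q : Type*} [AddCommGroup Q]
    (b : ∀ {i j : ℤ}, i + j = n → M.X i →+ N.X j →+ Q)
    (bal : ∀ {d i j i' j' : ℤ} (h₁ : d + i = i') (h₂ : d + j = j') (h : i' + j = n)
      (h' : i + j' = n) (a : 𝒜 d) (x : M.X i) (y : N.X j),
      b h (M.act h₁ a x) y = b h' x (N.act h₂ a y)) : T M N n →+ Q :=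
  QuotientAddGroup.lift _ (FreeAbelianGroup.lift fun g : TGen M N n => b g.h g.x g.y) <| by
    rw [AddSubgroup.closure_le]
    rintro z (⟨h, x, x', y⟩ | ⟨h, x, y, y'⟩ | ⟨h₁, h₂, h, h', a, x, y⟩)
    · simp
    · simp
    · simp [bal h₁ h₂ h h']

variable {M N} in
theorem T.lift_mk {n : ℤ} {Q : Type*} [AddCommGroup Q]
    (b : ∀ {i j : ℤ}, i + j = n → M.X i →+ N.X j →+ Q) (bal) {i j : ℤ} (h : i + j = n)
    (x : M.X i) (y : N.X j) : T.lift (M := M) (N := N) b bal (T.mk M N h x y) = b h x y := by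
  change FreeAbelianGroup.lift _ (FreeAbelianGroup.of _) = _
  simp

variable {M N}

/-- The image of `F ⊗ N + M ⊗ F'` in the degree `n` part of the tensor product. -/
def T.W (F : OpenSub M.toGMod) (F' : OpenSub N.toGMod) (n : ℤ) : AddSubgroup (T M N n) :=
  AddSubgroup.closure {z | ∃ (i j : ℤ) (h : i + j = n) (x : M.X i) (y : N.X j),
    (x ∈ F.N i ∨ y ∈ F'.N j) ∧ T.mk M N h x y = z}

theorem T.W_mono {F G : OpenSub M.toGMod} {F' G' : OpenSub N.toGMod} (h : F ≤ G) (h' : F' ≤ G')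
    (n : ℤ) : T.W F F' n ≤ T.W G G' n := by
  refine AddSubgroup.closure_mono ?_
  rintro z ⟨i, j, hij, x, y, hx, rfl⟩
  exact ⟨i, j, hij, x, y, hx.imp (fun a => h i a) (fun a => h' j a), rfl⟩

variable (M N) in
/-- The subgroups `F ⊗ N + M ⊗ F'` form a fundamental system of neighbourhoods of `0`. -/
@[reducible] def T.basis (n : ℤ) : AddGroupFilterBasis (T M N n) :=
  addGroupFilterBasisOfComm
    {U | ∃ (F : OpenSub M.toGMod) (F' : OpenSub N.toGMod), U = (T.W F F' n : Set (T M N n))}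
    ⟨_, ⊤, ⊤, rfl⟩
    (by
      rintro _ _ ⟨F, F', rfl⟩ ⟨G, G', rfl⟩
      exact ⟨_, ⟨F ⊓ G, F' ⊓ G', rfl⟩, fun z hz =>
        ⟨T.W_mono (OpenSub.inf_le_left _ _) (OpenSub.inf_le_left _ _) n hz,
          T.W_mono (OpenSub.inf_le_right _ _) (OpenSub.inf_le_right _ _) n hz⟩⟩)
    (by rintro _ ⟨F, F', rfl⟩; exact zero_mem _)
    (by
      rintro _ ⟨F, F', rfl⟩
      refine ⟨_, ⟨F, F', rfl⟩, ?_⟩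
      rintro _ ⟨a, ha, b, hb, rfl⟩
      exact add_mem ha hb)
    (by rintro _ ⟨F, F', rfl⟩; exact ⟨_, ⟨F, F', rfl⟩, fun _ ha => neg_mem ha⟩)

instance (n : ℤ) : TopologicalSpace (T M N n) := (T.basis M N n).topology

instance (n : ℤ) : IsTopologicalAddGroup (T M N n) := (T.basis M N n).isTopologicalAddGroup

instance (n : ℤ) : UniformSpace (T M N n) :=
  IsTopologicalAddGroup.rightUniformSpace _

instance (n : ℤ) : IsUniformAddGroup (T M N n) := isUniformAddGroup_of_addCommGroup

theorem T.hasBasis (n : ℤ) : (𝓝 (0 : T M N n)).HasBasis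
    (fun _ : OpenSub M.toGMod × OpenSub N.toGMod => True)
    (fun p => (T.W p.1 p.2 n : Set (T M N n))) := by
  refine ⟨fun U => ?_⟩
  rw [(T.basis M N n).nhds_zero_hasBasis.mem_iff]
  constructor
  · rintro ⟨_, ⟨F, F', rfl⟩, h⟩
    exact ⟨(F, F'), trivial, h⟩
  · rintro ⟨p, -, h⟩
    exact ⟨_, ⟨p.1, p.2, rfl⟩, h⟩

variable (M N) in
/-- The degree `n` part of the completed tensor product, that is, the Hausdorff completion
of the tensor product with respect to the subgroups `F ⊗ N + M ⊗ F'`. -/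
abbrev TC (n : ℤ) : Type u := Completion (T M N n)

variable (M N) in
/-- `x ⊗ y` in the completed tensor product. -/
def TC.mk {i j n : ℤ} (h : i + j = n) : M.X i →+ N.X j →+ TC M N n :=
  AddMonoidHom.mk' (fun x => Completion.toCompl.comp (T.mk M N h x))
    (fun _ _ => AddMonoidHom.ext fun _ => by simp [Completion.coe_add])

theorem TC.mk_eq {i j n : ℤ} (h : i + j = n) (x : M.X i) (y : N.X j) :
    TC.mk M N h x y = ((T.mk M N h x y : T M N n) : TC M N n) := rfl

/-- Balanced continuous biadditive maps in degree `n`. -/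
structure Bilin (M N : CMod 𝒜) (n : ℤ) (Q : Type*) [AddCommGroup Q] [TopologicalSpace Q] where
  b : ∀ {i j : ℤ}, i + j = n → M.X i →+ N.X j →+ Q
  bal : ∀ {d i j i' j' : ℤ} (h₁ : d + i = i') (h₂ : d + j = j') (h : i' + j = n)
    (h' : i + j' = n) (a : 𝒜 d) (x : M.X i) (y : N.X j),
    b h (M.act h₁ a x) y = b h' x (N.act h₂ a y)
  cont : ∀ L : AddSubgroup Q, IsOpen (L : Set Q) → ∃ (F : OpenSub M.toGMod)
    (F' : OpenSub N.toGMod), ∀ {i j : ℤ} (h : i + j = n) (x : M.X i) (y : N.X j),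
    (x ∈ F.N i ∨ y ∈ F'.N j) → b h x y ∈ L

/-- Closure of `F ⊗ N + M ⊗ F'` in the completed tensor product. -/
def TC.W (F : OpenSub M.toGMod) (F' : OpenSub N.toGMod) (n : ℤ) : AddSubgroup (TC M N n) :=
  ((T.W F F' n).map (Completion.toCompl : T M N n →+ TC M N n)).topologicalClosure

theorem TC.hasBasis (n : ℤ) : (𝓝 (0 : TC M N n)).HasBasis
    (fun _ : OpenSub M.toGMod × OpenSub N.toGMod => True)
    (fun p => (TC.W p.1 p.2 n : Set (TC M N n))) :=
  (T.hasBasis n).hasBasis_of_isDenseInducing Completion.isDenseInducing_coe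

theorem TC.isOpen_W (F : OpenSub M.toGMod) (F' : OpenSub N.toGMod) (n : ℤ) :
    IsOpen (TC.W F F' n : Set (TC M N n)) :=
  AddSubgroup.isOpen_of_mem_nhds (g := 0) _ ((TC.hasBasis n).mem_of_mem (i := (F, F')) trivial)

theorem TC.exists_W {n : ℤ} (L : AddSubgroup (TC M N n)) (hL : IsOpen (L : Set (TC M N n))) :
    ∃ (F : OpenSub M.toGMod) (F' : OpenSub N.toGMod), TC.W F F' n ≤ L := by
  obtain ⟨p, -, hp⟩ := (TC.hasBasis n).mem_iff.1 (hL.mem_nhds L.zero_mem)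
  exact ⟨p.1, p.2, hp⟩

instance (n : ℤ) : NonarchimedeanAddGroup (TC M N n) where
  is_nonarchimedean U hU := by
    obtain ⟨p, -, hp⟩ := (TC.hasBasis n).mem_iff.1 hU
    exact ⟨⟨TC.W p.1 p.2 n, TC.isOpen_W _ _ _⟩, hp⟩

theorem TC.mk_mem_W {F : OpenSub M.toGMod} {F' : OpenSub N.toGMod} {i j n : ℤ} (h : i + j = n)
    {x : M.X i} {y : N.X j} (hxy : x ∈ F.N i ∨ y ∈ F'.N j) : TC.mk M N h x y ∈ TC.W F F' n :=
  AddSubgroup.le_topologicalClosure _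
    ⟨_, AddSubgroup.subset_closure ⟨i, j, h, x, y, hxy, rfl⟩, rfl⟩

section MapsOut

variable {n : ℤ} {Q : Type*} [AddCommGroup Q] [TopologicalSpace Q]

theorem TC.mem_of_mk {f : TC M N n →+ Q} (hf : Continuous f) (L : AddSubgroup Q)
    (hL : IsClosed (L : Set Q))
    (F : OpenSub M.toGMod) (F' : OpenSub N.toGMod)
    (h : ∀ {i j : ℤ} (h : i + j = n) (x : M.X i) (y : N.X j), (x ∈ F.N i ∨ y ∈ F'.N j) →
      f (TC.mk M N h x y) ∈ L) {z : TC M N n} (hz : z ∈ TC.W F F' n) : f z ∈ L := by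
  have : TC.W F F' n ≤ L.comap f := by
    refine AddSubgroup.topologicalClosure_minimal _ ?_ (hL.preimage hf)
    rw [AddSubgroup.map_le_iff_le_comap, T.W, AddSubgroup.closure_le]
    rintro _ ⟨i, j, hij, x, y, hxy, rfl⟩
    exact h hij x y hxy
  exact this hz

theorem T.W_top (F' : OpenSub N.toGMod) (n : ℤ) : T.W (⊤ : OpenSub M.toGMod) F' n = ⊤ := by
  have hh : (QuotientAddGroup.mk' (T.W (⊤ : OpenSub M.toGMod) F' n)) = 0 := by
    refine T.ext fun h x y => ?_
    exact (QuotientAddGroup.eq_zero_iff _).2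
      (AddSubgroup.subset_closure ⟨_, _, h, x, y, Or.inl trivial, rfl⟩)
  rw [← QuotientAddGroup.ker_mk' (T.W (⊤ : OpenSub M.toGMod) F' n), hh]
  exact AddMonoidHom.ker_zero

theorem TC.W_top (F' : OpenSub N.toGMod) (n : ℤ) (z : TC M N n) :
    z ∈ TC.W (⊤ : OpenSub M.toGMod) F' n := by
  have hd := (Completion.denseRange_coe (α := T M N n)) z
  rw [TC.W, T.W_top]
  refine closure_mono ?_ hd
  rintro _ ⟨y, rfl⟩
  exact ⟨y, trivial, rfl⟩

theorem TC.mem_of_mk_all {f : TC M N n →+ Q} (hf : Continuous f) (L : AddSubgroup Q)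
    (hL : IsClosed (L : Set Q))
    (h : ∀ {i j : ℤ} (h : i + j = n) (x : M.X i) (y : N.X j), f (TC.mk M N h x y) ∈ L)
    (z : TC M N n) : f z ∈ L :=
  TC.mem_of_mk hf L hL ⊤ ⊤ (fun h' x y _ => h h' x y) (TC.W_top ⊤ n z)

theorem TC.ext [IsTopologicalAddGroup Q] [T2Space Q] {f g : TC M N n →+ Q}
    (hf : Continuous f) (hg : Continuous g)
    (h : ∀ {i j : ℤ} (h : i + j = n) (x : M.X i) (y : N.X j),
      f (TC.mk M N h x y) = g (TC.mk M N h x y)) : f = g := by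
  ext z
  have := TC.mem_of_mk_all (f := f - g) (hf.sub hg) ⊥ isClosed_singleton
    (fun h' x y => by simp [h h' x y]) z
  rw [AddSubgroup.mem_bot] at this
  exact sub_eq_zero.1 this

end MapsOut

section Lift

variable {n : ℤ} {Q : Type*} [AddCommGroup Q] [UniformSpace Q] [IsUniformAddGroup Q]
  [CompleteSpace Q] [T0Space Q] [NonarchimedeanAddGroup Q]

theorem Bilin.cont_lift (B : Bilin M N n Q) : Continuous (T.lift B.b B.bal) := by
  refine continuous_of_open _ fun L hL => ?_
  obtain ⟨F, F', h⟩ := B.cont L hL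
  refine ⟨T.W F F' n, AddSubgroup.isOpen_of_mem_nhds (g := 0) _
    ((T.hasBasis n).mem_of_mem (i := (F, F')) trivial), fun z hz => ?_⟩
  have : T.W F F' n ≤ L.comap (T.lift B.b B.bal) := by
    rw [T.W, AddSubgroup.closure_le]
    rintro _ ⟨i, j, hij, x, y, hxy, rfl⟩
    rw [SetLike.mem_coe, AddSubgroup.mem_comap, T.lift_mk]
    exact h hij x y hxy
  exact this hz

/-- The universal property of the completed tensor product. -/
def TC.lift (B : Bilin M N n Q) : TC M N n →+ Q := (T.lift B.b B.bal).extension B.cont_lift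

theorem TC.continuous_lift (B : Bilin M N n Q) : Continuous (TC.lift B) :=
  AddMonoidHom.continuous_extension _ _

theorem TC.lift_mk (B : Bilin M N n Q) {i j : ℤ} (h : i + j = n) (x : M.X i) (y : N.X j) :
    TC.lift B (TC.mk M N h x y) = B.b h x y := by
  rw [TC.lift, TC.mk_eq, AddMonoidHom.extension_coe, T.lift_mk]

end Lift

theorem TC.continuous_mk_left {i j n : ℤ} (h : i + j = n) (y : N.X j) :
    Continuous (fun x => TC.mk M N h x y) := by
  refine continuous_of_open ((TC.mk M N h).flip y) fun L hL => ?_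
  obtain ⟨F, F', hF⟩ := TC.exists_W L hL
  exact ⟨F.N i, F.isOpen i, fun x hx => hF (TC.mk_mem_W h (Or.inl hx))⟩

theorem TC.continuous_mk_right {i j n : ℤ} (h : i + j = n) (x : M.X i) :
    Continuous (TC.mk M N h x) := by
  refine continuous_of_open (TC.mk M N h x) fun L hL => ?_
  obtain ⟨F, F', hF⟩ := TC.exists_W L hL
  exact ⟨F'.N j, F'.isOpen j, fun x hx => hF (TC.mk_mem_W h (Or.inr hx))⟩

theorem TC.mk_bal {d i j i' j' n : ℤ} (h₁ : d + i = i') (h₂ : d + j = j') (h : i' + j = n)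
    (h' : i + j' = n) (a : 𝒜 d) (x : M.X i) (y : N.X j) :
    TC.mk M N h (M.act h₁ a x) y = TC.mk M N h' x (N.act h₂ a y) := by
  rw [TC.mk_eq, TC.mk_eq]
  congr 1
  exact T.rel (.bal h₁ h₂ h h' a x y)

/-- The bilinear map `(x, y) ↦ a x ⊗ y`. -/
def TC.actBilin {d n m : ℤ} (h : d + n = m) (a : 𝒜 d) : Bilin M N n (TC M N m) where
  b {i j} hij := (TC.mk M N (by omega : (d + i) + j = m)).comp (M.act rfl a)
  bal {e i j i' j'} h₁ h₂ h₃ h₄ b x y := by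
    simp only [AddMonoidHom.comp_apply]
    rw [M.act_comm h₁ rfl rfl (by omega) a b x]
    exact TC.mk_bal (M := M) (N := N) (by omega : e + (d + i) = d + i') h₂ (by omega) (by omega) b (M.act rfl a x) y
  cont L hL := by
    obtain ⟨F, F', hF⟩ := TC.exists_W L hL
    refine ⟨F, F', fun h x y hxy => ?_⟩
    rw [AddMonoidHom.comp_apply]
    exact hF (TC.mk_mem_W _ (hxy.imp (fun hx => F.act_mem _ a hx) id))

/-- The action of `𝒜` on the completed tensor product. -/
def TC.act {d n m : ℤ} (h : d + n = m) : 𝒜 d →+ TC M N n →+ TC M N m :=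
  AddMonoidHom.mk' (fun a => TC.lift (TC.actBilin h a)) fun a a' => by
    refine TC.ext (TC.continuous_lift _) ((TC.continuous_lift _).add (TC.continuous_lift _))
      fun hij x y => ?_
    simp [TC.lift_mk, TC.actBilin]

theorem TC.continuous_act {d n m : ℤ} (h : d + n = m) (a : 𝒜 d) :
    Continuous (TC.act (M := M) (N := N) h a) := TC.continuous_lift _

theorem TC.act_mk {d n m i j i' : ℤ} (h : d + n = m) (a : 𝒜 d) (hij : i + j = n)
    (hi : d + i = i') (h' : i' + j = m) (x : M.X i) (y : N.X j) :
    TC.act h a (TC.mk M N hij x y) = TC.mk M N h' (M.act hi a x) y := by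
  subst hi
  exact TC.lift_mk _ _ _ _

attribute [irreducible] TC.mk TC.lift TC.act

theorem TC.one_act {n : ℤ} (h : 0 + n = n) (z : TC M N n) : TC.act h (1 : 𝒜 0) z = z := by
  have : TC.act (M := M) (N := N) h (1 : 𝒜 0) = AddMonoidHom.id _ := by
    refine TC.ext (TC.continuous_act _ _) continuous_id fun hij x y => ?_
    rw [TC.act_mk h 1 hij (zero_add _) hij, M.one_act, AddMonoidHom.id_apply]
  rw [this, AddMonoidHom.id_apply]

theorem TC.mul_act {d e f j l i : ℤ} (h₁ : d + e = f) (h₂ : e + j = l) (h₃ : d + l = i)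
    (h₄ : f + j = i) (a : 𝒜 d) (b : 𝒜 e) (z : TC M N j) :
    TC.act h₄ (gmul 𝒜 h₁ a b) z = TC.act h₃ a (TC.act h₂ b z) := by
  have : TC.act (M := M) (N := N) h₄ (gmul 𝒜 h₁ a b) =
      (TC.act h₃ a).comp (TC.act h₂ b) := by
    refine TC.ext (TC.continuous_act _ _)
      ((TC.continuous_act _ _).comp (TC.continuous_act _ _)) fun {p q} hij x y => ?_
    rw [AddMonoidHom.comp_apply, TC.act_mk h₄ _ hij rfl (by omega),
      TC.act_mk h₂ b hij rfl (by omega), TC.act_mk h₃ a _ (by omega : d + (e + p) = f + p)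
      (by omega), M.mul_act h₁ rfl (by omega)]
  rw [this, AddMonoidHom.comp_apply]

/-- The completed tensor product as a graded topological module. -/
@[reducible] def tensorG (M N : CMod 𝒜) : GMod 𝒜 where
  X := TC M N
  act h := TC.act h
  one_act := TC.one_act
  mul_act := TC.mul_act

theorem tensorG_act_mk {d n m i j i' : ℤ} (h : d + n = m) (a : 𝒜 d) (hij : i + j = n)
    (hi : d + i = i') (h' : i' + j = m) (x : M.X i) (y : N.X j) :
    (tensorG M N).act h a (TC.mk M N hij x y) = TC.mk M N h' (M.act hi a x) y :=
  TC.act_mk h a hij hi h' x y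

theorem tensorG_cont_act {d n m : ℤ} (h : d + n = m) (a : 𝒜 d) :
    Continuous ((tensorG M N).act h a) := TC.continuous_act h a

/-- The closure of `F ⊗ N + M ⊗ F'` as an open submodule. -/
def OpenSub.tensor (F : OpenSub M.toGMod) (F' : OpenSub N.toGMod) : OpenSub (tensorG M N) where
  N := TC.W F F'
  isOpen := TC.isOpen_W F F'
  act_mem {d j i} h a z hz := by
    refine TC.mem_of_mk (tensorG_cont_act h a) _
      (AddSubgroup.isClosed_of_isOpen _ (TC.isOpen_W F F' i)) F F' (fun {p q} hpq x y hxy => ?_) hz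
    rw [tensorG_act_mk h a hpq rfl (by omega)]
    exact TC.mk_mem_W _ (hxy.imp (fun hx => F.act_mem _ a hx) id)

theorem OpenSub.exists_tensor_le [EvenPeriodic 𝒜] (E : OpenSub (tensorG M N)) :
    ∃ (F : OpenSub M.toGMod) (F' : OpenSub N.toGMod), OpenSub.tensor F F' ≤ E := by
  obtain ⟨F₀, F₀', h₀⟩ := TC.exists_W (E.N 0) (E.isOpen 0)
  obtain ⟨F₁, F₁', h₁⟩ := TC.exists_W (E.N 1) (E.isOpen 1)
  have hle : ∀ {F G : OpenSub M.toGMod} {F' G' : OpenSub N.toGMod}, F ≤ G → F' ≤ G' →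
      ∀ n, TC.W F F' n ≤ TC.W G G' n := fun h h' n =>
    AddSubgroup.topologicalClosure_mono (AddSubgroup.map_mono (T.W_mono h h' n))
  refine ⟨F₀ ⊓ F₁, F₀' ⊓ F₁', fun n => le_of_zero_one (tensorG M N) _ _
    (OpenSub.tensor (F₀ ⊓ F₁) (F₀' ⊓ F₁')).act_mem E.act_mem ?_ ?_ n⟩
  · exact (hle (OpenSub.inf_le_left _ _) (OpenSub.inf_le_left _ _) 0).trans h₀
  · exact (hle (OpenSub.inf_le_right _ _) (OpenSub.inf_le_right _ _) 1).trans h₁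

/-- The completed tensor product `M ⊗̂ N` over `𝒜`. -/
@[reducible] def tensorC [EvenPeriodic 𝒜] (M N : CMod 𝒜) : CMod 𝒜 where
  toGMod := tensorG M N
  lin n U hU := by
    obtain ⟨p, -, hp⟩ := (TC.hasBasis n).mem_iff.1 hU
    exact ⟨OpenSub.tensor p.1 p.2, hp⟩
  adic E := by
    obtain ⟨F, F', h⟩ := OpenSub.exists_tensor_le E
    obtain ⟨p, hp⟩ := M.adic F
    refine ⟨p, fun {d j i} hd a ha z => ?_⟩
    refine TC.mem_of_mk_all (tensorG_cont_act hd a) _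
      (AddSubgroup.isClosed_of_isOpen _ (E.isOpen i)) (fun {r s} hrs x y => ?_) z
    rw [tensorG_act_mk hd a hrs rfl (by omega)]
    exact h _ (TC.mk_mem_W _ (Or.inl (hp _ a ha x)))

end Tensor

end

noncomputable section

section Unit

variable {k : Type w} {A : Type u} [CommRing k] [CommRing A] [Algebra k A]
  (𝒜 : ℤ → Submodule k A) [GradedAlgebra 𝒜] [IsLocalRing (𝒜 0)]

/-- The `𝔪`-adic filtration on the degree `d` part of `𝒜`. -/
@[reducible] def mbasis (d : ℤ) : AddGroupFilterBasis (𝒜 d) :=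
  addGroupFilterBasisOfComm {U | ∃ i : ℕ, U = (mpow 𝒜 i d : Set (𝒜 d))}
    ⟨_, 0, rfl⟩
    (by
      rintro _ _ ⟨i, rfl⟩ ⟨j, rfl⟩
      exact ⟨_, ⟨i ⊔ j, rfl⟩, fun z hz =>
        ⟨mpow_mono 𝒜 le_sup_left d hz, mpow_mono 𝒜 le_sup_right d hz⟩⟩)
    (by rintro _ ⟨i, rfl⟩; exact zero_mem _)
    (by
      rintro _ ⟨i, rfl⟩
      refine ⟨_, ⟨i, rfl⟩, ?_⟩
      rintro _ ⟨a, ha, b, hb, rfl⟩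
      exact add_mem ha hb)
    (by rintro _ ⟨i, rfl⟩; exact ⟨_, ⟨i, rfl⟩, fun _ ha => neg_mem ha⟩)

/-- The `𝔪`-adic topology on the degree `d` part of `𝒜`. -/
@[reducible] def mtop (d : ℤ) : TopologicalSpace (𝒜 d) := (mbasis 𝒜 d).topology

theorem mtop_group (d : ℤ) : @IsTopologicalAddGroup (𝒜 d) (mtop 𝒜 d) _ :=
  (mbasis 𝒜 d).isTopologicalAddGroup

/-- The `𝔪`-adic uniform structure on the degree `d` part of `𝒜`. -/
@[reducible] def munif (d : ℤ) : UniformSpace (𝒜 d) :=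
  @IsTopologicalAddGroup.rightUniformSpace (𝒜 d) _ (mtop 𝒜 d) (mtop_group 𝒜 d)

theorem munif_group (d : ℤ) : @IsUniformAddGroup (𝒜 d) (munif 𝒜 d) _ :=
  @isUniformAddGroup_of_addCommGroup (𝒜 d) _ (mtop 𝒜 d) (mtop_group 𝒜 d)

/-- The graded ring `𝒜` with its `𝔪`-adic topology, as a graded module over itself. -/
def unitG : GMod 𝒜 where
  X d := 𝒜 d
  unif := munif 𝒜
  ug := munif_group 𝒜
  act h := gmul 𝒜 h
  one_act _ _ := Subtype.ext (one_mul _)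
  mul_act _ _ _ _ _ _ _ := Subtype.ext (mul_assoc _ _ _)

theorem unitG_hasBasis (d : ℤ) : (𝓝 (0 : (unitG 𝒜).X d)).HasBasis (fun _ : ℕ => True)
    (fun i => (mpow 𝒜 i d : Set (𝒜 d))) := by
  refine ⟨fun U => ?_⟩
  refine ((mbasis 𝒜 d).nhds_zero_hasBasis.mem_iff (t := U)).trans ?_
  constructor
  · rintro ⟨_, ⟨i, rfl⟩, h⟩
    exact ⟨i, trivial, h⟩
  · rintro ⟨i, -, h⟩
    exact ⟨_, ⟨i, rfl⟩, h⟩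

/-- The powers of `𝔪` as open submodules of the unit. -/
def unitPow (i : ℕ) : OpenSub (unitG 𝒜) where
  N := mpow 𝒜 i
  isOpen d := AddSubgroup.isOpen_of_mem_nhds (G := (unitG 𝒜).X d) (g := 0) _
    ((unitG_hasBasis 𝒜 d).mem_of_mem trivial)
  act_mem _ _ _ hx := Ideal.mul_mem_left _ _ hx

theorem mem_mpow_zero (i : ℕ) (a : 𝒜 0) :
    a ∈ mpow 𝒜 i 0 ↔ a ∈ IsLocalRing.maximalIdeal (𝒜 0) ^ i := by
  rw [mem_mpow, maxIdeal, ← Ideal.map_pow]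
  constructor
  · intro h
    have key : ∀ x : A, x ∈ (IsLocalRing.maximalIdeal (𝒜 0) ^ i).map (algebraMap (𝒜 0) A) →
        ∀ c : A, DirectSum.decompose 𝒜 (c * x) 0 ∈ IsLocalRing.maximalIdeal (𝒜 0) ^ i := by
      intro x hx
      refine Submodule.span_induction (p := fun x _ => ∀ c : A, DirectSum.decompose 𝒜 (c * x) 0 ∈
        IsLocalRing.maximalIdeal (𝒜 0) ^ i) ?_ ?_ ?_ ?_ hx
      · rintro _ ⟨y, hy, rfl⟩ c
        have : DirectSum.decompose 𝒜 (c * algebraMap (𝒜 0) A y) 0 =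
            DirectSum.decompose 𝒜 c 0 * y :=
          Subtype.ext (DirectSum.coe_decompose_mul_of_right_mem_zero 𝒜 y.2)
        rw [this]; exact Ideal.mul_mem_left _ _ hy
      · simp
      · intro x y _ _ hx hy c
        rw [mul_add, DirectSum.decompose_add]
        exact add_mem (hx c) (hy c)
      · intro e x _ hx c
        rw [smul_eq_mul, ← mul_assoc]
        exact hx _
    have := key _ h 1
    rwa [one_mul, show DirectSum.decompose 𝒜 (a : A) 0 = a from
      Subtype.ext (DirectSum.decompose_of_mem_same 𝒜 a.2)] at this
  · intro h
    exact Ideal.mem_map_of_mem (algebraMap (𝒜 0) A) h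

theorem unit_zero_complete [IsAdicComplete (IsLocalRing.maximalIdeal (𝒜 0)) (𝒜 0)] :
    CompleteSpace ((unitG 𝒜).X 0) ∧ T2Space ((unitG 𝒜).X 0) := by
  have hI : @IsAdic (𝒜 0) _ (mtop 𝒜 0) (IsLocalRing.maximalIdeal (𝒜 0)) := by
    refine @IsTopologicalAddGroup.ext (𝒜 0) _ _ _ (mtop_group 𝒜 0) ?_ ?_
    · let := (IsLocalRing.maximalIdeal (𝒜 0)).adicTopology
      infer_instance
    · refine (unitG_hasBasis 𝒜 0).eq_of_same_basis ?_
      exact (IsLocalRing.maximalIdeal (𝒜 0)).hasBasis_nhds_zero_adic.congr (fun _ => Iff.rfl)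
        fun i _ => Set.ext fun a => (mem_mpow_zero 𝒜 i a).symm
  exact (@IsAdic.isAdicComplete_iff (𝒜 0) _ (munif 𝒜 0) (munif_group 𝒜 0) _ hI).1 inferInstance

theorem mpow_mul {i : ℕ} {d e f : ℤ} (h : d + e = f) (a : 𝒜 d) {b : 𝒜 e}
    (hb : b ∈ mpow 𝒜 i e) : gmul 𝒜 h a b ∈ mpow 𝒜 i f := Ideal.mul_mem_left _ _ hb

theorem unitG_cont_act {d j i : ℤ} (h : d + j = i) (a : 𝒜 d) :
    Continuous ((unitG 𝒜).act h a) := by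
  refine continuous_of_continuousAt_zero ((unitG 𝒜).act h a) ?_
  rw [ContinuousAt, map_zero, (unitG_hasBasis 𝒜 j).tendsto_iff (unitG_hasBasis 𝒜 i)]
  exact fun p _ => ⟨p, trivial, fun x hx => mpow_mul 𝒜 h a hx⟩

theorem unit_complete [EvenPeriodic 𝒜]
    [IsAdicComplete (IsLocalRing.maximalIdeal (𝒜 0)) (𝒜 0)] (d : ℤ) :
    CompleteSpace ((unitG 𝒜).X d) ∧ T2Space ((unitG 𝒜).X d) := by
  obtain ⟨hc, ht⟩ := unit_zero_complete 𝒜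
  rcases Int.even_or_odd' d with ⟨m, rfl | hm⟩
  · obtain ⟨a, b, hab⟩ := exists_unit_deg 𝒜 m
    have hba : (b : A) * a = 1 := by rw [mul_comm]; exact hab
    let f := (unitG 𝒜).act (by omega : -(2 * m) + 2 * m = 0) b
    let g := (unitG 𝒜).act (by omega : 2 * m + 0 = 2 * m) a
    have hf : Continuous f := unitG_cont_act 𝒜 _ _
    have hg : Continuous g := unitG_cont_act 𝒜 _ _
    have hfg : ∀ x, f (g x) = x := fun x => Subtype.ext (by
      change (b : A) * ((a : A) * Subtype.val (p := (· ∈ 𝒜 0)) x) =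
        Subtype.val (p := (· ∈ 𝒜 0)) x
      rw [← mul_assoc, hba, one_mul])
    have hgf : ∀ x, g (f x) = x := fun x => Subtype.ext (by
      change (a : A) * ((b : A) * Subtype.val (p := (· ∈ 𝒜 (2 * m))) x) =
        Subtype.val (p := (· ∈ 𝒜 (2 * m))) x
      rw [← mul_assoc, hab, one_mul])
    have hind : IsUniformInducing f :=
      IsUniformInducing.of_comp (g := g) (uniformContinuous_addMonoidHom_of_continuous hf)
        (uniformContinuous_addMonoidHom_of_continuous hg) (by
          rw [show (g ∘ f) = id from funext hgf]; exact .id)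
    refine ⟨(hind.completeSpace_congr (fun x => ⟨g x, hfg x⟩)).2 hc, ?_⟩
    exact T2Space.of_injective_continuous (f := f) (fun x y h => by
      rw [← hgf x, h, hgf y]) hf
  · have : Subsingleton ((unitG 𝒜).X d) := by
      have hb := EvenPeriodic.odd_eq_bot (𝒜 := 𝒜) d ⟨m, hm⟩
      refine ⟨fun x y => Subtype.ext ?_⟩
      have h : ∀ z : 𝒜 d, (z : A) = 0 := fun z => (Submodule.mem_bot k).1 (hb ▸ z.2)
      exact (h x).trans (h y).symm
    exact ⟨⟨fun {F} hF => ⟨0, by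
      intro U hU
      rw [show U = Set.univ from Subsingleton.eq_univ_of_nonempty ⟨0, mem_of_mem_nhds hU⟩]
      exact Filter.univ_mem⟩⟩, inferInstance⟩

/-- The unit object: `𝒜` with its `𝔪`-adic topology. -/
@[reducible] def unitC [EvenPeriodic 𝒜] [IsAdicComplete (IsLocalRing.maximalIdeal (𝒜 0)) (𝒜 0)] :
    CMod 𝒜 where
  toGMod := unitG 𝒜
  cpl d := (unit_complete 𝒜 d).1
  t0 d := by have := (unit_complete 𝒜 d).2; infer_instance
  lin d U hU := by
    obtain ⟨i, -, hi⟩ := (unitG_hasBasis 𝒜 d).mem_iff.1 hU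
    exact ⟨unitPow 𝒜 i, hi⟩
  adic E := by
    obtain ⟨i₀, -, h₀⟩ := (unitG_hasBasis 𝒜 0).mem_iff.1 ((E.isOpen 0).mem_nhds (zero_mem _))
    obtain ⟨i₁, -, h₁⟩ := (unitG_hasBasis 𝒜 1).mem_iff.1 ((E.isOpen 1).mem_nhds (zero_mem _))
    refine ⟨i₀ ⊔ i₁, fun {d j i} h a ha x => ?_⟩
    refine le_of_zero_one (unitG 𝒜) (mpow 𝒜 (i₀ ⊔ i₁)) E.N (unitPow 𝒜 _).act_mem E.act_mem
      ?_ ?_ i (Ideal.mul_mem_right _ _ ha)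
    · exact fun z hz => h₀ (mpow_mono 𝒜 le_sup_left 0 hz)
    · exact fun z hz => h₁ (mpow_mono 𝒜 le_sup_right 1 hz)

end Unit

end

noncomputable section

section Monoidal

variable {k : Type w} {A : Type u} [CommRing k] [CommRing A] [Algebra k A]
  {𝒜 : ℤ → Submodule k A} [GradedAlgebra 𝒜] [IsLocalRing (𝒜 0)] [EvenPeriodic 𝒜]

section Ext

variable {M N P R : CMod 𝒜} {n : ℤ} {Q : Type*} [AddCommGroup Q] [TopologicalSpace Q]
  [IsTopologicalAddGroup Q] [T2Space Q]

theorem TC.ext3 {f g : TC (tensorC M N) P n →+ Q} (hf : Continuous f) (hg : Continuous g)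
    (h : ∀ {i j l p : ℤ} (h₁ : i + j = l) (h₂ : l + p = n) (x : M.X i) (y : N.X j) (z : P.X p),
      f (TC.mk (tensorC M N) P h₂ (TC.mk M N h₁ x y) z) =
        g (TC.mk (tensorC M N) P h₂ (TC.mk M N h₁ x y) z)) : f = g := by
  refine TC.ext hf hg fun {l p} h₂ w z => ?_
  refine DFunLike.congr_fun (f := f.comp ((TC.mk (tensorC M N) P h₂).flip z))
    (g := g.comp ((TC.mk (tensorC M N) P h₂).flip z)) ?_ w
  exact TC.ext (hf.comp (TC.continuous_mk_left h₂ z)) (hg.comp (TC.continuous_mk_left h₂ z))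
    fun h₁ x y => h h₁ h₂ x y z

theorem TC.ext3' {f g : TC M (tensorC N P) n →+ Q} (hf : Continuous f) (hg : Continuous g)
    (h : ∀ {i j l p : ℤ} (h₁ : j + p = l) (h₂ : i + l = n) (x : M.X i) (y : N.X j) (z : P.X p),
      f (TC.mk M (tensorC N P) h₂ x (TC.mk N P h₁ y z)) =
        g (TC.mk M (tensorC N P) h₂ x (TC.mk N P h₁ y z))) : f = g := by
  refine TC.ext hf hg fun {i l} h₂ x w => ?_
  refine DFunLike.congr_fun (f := f.comp (TC.mk M (tensorC N P) h₂ x))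
    (g := g.comp (TC.mk M (tensorC N P) h₂ x)) ?_ w
  exact TC.ext (hf.comp (TC.continuous_mk_right h₂ x)) (hg.comp (TC.continuous_mk_right h₂ x))
    fun h₁ y z => h h₁ h₂ x y z

theorem TC.ext4 {f g : TC (tensorC (tensorC M N) P) R n →+ Q} (hf : Continuous f)
    (hg : Continuous g)
    (h : ∀ {i j l p q r : ℤ} (h₁ : i + j = l) (h₂ : l + p = q) (h₃ : q + r = n) (x : M.X i)
      (y : N.X j) (z : P.X p) (t : R.X r),
      f (TC.mk (tensorC (tensorC M N) P) R h₃
          (TC.mk (tensorC M N) P h₂ (TC.mk M N h₁ x y) z) t) =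
        g (TC.mk (tensorC (tensorC M N) P) R h₃
          (TC.mk (tensorC M N) P h₂ (TC.mk M N h₁ x y) z) t)) : f = g := by
  refine TC.ext hf hg fun {l p} h₃ w t => ?_
  refine DFunLike.congr_fun (f := f.comp ((TC.mk (tensorC (tensorC M N) P) R h₃).flip t))
    (g := g.comp ((TC.mk (tensorC (tensorC M N) P) R h₃).flip t)) ?_ w
  exact TC.ext3 (hf.comp (TC.continuous_mk_left h₃ t)) (hg.comp (TC.continuous_mk_left h₃ t))
    fun h₁ h₂ x y z => h h₁ h₂ h₃ x y z t

end Ext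

section TensorHom

variable {M N M' N' : CMod 𝒜}

/-- The bilinear map `(x, y) ↦ φ x ⊗ ψ y`. -/
def tensorHomBilin (φ : M ⟶ M') (ψ : N ⟶ N') (n : ℤ) : Bilin M N n (TC M' N' n) where
  b h := ((TC.mk M' N' h).compr₂ (AddMonoidHom.id _)).compl₂ (ψ.f _) |>.comp (φ.f _)
  bal h₁ h₂ h h' a x y := by
    simp only [AddMonoidHom.comp_apply, AddMonoidHom.compl₂_apply, AddMonoidHom.compr₂_apply,
      AddMonoidHom.id_apply, φ.map_act, ψ.map_act]
    exact TC.mk_bal h₁ h₂ h h' a _ _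
  cont L hL := by
    obtain ⟨F, F', hF⟩ := TC.exists_W L hL
    refine ⟨F.comap φ, F'.comap ψ, fun h x y hxy => ?_⟩
    exact hF (TC.mk_mem_W h hxy)

/-- The completed tensor product of morphisms. -/
def tensorHomC (φ : M ⟶ M') (ψ : N ⟶ N') : tensorC M N ⟶ tensorC M' N' where
  f n := TC.lift (tensorHomBilin φ ψ n)
  cont n := TC.continuous_lift _
  map_act {d n m} h a z := by
    refine DFunLike.congr_fun (f := (TC.lift (tensorHomBilin φ ψ m)).comp (TC.act h a))
      (g := (TC.act h a).comp (TC.lift (tensorHomBilin φ ψ n)))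
      (TC.ext ((TC.continuous_lift _).comp (TC.continuous_act h a))
        ((TC.continuous_act h a).comp (TC.continuous_lift _)) fun {i j} hij x y => ?_) z
    simp only [AddMonoidHom.comp_apply]
    rw [TC.act_mk h a hij rfl (by omega), TC.lift_mk, TC.lift_mk]
    simp only [tensorHomBilin, AddMonoidHom.comp_apply, AddMonoidHom.compl₂_apply,
      AddMonoidHom.compr₂_apply, AddMonoidHom.id_apply, φ.map_act]
    rw [TC.act_mk h a hij rfl (by omega)]

theorem tensorHomC_mk (φ : M ⟶ M') (ψ : N ⟶ N') {i j n : ℤ} (h : i + j = n) (x : M.X i)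
    (y : N.X j) : (tensorHomC φ ψ).f n (TC.mk M N h x y) = TC.mk M' N' h (φ.f i x) (ψ.f j y) :=
  TC.lift_mk _ _ _ _

end TensorHom

section Assoc

variable (M N P : CMod 𝒜)

/-- For fixed `z`, the bilinear map `(x, y) ↦ x ⊗ (y ⊗ z)`. -/
def assocInner {l p n : ℤ} (h : l + p = n) (z : P.X p) :
    Bilin M N l (TC M (tensorC N P) n) where
  b {i j} hij := (TC.mk M (tensorC N P) (by omega : i + (j + p) = n)).compl₂
    ((TC.mk N P rfl).flip z)
  bal {d i j i' j'} h₁ h₂ h h' a x y := by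
    simp only [AddMonoidHom.compl₂_apply, AddMonoidHom.flip_apply]
    rw [TC.mk_bal h₁ (by omega : d + (j + p) = j' + p) (by omega) (by omega),
      tensorG_act_mk _ a rfl h₂ rfl]
  cont L hL := by
    obtain ⟨F, E, hF⟩ := TC.exists_W L hL
    obtain ⟨G, G', hG⟩ := OpenSub.exists_tensor_le E
    refine ⟨F, G, fun {i j} h x y hxy => ?_⟩
    simp only [AddMonoidHom.compl₂_apply, AddMonoidHom.flip_apply]
    exact hF (TC.mk_mem_W _ (hxy.imp id fun hy => hG _ (TC.mk_mem_W rfl (Or.inl hy))))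

theorem assocInner_mk {l p n i j q : ℤ} (h : l + p = n) (z : P.X p) (hij : i + j = l)
    (hjp : j + p = q) (hn : i + q = n) (x : M.X i) (y : N.X j) :
    TC.lift (assocInner M N P h z) (TC.mk M N hij x y) =
      TC.mk M (tensorC N P) hn x (TC.mk N P hjp y z) := by
  subst hjp
  exact TC.lift_mk _ _ _ _

/-- The map `(w, z) ↦ α (w ⊗ z)` defining the associator. -/
def assocBilin (n : ℤ) : Bilin (tensorC M N) P n (TC M (tensorC N P) n) where
  b {l p} h := (AddMonoidHom.mk' (fun z => TC.lift (assocInner M N P h z)) fun z z' => by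
    refine TC.ext (TC.continuous_lift _) ((TC.continuous_lift _).add (TC.continuous_lift _))
      fun {i j} hij x y => ?_
    rw [AddMonoidHom.add_apply, assocInner_mk M N P h _ hij rfl (by omega),
      assocInner_mk M N P h _ hij rfl (by omega), assocInner_mk M N P h _ hij rfl (by omega),
      map_add, map_add]).flip
  bal {d l p l' p'} h₁ h₂ h h' a w z := by
    simp only [AddMonoidHom.flip_apply, AddMonoidHom.mk'_apply]
    refine DFunLike.congr_fun (f := (TC.lift (assocInner M N P h z)).comp (TC.act h₁ a))
      (g := TC.lift (assocInner M N P h' (P.act h₂ a z)))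
      (TC.ext ((TC.continuous_lift _).comp (TC.continuous_act h₁ a))
        (TC.continuous_lift _) fun {i j} hij x y => ?_) w
    rw [AddMonoidHom.comp_apply, TC.act_mk h₁ a hij rfl (by omega),
      assocInner_mk M N P h z _ rfl (by omega), assocInner_mk M N P h' _ hij rfl (by omega),
      ← TC.mk_bal rfl h₂ (by omega) (by omega) a y z,
      TC.mk_bal rfl (by omega : d + (j + p) = j + p') (by omega) (by omega),
      tensorG_act_mk _ a rfl rfl (by omega)]
  cont L hL := by
    obtain ⟨F, E, hF⟩ := TC.exists_W L hL
    obtain ⟨G, G', hG⟩ := OpenSub.exists_tensor_le E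
    refine ⟨OpenSub.tensor F G, G', fun {l p} h w z hwz => ?_⟩
    simp only [AddMonoidHom.flip_apply, AddMonoidHom.mk'_apply]
    rcases hwz with hw | hz
    · refine TC.mem_of_mk (TC.continuous_lift _) L (AddSubgroup.isClosed_of_isOpen _ hL) F G
        (fun {i j} hij x y hxy => ?_) hw
      rw [assocInner_mk M N P h z hij rfl (by omega)]
      exact hF (TC.mk_mem_W _ (hxy.imp id fun hy => hG _ (TC.mk_mem_W rfl (Or.inl hy))))
    · refine TC.mem_of_mk_all (TC.continuous_lift _) L (AddSubgroup.isClosed_of_isOpen _ hL)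
        (fun {i j} hij x y => ?_) w
      rw [assocInner_mk M N P h z hij rfl (by omega)]
      exact hF (TC.mk_mem_W _ (Or.inr (hG _ (TC.mk_mem_W rfl (Or.inr hz)))))

theorem assocBilin_mk {n i j l p q : ℤ} (h₁ : i + j = l) (h₂ : l + p = n) (h₃ : j + p = q)
    (h₄ : i + q = n) (x : M.X i) (y : N.X j) (z : P.X p) :
    TC.lift (assocBilin M N P n) (TC.mk (tensorC M N) P h₂ (TC.mk M N h₁ x y) z) =
      TC.mk M (tensorC N P) h₄ x (TC.mk N P h₃ y z) := by
  rw [TC.lift_mk]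
  exact assocInner_mk M N P h₂ z h₁ h₃ h₄ x y

/-- The associator. -/
def assocHom : tensorC (tensorC M N) P ⟶ tensorC M (tensorC N P) where
  f n := TC.lift (assocBilin M N P n)
  cont n := TC.continuous_lift _
  map_act {d n m} h a z := by
    refine DFunLike.congr_fun (f := (TC.lift (assocBilin M N P m)).comp (TC.act h a))
      (g := (TC.act h a).comp (TC.lift (assocBilin M N P n)))
      (TC.ext3 ((TC.continuous_lift _).comp (TC.continuous_act h a))
        ((TC.continuous_act h a).comp (TC.continuous_lift _))
        fun {i j l p} h₁ h₂ x y z => ?_) z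
    simp only [AddMonoidHom.comp_apply]
    rw [TC.act_mk h a h₂ rfl (by omega), tensorG_act_mk _ a h₁ rfl (by omega),
      assocBilin_mk M N P _ _ rfl (by omega), assocBilin_mk M N P _ _ rfl (by omega),
      TC.act_mk h a _ rfl (by omega)]

theorem assocHom_mk {n i j l p q : ℤ} (h₁ : i + j = l) (h₂ : l + p = n) (h₃ : j + p = q)
    (h₄ : i + q = n) (x : M.X i) (y : N.X j) (z : P.X p) :
    (assocHom M N P).f n (TC.mk (tensorC M N) P h₂ (TC.mk M N h₁ x y) z) =
      TC.mk M (tensorC N P) h₄ x (TC.mk N P h₃ y z) :=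
  assocBilin_mk M N P h₁ h₂ h₃ h₄ x y z

/-- For fixed `x`, the bilinear map `(y, z) ↦ (x ⊗ y) ⊗ z`. -/
def assocInner' {i q n : ℤ} (h : i + q = n) (x : M.X i) :
    Bilin N P q (TC (tensorC M N) P n) where
  b {j p} hjp := (TC.mk (tensorC M N) P (by omega : (i + j) + p = n)).comp (TC.mk M N rfl x)
  bal {d j p j' p'} h₁ h₂ h h' a y z := by
    simp only [AddMonoidHom.comp_apply]
    rw [← TC.mk_bal (by omega : d + (i + j) = i + j') h₂ (by omega) (by omega),
      tensorG_act_mk _ a rfl rfl (by omega), TC.mk_bal rfl h₁]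
  cont L hL := by
    obtain ⟨E, F, hF⟩ := TC.exists_W L hL
    obtain ⟨G, G', hG⟩ := OpenSub.exists_tensor_le E
    refine ⟨G', F, fun {j p} h y z hyz => ?_⟩
    simp only [AddMonoidHom.comp_apply]
    exact hF (TC.mk_mem_W _ (hyz.imp (fun hy => hG _ (TC.mk_mem_W rfl (Or.inr hy))) id))

theorem assocInner'_mk {i j p l q n : ℤ} (h : i + q = n) (x : M.X i) (hjp : j + p = q)
    (hij : i + j = l) (hn : l + p = n) (y : N.X j) (z : P.X p) :
    TC.lift (assocInner' M N P h x) (TC.mk N P hjp y z) =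
      TC.mk (tensorC M N) P hn (TC.mk M N hij x y) z := by
  subst hij
  exact TC.lift_mk _ _ _ _

/-- The map `(x, w) ↦ α⁻¹ (x ⊗ w)` defining the inverse of the associator. -/
def assocBilin' (n : ℤ) : Bilin M (tensorC N P) n (TC (tensorC M N) P n) where
  b {i q} h := AddMonoidHom.mk' (fun x => TC.lift (assocInner' M N P h x)) fun x x' => by
    refine TC.ext (TC.continuous_lift _) ((TC.continuous_lift _).add (TC.continuous_lift _))
      fun {j p} hjp y z => ?_
    rw [AddMonoidHom.add_apply, assocInner'_mk M N P h _ hjp rfl (by omega),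
      assocInner'_mk M N P h _ hjp rfl (by omega), assocInner'_mk M N P h _ hjp rfl (by omega),
      map_add, AddMonoidHom.add_apply, map_add, AddMonoidHom.add_apply]
  bal {d i q i' q'} h₁ h₂ h h' a x w := by
    simp only [AddMonoidHom.mk'_apply]
    refine DFunLike.congr_fun (f := TC.lift (assocInner' M N P h (M.act h₁ a x)))
      (g := (TC.lift (assocInner' M N P h' x)).comp (TC.act h₂ a))
      (TC.ext (TC.continuous_lift _) ((TC.continuous_lift _).comp (TC.continuous_act h₂ a))
        fun {j p} hjp y z => ?_) w
    rw [AddMonoidHom.comp_apply, TC.act_mk h₂ a hjp rfl (by omega),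
      assocInner'_mk M N P h _ hjp rfl (by omega), assocInner'_mk M N P h' _ _
        (by omega : i + (d + j) = i' + j) (by omega), TC.mk_bal h₁ rfl rfl (by omega)]
  cont L hL := by
    obtain ⟨E, F, hF⟩ := TC.exists_W L hL
    obtain ⟨G, G', hG⟩ := OpenSub.exists_tensor_le E
    refine ⟨G, OpenSub.tensor G' F, fun {i q} h x w hxw => ?_⟩
    simp only [AddMonoidHom.mk'_apply]
    rcases hxw with hx | hw
    · refine TC.mem_of_mk_all (TC.continuous_lift _) L (AddSubgroup.isClosed_of_isOpen _ hL)
        (fun {j p} hjp y z => ?_) w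
      rw [assocInner'_mk M N P h x hjp rfl (by omega)]
      exact hF (TC.mk_mem_W _ (Or.inl (hG _ (TC.mk_mem_W rfl (Or.inl hx)))))
    · refine TC.mem_of_mk (TC.continuous_lift _) L (AddSubgroup.isClosed_of_isOpen _ hL) G' F
        (fun {j p} hjp y z hyz => ?_) hw
      rw [assocInner'_mk M N P h x hjp rfl (by omega)]
      exact hF (TC.mk_mem_W _ (hyz.imp (fun hy => hG _ (TC.mk_mem_W rfl (Or.inr hy))) id))

theorem assocBilin'_mk {n i j l p q : ℤ} (h₁ : i + j = l) (h₂ : l + p = n) (h₃ : j + p = q)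
    (h₄ : i + q = n) (x : M.X i) (y : N.X j) (z : P.X p) :
    TC.lift (assocBilin' M N P n) (TC.mk M (tensorC N P) h₄ x (TC.mk N P h₃ y z)) =
      TC.mk (tensorC M N) P h₂ (TC.mk M N h₁ x y) z := by
  rw [TC.lift_mk]
  exact assocInner'_mk M N P h₄ x h₃ h₁ h₂ y z

/-- The inverse of the associator. -/
def assocInv : tensorC M (tensorC N P) ⟶ tensorC (tensorC M N) P where
  f n := TC.lift (assocBilin' M N P n)
  cont n := TC.continuous_lift _
  map_act {d n m} h a z := by
    refine DFunLike.congr_fun (f := (TC.lift (assocBilin' M N P m)).comp (TC.act h a))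
      (g := (TC.act h a).comp (TC.lift (assocBilin' M N P n)))
      (TC.ext3' ((TC.continuous_lift _).comp (TC.continuous_act h a))
        ((TC.continuous_act h a).comp (TC.continuous_lift _))
        fun {i j l p} h₁ h₂ x y z => ?_) z
    simp only [AddMonoidHom.comp_apply]
    rw [TC.act_mk h a h₂ rfl (by omega), assocBilin'_mk M N P rfl (by omega) h₁ _,
      assocBilin'_mk M N P rfl (by omega) h₁ _,
      TC.act_mk h a _ (by omega : d + (i + j) = d + i + j) (by omega),
      tensorG_act_mk _ a rfl rfl rfl]

theorem assocInv_mk {n i j l p q : ℤ} (h₁ : i + j = l) (h₂ : l + p = n) (h₃ : j + p = q)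
    (h₄ : i + q = n) (x : M.X i) (y : N.X j) (z : P.X p) :
    (assocInv M N P).f n (TC.mk M (tensorC N P) h₄ x (TC.mk N P h₃ y z)) =
      TC.mk (tensorC M N) P h₂ (TC.mk M N h₁ x y) z :=
  assocBilin'_mk M N P h₁ h₂ h₃ h₄ x y z

end Assoc

section HomExt

variable {M N P R Q : CMod 𝒜}

theorem CMod.hom_ext2 {f g : tensorC M N ⟶ Q}
    (h : ∀ {i j n : ℤ} (h : i + j = n) (x : M.X i) (y : N.X j),
      f.f n (TC.mk M N h x y) = g.f n (TC.mk M N h x y)) : f = g :=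
  CMod.Hom.ext (funext fun n => TC.ext (f.cont n) (g.cont n) fun h' x y => h h' x y)

theorem CMod.hom_ext3 {f g : tensorC (tensorC M N) P ⟶ Q}
    (h : ∀ {i j l p n : ℤ} (h₁ : i + j = l) (h₂ : l + p = n) (x : M.X i) (y : N.X j) (z : P.X p),
      f.f n (TC.mk (tensorC M N) P h₂ (TC.mk M N h₁ x y) z) =
        g.f n (TC.mk (tensorC M N) P h₂ (TC.mk M N h₁ x y) z)) : f = g :=
  CMod.Hom.ext (funext fun n => TC.ext3 (f.cont n) (g.cont n) fun h₁ h₂ x y z => h h₁ h₂ x y z)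

theorem CMod.hom_ext3' {f g : tensorC M (tensorC N P) ⟶ Q}
    (h : ∀ {i j l p n : ℤ} (h₁ : j + p = l) (h₂ : i + l = n) (x : M.X i) (y : N.X j) (z : P.X p),
      f.f n (TC.mk M (tensorC N P) h₂ x (TC.mk N P h₁ y z)) =
        g.f n (TC.mk M (tensorC N P) h₂ x (TC.mk N P h₁ y z))) : f = g :=
  CMod.Hom.ext (funext fun n => TC.ext3' (f.cont n) (g.cont n) fun h₁ h₂ x y z => h h₁ h₂ x y z)

theorem CMod.hom_ext4 {f g : tensorC (tensorC (tensorC M N) P) R ⟶ Q}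
    (h : ∀ {i j l p q r n : ℤ} (h₁ : i + j = l) (h₂ : l + p = q) (h₃ : q + r = n) (x : M.X i)
      (y : N.X j) (z : P.X p) (t : R.X r),
      f.f n (TC.mk (tensorC (tensorC M N) P) R h₃
          (TC.mk (tensorC M N) P h₂ (TC.mk M N h₁ x y) z) t) =
        g.f n (TC.mk (tensorC (tensorC M N) P) R h₃
          (TC.mk (tensorC M N) P h₂ (TC.mk M N h₁ x y) z) t)) : f = g :=
  CMod.Hom.ext (funext fun n => TC.ext4 (f.cont n) (g.cont n)
    fun h₁ h₂ h₃ x y z t => h h₁ h₂ h₃ x y z t)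

/-- The associativity isomorphism `(M ⊗ N) ⊗ P ≅ M ⊗ (N ⊗ P)`. -/
def assocIso (M N P : CMod 𝒜) : tensorC (tensorC M N) P ≅ tensorC M (tensorC N P) where
  hom := assocHom M N P
  inv := assocInv M N P
  hom_inv_id := CMod.hom_ext3 fun {i j l p n} h₁ h₂ x y z => by
    rw [CMod.comp_f, assocHom_mk M N P h₁ h₂ rfl (by omega), assocInv_mk M N P h₁ h₂,
      CMod.id_f]
  inv_hom_id := CMod.hom_ext3' fun {i j l p n} h₁ h₂ x y z => by
    rw [CMod.comp_f, assocInv_mk M N P rfl (by omega) h₁ h₂, assocHom_mk M N P _ _ h₁ h₂,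
      CMod.id_f]

end HomExt

section Braiding

variable (M N : CMod 𝒜)

/-- The sign `(-1) ^ (i * j)`. -/
def ksign (i j : ℤ) : ℤ := ((i * j).negOnePow : ℤˣ)

theorem ksign_mul_self (i j : ℤ) : ksign j i * ksign i j = 1 := by
  rw [ksign, ksign, mul_comm j i, ← Units.val_mul, ← Int.negOnePow_add, Int.negOnePow_even _ ⟨_, rfl⟩]
  rfl

theorem ksign_add_right (i j l : ℤ) : ksign i (j + l) = ksign i j * ksign i l := by
  rw [ksign, mul_add, Int.negOnePow_add]; rfl

theorem ksign_add_left (i j l : ℤ) : ksign (i + j) l = ksign i l * ksign j l := by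
  rw [ksign, add_mul, Int.negOnePow_add]; rfl

theorem ksign_zero_right (i : ℤ) : ksign i 0 = 1 := by simp [ksign]

theorem ksign_even {d : ℤ} (hd : Even d) (j : ℤ) : ksign d j = 1 := by
  rw [ksign, Int.negOnePow_even _ (hd.mul_right j)]; rfl

theorem ksign_even_right {d : ℤ} (hd : Even d) (j : ℤ) : ksign j d = 1 := by
  rw [ksign, Int.negOnePow_even _ (hd.mul_left j)]; rfl

theorem even_or_eq_zero {d : ℤ} (a : 𝒜 d) : Even d ∨ a = 0 := by
  rcases Int.even_or_odd d with h | h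
  · exact Or.inl h
  · exact Or.inr (Subtype.ext ((Submodule.mem_bot k).1
      (EvenPeriodic.odd_eq_bot (𝒜 := 𝒜) d h ▸ a.2)))

/-- The bilinear map `(x, y) ↦ (-1) ^ (|x| |y|) y ⊗ x`. -/
def braidBilin (n : ℤ) : Bilin M N n (TC N M n) where
  b {i j} h := ksign i j • (TC.mk N M (by omega : j + i = n)).flip
  bal {d i j i' j'} h₁ h₂ h h' a x y := by
    rcases even_or_eq_zero a with hd | rfl
    · have e₁ : ksign i' j = ksign i j := by rw [← h₁, ksign_add_left, ksign_even hd, one_mul]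
      have e₂ : ksign i j' = ksign i j := by
        rw [← h₂, ksign_add_right, ksign_even_right hd, one_mul]
      simp only [AddMonoidHom.smul_apply, AddMonoidHom.flip_apply]
      rw [TC.mk_bal h₂ h₁ (by omega) (by omega), e₁, e₂]
    · simp
  cont L hL := by
    obtain ⟨F, F', hF⟩ := TC.exists_W L hL
    refine ⟨F', F, fun h x y hxy => ?_⟩
    simp only [AddMonoidHom.smul_apply, AddMonoidHom.flip_apply]
    exact zsmul_mem (hF (TC.mk_mem_W _ hxy.symm)) _

theorem braidBilin_mk {i j n : ℤ} (h : i + j = n) (h' : j + i = n) (x : M.X i) (y : N.X j) :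
    TC.lift (braidBilin M N n) (TC.mk M N h x y) = ksign i j • TC.mk N M h' y x :=
  TC.lift_mk _ _ _ _

/-- The symmetry. -/
def braidHom : tensorC M N ⟶ tensorC N M where
  f n := TC.lift (braidBilin M N n)
  cont n := TC.continuous_lift _
  map_act {d n m} h a z := by
    refine DFunLike.congr_fun (f := (TC.lift (braidBilin M N m)).comp (TC.act h a))
      (g := (TC.act h a).comp (TC.lift (braidBilin M N n)))
      (TC.ext ((TC.continuous_lift _).comp (TC.continuous_act h a))
        ((TC.continuous_act h a).comp (TC.continuous_lift _))
        fun {i j} h₁ x y => ?_) z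
    simp only [AddMonoidHom.comp_apply]
    rcases even_or_eq_zero a with hd | rfl
    · rw [TC.act_mk h a h₁ rfl (by omega), braidBilin_mk M N _ (by omega),
        braidBilin_mk M N _ (by omega), map_zsmul, TC.act_mk h a _ rfl (by omega),
        ksign_add_left, ksign_even hd, one_mul, TC.mk_bal rfl rfl (by omega) (by omega)]
    · simp

theorem braidHom_mk {i j n : ℤ} (h : i + j = n) (h' : j + i = n) (x : M.X i) (y : N.X j) :
    (braidHom M N).f n (TC.mk M N h x y) = ksign i j • TC.mk N M h' y x :=
  braidBilin_mk M N h h' x y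

theorem braidHom_comp : braidHom M N ≫ braidHom N M = 𝟙 _ :=
  CMod.hom_ext2 fun {i j n} h x y => by
    rw [CMod.comp_f, braidHom_mk M N h (by omega), map_zsmul, braidHom_mk N M _ h, smul_smul,
      mul_comm, ksign_mul_self, one_smul, CMod.id_f]

/-- The symmetry isomorphism, with the Koszul sign. -/
def braidIso : tensorC M N ≅ tensorC N M where
  hom := braidHom M N
  inv := braidHom N M
  hom_inv_id := braidHom_comp M N
  inv_hom_id := braidHom_comp N M

end Braiding

section Unitors

variable [IsAdicComplete (IsLocalRing.maximalIdeal (𝒜 0)) (𝒜 0)] (M : CMod 𝒜)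

theorem CMod.exists_pow (F : OpenSub M.toGMod) : ∃ p : ℕ, ∀ {d j i : ℤ} (h : d + j = i),
    ∀ a ∈ (unitPow 𝒜 p).N d, ∀ x : M.X j, M.act h a x ∈ F.N i := M.adic F

/-- The bilinear map `(a, x) ↦ a x`. -/
def leftBilin (n : ℤ) : Bilin (unitC 𝒜) M n (M.X n) where
  b h := M.act h
  bal {d i j i' j'} h₁ h₂ h h' a r x := by
    have : (unitC 𝒜).act h₁ a r = gmul 𝒜 (by omega : i + d = i') r a :=
      Subtype.ext (mul_comm _ _)
    rw [this]
    exact M.mul_act _ h₂ h' h r a x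
  cont L hL := by
    obtain ⟨F, hF⟩ := M.exists_le L hL
    obtain ⟨p, hp⟩ := M.exists_pow F
    refine ⟨unitPow 𝒜 p, F, fun h a x hax => hF ?_⟩
    rcases hax with ha | hx
    · exact hp h a ha x
    · exact F.act_mem h a hx

theorem leftBilin_mk {i j n : ℤ} (h : i + j = n) (a : (unitC 𝒜).X i) (x : M.X j) :
    TC.lift (leftBilin M n) (TC.mk (unitC 𝒜) M h a x) = M.act h a x := TC.lift_mk _ _ _ _

/-- The left unitor. -/
def leftHom : tensorC (unitC 𝒜) M ⟶ M where
  f n := TC.lift (leftBilin M n)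
  cont n := TC.continuous_lift _
  map_act {d n m} h a z := by
    refine DFunLike.congr_fun (f := (TC.lift (leftBilin M m)).comp (TC.act h a))
      (g := (M.act h a).comp (TC.lift (leftBilin M n)))
      (TC.ext ((TC.continuous_lift _).comp (TC.continuous_act h a))
        ((M.continuous_act h a).comp (TC.continuous_lift _))
        fun {i j} h₁ r x => ?_) z
    simp only [AddMonoidHom.comp_apply]
    rw [TC.act_mk h a h₁ rfl (by omega), leftBilin_mk, leftBilin_mk]
    exact M.mul_act rfl h₁ h _ a r x

theorem leftHom_mk {i j n : ℤ} (h : i + j = n) (a : (unitC 𝒜).X i) (x : M.X j) :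
    (leftHom M).f n (TC.mk (unitC 𝒜) M h a x) = M.act h a x := leftBilin_mk M h a x

/-- The inverse of the left unitor. -/
def leftInv : M ⟶ tensorC (unitC 𝒜) M where
  f n := TC.mk (unitC 𝒜) M (zero_add n) (1 : 𝒜 0)
  cont n := TC.continuous_mk_right _ _
  map_act {d n m} h a x := by
    refine (TC.mk_bal (M := unitC 𝒜) (by omega : d + 0 = d) h h (zero_add m) a
      (1 : 𝒜 0) x).symm.trans ?_
    exact (tensorG_act_mk (M := unitC 𝒜) h a _ (by omega : d + 0 = d) h (1 : 𝒜 0) x).symm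

/-- The left unit isomorphism. -/
def leftIso : tensorC (unitC 𝒜) M ≅ M where
  hom := leftHom M
  inv := leftInv M
  hom_inv_id := CMod.hom_ext2 fun {i j n} h a x => by
    rw [CMod.comp_f, leftHom_mk, CMod.id_f]
    refine (TC.mk_bal (M := unitC 𝒜) (by omega : i + 0 = i) h h (zero_add n) a
      (1 : 𝒜 0) x).symm.trans ?_
    congr 2
    exact Subtype.ext (mul_one _)
  inv_hom_id := CMod.hom_ext fun n x => by
    rw [CMod.comp_f, CMod.id_f]
    exact (leftHom_mk M _ _ _).trans (M.one_act _ x)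

theorem rightHom_mk {i j n : ℤ} (h : i + j = n) (h' : j + i = n) (x : M.X i) (a : (unitC 𝒜).X j) :
    (braidHom M (unitC 𝒜) ≫ leftHom M).f n (TC.mk M (unitC 𝒜) h x a) = M.act h' a x := by
  rw [CMod.comp_f, braidHom_mk M _ h h', map_zsmul, leftHom_mk]
  rcases even_or_eq_zero (𝒜 := 𝒜) a with hd | rfl
  · rw [ksign_even_right hd, one_smul]
  · simp

/-- The right unit isomorphism. -/
def rightIso : tensorC M (unitC 𝒜) ≅ M := braidIso M (unitC 𝒜) ≪≫ leftIso M

theorem rightIso_mk {i j n : ℤ} (h : i + j = n) (h' : j + i = n) (x : M.X i) (a : (unitC 𝒜).X j) :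
    (rightIso M).hom.f n (TC.mk M (unitC 𝒜) h x a) = M.act h' a x := rightHom_mk M h h' x a

theorem leftIso_mk {i j n : ℤ} (h : i + j = n) (a : (unitC 𝒜).X i) (x : M.X j) :
    (leftIso M).hom.f n (TC.mk (unitC 𝒜) M h a x) = M.act h a x := leftBilin_mk M h a x

theorem assocIso_mk (M N P : CMod 𝒜) {n i j l p q : ℤ} (h₁ : i + j = l) (h₂ : l + p = n)
    (h₃ : j + p = q) (h₄ : i + q = n) (x : M.X i) (y : N.X j) (z : P.X p) :
    (assocIso M N P).hom.f n (TC.mk (tensorC M N) P h₂ (TC.mk M N h₁ x y) z) =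
      TC.mk M (tensorC N P) h₄ x (TC.mk N P h₃ y z) :=
  assocBilin_mk M N P h₁ h₂ h₃ h₄ x y z

end Unitors

section Instances

variable [IsAdicComplete (IsLocalRing.maximalIdeal (𝒜 0)) (𝒜 0)]

instance : MonoidalCategoryStruct (CMod 𝒜) where
  tensorObj := tensorC
  tensorHom := tensorHomC
  whiskerLeft M _ _ φ := tensorHomC (𝟙 M) φ
  whiskerRight φ N := tensorHomC φ (𝟙 N)
  tensorUnit := unitC 𝒜
  associator := assocIso
  leftUnitor := leftIso
  rightUnitor := rightIso

instance : MonoidalCategory (CMod 𝒜) := MonoidalCategory.ofTensorHom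
  (id_tensorHom_id := fun M N => CMod.hom_ext2 fun h x y => tensorHomC_mk (𝟙 M) (𝟙 N) h x y)
  (tensorHom_comp_tensorHom := fun f₁ f₂ g₁ g₂ => CMod.hom_ext2 fun h x y => by
    change (tensorHomC f₁ f₂ ≫ tensorHomC g₁ g₂).f _ _ = (tensorHomC _ _).f _ _
    rw [CMod.comp_f, tensorHomC_mk, tensorHomC_mk, tensorHomC_mk, CMod.comp_f, CMod.comp_f])
  (associator_naturality := fun {M N P M' N' P'} f₁ f₂ f₃ => by
    change tensorHomC (tensorHomC f₁ f₂) f₃ ≫ (assocIso M' N' P').hom =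
      (assocIso M N P).hom ≫ tensorHomC f₁ (tensorHomC f₂ f₃)
    refine CMod.hom_ext3 fun {i j l p n} h₁ h₂ x y z => ?_
    repeat rw [CMod.comp_f]
    rw [assocIso_mk M N P h₁ h₂ rfl (by omega), tensorHomC_mk, tensorHomC_mk, tensorHomC_mk,
      tensorHomC_mk, assocIso_mk M' N' P' h₁ h₂ rfl (by omega)])
  (leftUnitor_naturality := fun {M N} f => by
    change tensorHomC (𝟙 (unitC 𝒜)) f ≫ (leftIso N).hom = (leftIso M).hom ≫ f
    refine CMod.hom_ext2 fun {i j n} h a x => ?_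
    repeat rw [CMod.comp_f]
    rw [tensorHomC_mk, leftIso_mk, CMod.id_f, leftIso_mk]
    exact (f.map_act _ _ _).symm)
  (rightUnitor_naturality := fun {M N} f => by
    change tensorHomC f (𝟙 (unitC 𝒜)) ≫ (rightIso N).hom = (rightIso M).hom ≫ f
    refine CMod.hom_ext2 fun {i j n} h x a => ?_
    repeat rw [CMod.comp_f]
    rw [tensorHomC_mk, rightIso_mk _ _ (by omega), CMod.id_f, rightIso_mk _ _ (by omega)]
    exact (f.map_act _ _ _).symm)
  (pentagon := fun M N P R => by
    change tensorHomC (assocIso M N P).hom (𝟙 R) ≫ (assocIso M (tensorC N P) R).hom ≫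
      tensorHomC (𝟙 M) (assocIso N P R).hom =
      (assocIso (tensorC M N) P R).hom ≫ (assocIso M N (tensorC P R)).hom
    refine CMod.hom_ext4 fun {i j l p q r n} h₁ h₂ h₃ x y z t => ?_
    repeat rw [CMod.comp_f]
    rw [tensorHomC_mk, CMod.id_f, assocIso_mk M N P h₁ h₂ rfl (by omega),
      assocIso_mk M (tensorC N P) R _ _ rfl (by omega), tensorHomC_mk, CMod.id_f,
      assocIso_mk N P R _ _ rfl (by omega), assocIso_mk (tensorC M N) P R h₂ h₃ rfl (by omega),
      assocIso_mk M N (tensorC P R) h₁ _ (by omega : j + (p + r) = j + p + r) (by omega)])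
  (triangle := fun M N => by
    change (assocIso M (unitC 𝒜) N).hom ≫ tensorHomC (𝟙 M) (leftIso N).hom =
      tensorHomC (rightIso M).hom (𝟙 N)
    refine CMod.hom_ext3 fun {i j l p n} h₁ h₂ x a z => ?_
    repeat rw [CMod.comp_f]
    rw [assocIso_mk _ _ _ h₁ h₂ rfl (by omega), tensorHomC_mk, tensorHomC_mk, leftIso_mk,
      rightIso_mk M h₁ (by omega), CMod.id_f, CMod.id_f]
    exact (TC.mk_bal _ _ _ _ _ _ _).symm)

instance : SymmetricCategory (CMod 𝒜) where
  braiding := braidIso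
  braiding_naturality_right M N P f := by
    change tensorHomC (𝟙 M) f ≫ braidHom M P = braidHom M N ≫ tensorHomC f (𝟙 M)
    refine CMod.hom_ext2 fun {i j n} h x y => ?_
    repeat rw [CMod.comp_f]
    rw [tensorHomC_mk, braidHom_mk _ _ _ (by omega), braidHom_mk _ _ _ (by omega), map_zsmul,
      tensorHomC_mk]
  braiding_naturality_left {M N} f P := by
    change tensorHomC f (𝟙 P) ≫ braidHom N P = braidHom M P ≫ tensorHomC (𝟙 P) f
    refine CMod.hom_ext2 fun {i j n} h x y => ?_
    repeat rw [CMod.comp_f]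
    rw [tensorHomC_mk, braidHom_mk _ _ _ (by omega), braidHom_mk _ _ _ (by omega), map_zsmul,
      tensorHomC_mk]
  hexagon_forward M N P := by
    change (assocIso M N P).hom ≫ braidHom M (tensorC N P) ≫ (assocIso N P M).hom =
      tensorHomC (braidHom M N) (𝟙 P) ≫ (assocIso N M P).hom ≫ tensorHomC (𝟙 N) (braidHom M P)
    refine CMod.hom_ext3 fun {i j l p n} h₁ h₂ x y z => ?_
    repeat rw [CMod.comp_f]
    rw [assocIso_mk _ _ _ h₁ h₂ rfl (by omega), braidHom_mk _ _ _ (by omega), map_zsmul,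
      assocIso_mk _ _ _ _ _ (by omega : p + i = i + p) (by omega), tensorHomC_mk,
      braidHom_mk M N h₁ (by omega : j + i = l),
      map_zsmul, AddMonoidHom.smul_apply, map_zsmul, assocIso_mk _ _ _ _ _ rfl (by omega),
      map_zsmul, tensorHomC_mk, braidHom_mk M P _ (by omega), map_zsmul, smul_smul,
      ← ksign_add_right, CMod.id_f, CMod.id_f]
  hexagon_reverse M N P := by
    change assocInv M N P ≫ braidHom (tensorC M N) P ≫ assocInv P M N =
      tensorHomC (𝟙 M) (braidHom N P) ≫ assocInv M P N ≫ tensorHomC (braidHom M P) (𝟙 N)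
    refine CMod.hom_ext3' fun {i j l p n} h₁ h₂ x y z => ?_
    repeat rw [CMod.comp_f]
    rw [assocInv_mk _ _ _ rfl (by omega) h₁ h₂, braidHom_mk _ _ _ (by omega), map_zsmul,
      assocInv_mk _ _ _ (by omega : p + i = i + p) (by omega) rfl (by omega), tensorHomC_mk,
      braidHom_mk N P h₁ (by omega), map_zsmul, map_zsmul,
      assocInv_mk _ _ _ rfl (by omega) _ _,
      map_zsmul, tensorHomC_mk, braidHom_mk M P _ (by omega), map_zsmul, AddMonoidHom.smul_apply,
      smul_smul, ksign_add_left, mul_comm, CMod.id_f, CMod.id_f]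
  symmetry := braidHom_comp

end Instances

end Monoidal

end

noncomputable section

section FnTop

variable {X : Type*} [TopologicalSpace X] [CompactSpace X] {Y : Type*} [AddCommGroup Y]
  [UniformSpace Y] [IsUniformAddGroup Y]

instance : IsUniformAddGroup C(X, Y) := by
  refine ⟨ContinuousMap.isUniformEmbedding_uniformFunOfFun.isUniformInducing.uniformContinuous_iff.2
    ?_⟩
  exact (uniformContinuous_sub (α := UniformFun X Y)).comp
    (ContinuousMap.isUniformEmbedding_uniformFunOfFun.uniformContinuous.prodMap
      ContinuousMap.isUniformEmbedding_uniformFunOfFun.uniformContinuous)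

theorem fn_hasBasis : (𝓝 (0 : C(X, Y))).HasBasis (fun V : Set Y => V ∈ 𝓝 (0 : Y))
    (fun V => {f : C(X, Y) | ∀ x, f x ∈ V}) := by
  have h : (uniformity Y).HasBasis (fun V : Set Y => V ∈ 𝓝 (0 : Y))
      (fun V => (fun p : Y × Y => p.2 - p.1) ⁻¹' V) := by
    rw [uniformity_eq_comap_nhds_zero]
    exact (𝓝 (0 : Y)).basis_sets.comap _
  have := nhds_basis_uniformity' (x := (0 : C(X, Y))) h.compactConvergenceUniformity_of_compact
  refine this.congr (fun _ => Iff.rfl) fun V _ => ?_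
  ext f
  refine forall_congr' fun x => ?_
  change f x - 0 ∈ V ↔ f x ∈ V
  rw [sub_zero]

/-- The functions with values in a subgroup. -/
def fnSub (X : Type*) [TopologicalSpace X] (L : AddSubgroup Y) : AddSubgroup C(X, Y) where
  carrier := {f | ∀ x, f x ∈ L}
  zero_mem' _ := L.zero_mem
  add_mem' hf hg x := L.add_mem (hf x) (hg x)
  neg_mem' hf x := L.neg_mem (hf x)

theorem mem_fnSub {L : AddSubgroup Y} {f : C(X, Y)} : f ∈ fnSub X L ↔ ∀ x, f x ∈ L := Iff.rfl

theorem isOpen_fnSub (L : AddSubgroup Y) (hL : IsOpen (L : Set Y)) :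
    IsOpen (fnSub X L : Set C(X, Y)) :=
  AddSubgroup.isOpen_of_mem_nhds (g := 0) _ (fn_hasBasis.mem_of_mem (hL.mem_nhds L.zero_mem))

theorem exists_fnSub [NonarchimedeanAddGroup Y] {U : Set C(X, Y)} (hU : U ∈ 𝓝 0) :
    ∃ L : AddSubgroup Y, IsOpen (L : Set Y) ∧ (fnSub X L : Set C(X, Y)) ⊆ U := by
  obtain ⟨V, hV, h⟩ := fn_hasBasis.mem_iff.1 hU
  obtain ⟨L, hL⟩ := NonarchimedeanAddGroup.is_nonarchimedean V hV
  exact ⟨L, L.isOpen, fun f hf => h fun x => hL (hf x)⟩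

instance [NonarchimedeanAddGroup Y] : NonarchimedeanAddGroup C(X, Y) where
  is_nonarchimedean U hU := by
    obtain ⟨L, hL, h⟩ := exists_fnSub hU
    exact ⟨⟨fnSub X L, isOpen_fnSub L hL⟩, h⟩

end FnTop

section Joint

variable {Y Y' Z : Type*} [AddCommGroup Y] [TopologicalSpace Y] [IsTopologicalAddGroup Y]
  [AddCommGroup Y'] [TopologicalSpace Y'] [IsTopologicalAddGroup Y'] [AddCommGroup Z]
  [TopologicalSpace Z] [NonarchimedeanAddGroup Z]

/-- A criterion for the joint continuity of a biadditive map. -/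
theorem continuous_biadd (b : Y →+ Y' →+ Z)
    (h : ∀ L : AddSubgroup Z, IsOpen (L : Set Z) → ∃ (K : AddSubgroup Y) (K' : AddSubgroup Y'),
      IsOpen (K : Set Y) ∧ IsOpen (K' : Set Y') ∧ ∀ x y, (x ∈ K ∨ y ∈ K') → b x y ∈ L) :
    Continuous fun p : Y × Y' => b p.1 p.2 := by
  refine continuous_iff_continuousAt.2 fun ⟨x, y⟩ => ?_
  intro U hU
  have hU' : (fun z => b x y + z) ⁻¹' U ∈ 𝓝 (0 : Z) := by
    refine (continuous_const.add continuous_id).continuousAt.preimage_mem_nhds ?_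
    simpa using hU
  obtain ⟨L, hL⟩ := NonarchimedeanAddGroup.is_nonarchimedean _ hU'
  obtain ⟨K, K', hK, hK', hb⟩ := h L L.isOpen
  have hx : (fun x' => x' - x) ⁻¹' (K : Set Y) ∈ 𝓝 x :=
    (continuous_id.sub continuous_const).continuousAt.preimage_mem_nhds
      (by simpa using hK.mem_nhds K.zero_mem)
  have hy : (fun y' => y' - y) ⁻¹' (K' : Set Y') ∈ 𝓝 y :=
    (continuous_id.sub continuous_const).continuousAt.preimage_mem_nhds
      (by simpa using hK'.mem_nhds K'.zero_mem)
  refine Filter.mem_map.2 (Filter.mem_of_superset (prod_mem_nhds hx hy) ?_)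
  rintro ⟨x', y'⟩ ⟨h1, h2⟩
  have h3 : b (x' - x) y' + b x (y' - y) ∈ L :=
    L.add_mem (hb _ _ (Or.inl h1)) (hb _ _ (Or.inr h2))
  have h4 := hL h3
  simp only [Set.mem_preimage] at h4 ⊢
  convert h4 using 1
  simp only [map_sub, AddMonoidHom.sub_apply]
  abel

end Joint

section Fn

variable {k : Type w} {A : Type u} [CommRing k] [CommRing A] [Algebra k A]
  {𝒜 : ℤ → Submodule k A} [GradedAlgebra 𝒜] [IsLocalRing (𝒜 0)] [EvenPeriodic 𝒜]

theorem TC.continuous_mk (M N : CMod 𝒜) {i j n : ℤ} (h : i + j = n) :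
    Continuous fun p : M.X i × N.X j => TC.mk M N h p.1 p.2 :=
  continuous_biadd _ fun L hL => by
    obtain ⟨F, F', hF⟩ := TC.exists_W L hL
    exact ⟨F.N i, F'.N j, F.isOpen i, F'.isOpen j, fun x y hxy => hF (TC.mk_mem_W h hxy)⟩

variable [IsAdicComplete (IsLocalRing.maximalIdeal (𝒜 0)) (𝒜 0)]

/-- The action of `𝒜` on `M`, for elements of `𝒜` regarded as elements of the unit object. -/
def uact (M : CMod 𝒜) {d j i : ℤ} (h : d + j = i) : (unitC 𝒜).X d →+ M.X j →+ M.X i := M.act h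

theorem continuous_uact (M : CMod 𝒜) {d j i : ℤ} (h : d + j = i) :
    Continuous fun p : (unitC 𝒜).X d × M.X j => uact M h p.1 p.2 :=
  continuous_biadd _ fun L hL => by
    obtain ⟨F, hF⟩ := M.exists_le L hL
    obtain ⟨p, hp⟩ := M.exists_pow F
    refine ⟨(unitPow 𝒜 p).N d, F.N j, (unitPow 𝒜 p).isOpen d, F.isOpen j, fun x y hxy => hF ?_⟩
    rcases hxy with hx | hy
    · exact hp h x hx y
    · exact F.act_mem h x hy

variable {X : Type u} [TopologicalSpace X]

/-- Pointwise action of functions with values in `𝒜` on functions with values in `M`. -/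
def pact (M : CMod 𝒜) {d j i : ℤ} (h : d + j = i) :
    C(X, (unitC 𝒜).X d) →+ C(X, M.X j) →+ C(X, M.X i) :=
  AddMonoidHom.mk' (fun α => AddMonoidHom.mk'
    (fun f => ⟨fun x => uact M h (α x) (f x),
      (continuous_uact M h).comp (α.continuous.prodMk f.continuous)⟩)
    (fun f f' => by ext x; exact map_add (uact M h (α x)) (f x) (f' x)))
    (fun α α' => by
      ext f x
      exact (DFunLike.congr_fun (map_add (uact M h) (α x) (α' x)) (f x)).trans rfl)

@[simp] theorem pact_apply (M : CMod 𝒜) {d j i : ℤ} (h : d + j = i) (α : C(X, (unitC 𝒜).X d))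
    (f : C(X, M.X j)) (x : X) : pact M h α f x = uact M h (α x) (f x) := rfl

theorem uact_mul (M : CMod 𝒜) {d e f j l i : ℤ} (h₁ : d + e = f) (h₂ : e + j = l)
    (h₃ : d + l = i) (h₄ : f + j = i) (a : (unitC 𝒜).X d) (b : (unitC 𝒜).X e) (x : M.X j) :
    uact M h₄ (uact (unitC 𝒜) h₁ a b) x = uact M h₃ a (uact M h₂ b x) :=
  M.mul_act h₁ h₂ h₃ h₄ a b x

theorem uact_unit_comm {d e f : ℤ} (h₁ : d + e = f) (h₂ : e + d = f) (a : (unitC 𝒜).X d)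
    (b : (unitC 𝒜).X e) : uact (unitC 𝒜) h₁ a b = uact (unitC 𝒜) h₂ b a :=
  Subtype.ext (mul_comm _ _)

theorem uact_one (M : CMod 𝒜) {j : ℤ} (h : 0 + j = j) (x : M.X j) :
    uact M h (1 : 𝒜 0) x = x := M.one_act h x

/-- Addition of constant functions. -/
def constHom (X : Type*) [TopologicalSpace X] (Y : Type*) [AddCommGroup Y] [TopologicalSpace Y]
    [IsTopologicalAddGroup Y] : Y →+ C(X, Y) :=
  AddMonoidHom.mk' (ContinuousMap.const X) fun _ _ => rfl

@[simp] theorem constHom_apply {X : Type*} [TopologicalSpace X] {Y : Type*} [AddCommGroup Y]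
    [TopologicalSpace Y] [IsTopologicalAddGroup Y] (y : Y) (x : X) : constHom X Y y x = y := rfl

variable [CompactSpace X] [T2Space X] [TotallyDisconnectedSpace X]

variable (X) in
/-- The continuous functions from `X` to `M`, degree by degree, with the topology of uniform
convergence and the pointwise action of `𝒜`, before checking completeness. -/
@[reducible] def fnG (M : CMod 𝒜) : GMod 𝒜 where
  X n := C(X, M.X n)
  act {d j i} h := (pact M h).comp (constHom X ((unitC 𝒜).X d))
  one_act h f := by
    refine ContinuousMap.ext fun x => ?_
    exact M.one_act h (f x)
  mul_act h₁ h₂ h₃ h₄ a b f := by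
    refine ContinuousMap.ext fun x => ?_
    exact M.mul_act h₁ h₂ h₃ h₄ a b (f x)

variable (X) in
/-- The functions with values in an open submodule. -/
def OpenSub.fn {M : CMod 𝒜} (F : OpenSub M.toGMod) : OpenSub (fnG X M) where
  N n := fnSub X (F.N n)
  isOpen n := isOpen_fnSub _ (F.isOpen n)
  act_mem h a _ hf x := F.act_mem h a (hf x)

theorem OpenSub.exists_fn_le_deg (M : CMod 𝒜) (n : ℤ) {U : Set C(X, M.X n)} (hU : U ∈ 𝓝 0) :
    ∃ F : OpenSub M.toGMod, (fnSub X (F.N n) : Set C(X, M.X n)) ⊆ U := by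
  obtain ⟨L, hL, h⟩ := exists_fnSub hU
  obtain ⟨F, hF⟩ := M.exists_le L hL
  exact ⟨F, fun f hf => h fun x => hF (hf x)⟩

theorem OpenSub.exists_fn_le (M : CMod 𝒜) (E : OpenSub (fnG X M)) :
    ∃ F : OpenSub M.toGMod, F.fn X ≤ E := by
  obtain ⟨F₀, h₀⟩ := OpenSub.exists_fn_le_deg M 0 ((E.isOpen 0).mem_nhds (zero_mem _))
  obtain ⟨F₁, h₁⟩ := OpenSub.exists_fn_le_deg M 1 ((E.isOpen 1).mem_nhds (zero_mem _))
  refine ⟨F₀ ⊓ F₁, fun n => le_of_zero_one (fnG X M) _ _ ((F₀ ⊓ F₁).fn X).act_mem E.act_mem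
    ?_ ?_ n⟩
  · exact fun f hf => h₀ fun x => (hf x).1
  · exact fun f hf => h₁ fun x => (hf x).2

variable (X) in
/-- The complete module `C(X, M)` of continuous functions from `X` to `M`. -/
@[reducible] def fnC (M : CMod 𝒜) : CMod 𝒜 where
  toGMod := fnG X M
  lin n U hU := by
    obtain ⟨F, hF⟩ := OpenSub.exists_fn_le_deg M n hU
    exact ⟨F.fn X, hF⟩
  adic E := by
    obtain ⟨F, hF⟩ := OpenSub.exists_fn_le M E
    obtain ⟨p, hp⟩ := M.adic F
    exact ⟨p, fun h a ha f => hF _ fun x => hp h a ha (f x)⟩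

end Fn

end

noncomputable section

section Phi

variable {k : Type w} {A : Type u} [CommRing k] [CommRing A] [Algebra k A]
  {𝒜 : ℤ → Submodule k A} [GradedAlgebra 𝒜] [IsLocalRing (𝒜 0)] [EvenPeriodic 𝒜]
  [IsAdicComplete (IsLocalRing.maximalIdeal (𝒜 0)) (𝒜 0)]
  {X : Type u} [TopologicalSpace X] [CompactSpace X] [T2Space X] [TotallyDisconnectedSpace X]

variable (𝒜) in
/-- The element `1` of the unit object. -/
def uone : (unitC 𝒜).X 0 := (1 : 𝒜 0)

theorem uone_uact (M : CMod 𝒜) {n : ℤ} (h : 0 + n = n) (m : M.X n) :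
    uact M h (uone 𝒜) m = m := M.one_act _ m

theorem uact_uone {d : ℤ} (h : d + 0 = d) (a : (unitC 𝒜).X d) :
    uact (unitC 𝒜) h a (uone 𝒜) = a := Subtype.ext (mul_one _)

variable (𝒜) in
/-- The powers of `𝔪`. -/
def uPow (p : ℕ) : OpenSub (unitC 𝒜).toGMod := unitPow 𝒜 p

theorem uPow_mono {p q : ℕ} (h : p ≤ q) : uPow 𝒜 q ≤ uPow 𝒜 p := fun d => mpow_mono 𝒜 h d

variable (X 𝒜) in
/-- The functions with values in a power of `𝔪`. -/
def cPow (p : ℕ) : OpenSub (fnC X (unitC 𝒜)).toGMod := OpenSub.fn X (uPow 𝒜 p)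

variable (X) in
/-- The bilinear map `(α, m) ↦ (x ↦ α(x) m)`. -/
def evBilin (M : CMod 𝒜) (n : ℤ) : Bilin (fnC X (unitC 𝒜)) M n C(X, M.X n) where
  b {i j} h := (pact M h).compl₂ (constHom X (M.X j))
  bal {d i j i' j'} h₁ h₂ h h' a α m := by
    refine ContinuousMap.ext fun x => ?_
    change uact M h (uact (unitC 𝒜) h₁ (show (unitC 𝒜).X d from a) (α x)) m =
      uact M h' (α x) (uact M h₂ (show (unitC 𝒜).X d from a) m)
    rw [uact_unit_comm h₁ (by omega : i + d = i'), uact_mul M _ h₂ h' h]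
  cont L hL := by
    obtain ⟨F, hF⟩ := OpenSub.exists_fn_le_deg (X := X) M n (hL.mem_nhds L.zero_mem)
    obtain ⟨p, hp⟩ := M.exists_pow F
    refine ⟨cPow 𝒜 X p, F, fun h α m hαm => hF fun x => ?_⟩
    rcases hαm with hα | hm
    · exact hp h _ (hα x) m
    · exact F.act_mem h _ hm

/-- The comparison map `C(X, 𝒜) ⊗̂ M ⟶ C(X, M)`, `α ⊗ m ↦ (x ↦ α(x) m)`. -/
def phi (M : CMod 𝒜) (n : ℤ) : TC (fnC X (unitC 𝒜)) M n →+ C(X, M.X n) := TC.lift (evBilin X M n)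

theorem continuous_phi (M : CMod 𝒜) (n : ℤ) : Continuous (phi (X := X) M n) :=
  TC.continuous_lift _

theorem phi_mk (M : CMod 𝒜) {i j n : ℤ} (h : i + j = n) (α : C(X, (unitC 𝒜).X i)) (m : M.X j)
    (x : X) : phi M n (TC.mk (fnC X (unitC 𝒜)) M h α m) x = uact M h (α x) m :=
  (DFunLike.congr_fun (TC.lift_mk (evBilin X M n) h α m) x).trans rfl

/-- The characteristic function of a point of a discrete quotient. -/
def ind (S : DiscreteQuotient X) (s : S) : C(X, (unitC 𝒜).X 0) :=
  ⟨fun x => by classical exact if S.proj x = s then uone 𝒜 else 0, by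
    classical
    exact (continuous_of_discreteTopology (f := fun t : S =>
      if t = s then uone 𝒜 else 0)).comp S.proj_continuous⟩

theorem ind_apply (S : DiscreteQuotient X) (s : S) (x : X) [Decidable (S.proj x = s)] :
    ind (𝒜 := 𝒜) S s x = if S.proj x = s then uone 𝒜 else 0 := by
  rw [ind, ContinuousMap.coe_mk]
  congr

instance (S : DiscreteQuotient X) : Fintype S := Fintype.ofFinite S

theorem uact_ind (M : CMod 𝒜) {n : ℤ} (S : DiscreteQuotient X) (s : S) (x : X) (m : M.X n)
    [Decidable (S.proj x = s)] :
    uact M (zero_add n) (ind (𝒜 := 𝒜) S s x) m = if S.proj x = s then m else 0 := by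
  rw [ind_apply]
  split_ifs with hs
  · exact uone_uact M _ m
  · rw [map_zero, AddMonoidHom.zero_apply]

/-- The element of `C(X, 𝒜) ⊗̂ M` given by a function on a discrete quotient. -/
def stepT (M : CMod 𝒜) {n : ℤ} (S : DiscreteQuotient X) (m : S → M.X n) :
    TC (fnC X (unitC 𝒜)) M n := ∑ s : S, TC.mk (fnC X (unitC 𝒜)) M (zero_add n) (ind S s) (m s)

theorem phi_stepT (M : CMod 𝒜) {n : ℤ} (S : DiscreteQuotient X) (m : S → M.X n) (x : X) :
    phi M n (stepT M S m) x = m (S.proj x) := by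
  classical
  rw [stepT, map_sum, ContinuousMap.sum_apply, Finset.sum_eq_single (S.proj x)]
  · rw [phi_mk, uact_ind, if_pos rfl]
  · intro s _ hs
    rw [phi_mk, uact_ind, if_neg hs.symm]
  · simp

theorem ind_ofLE {S S' : DiscreteQuotient X} (h : S ≤ S') (s' : S') [DecidableEq S'] :
    (ind S' s' : C(X, (unitC 𝒜).X 0)) =
      ∑ s : S with DiscreteQuotient.ofLE h s = s', ind (𝒜 := 𝒜) S s := by
  classical
  refine ContinuousMap.ext fun x => ?_
  rw [ContinuousMap.sum_apply, Finset.sum_filter]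
  rw [Finset.sum_eq_single (S.proj x)]
  · rw [DiscreteQuotient.ofLE_proj, ind_apply, ind_apply, if_pos rfl]
  · intro s _ hs
    rw [ind_apply, if_neg hs.symm]
    split_ifs <;> rfl
  · simp

theorem stepT_ofLE (M : CMod 𝒜) {n : ℤ} {S S' : DiscreteQuotient X} (h : S ≤ S')
    (m : S' → M.X n) : stepT M S (fun s => m (DiscreteQuotient.ofLE h s)) = stepT M S' m := by
  classical
  rw [stepT, stepT, ← Finset.sum_fiberwise Finset.univ (DiscreteQuotient.ofLE h)]
  refine Finset.sum_congr rfl fun s' _ => ?_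
  rw [ind_ofLE h s', map_sum, AddMonoidHom.finsetSum_apply]
  refine Finset.sum_congr rfl fun s hs => ?_
  rw [(Finset.mem_filter.1 hs).2]

theorem stepT_add (M : CMod 𝒜) {n : ℤ} (S : DiscreteQuotient X) (m m' : S → M.X n) :
    stepT M S (m + m') = stepT M S m + stepT M S m' := by
  rw [stepT, stepT, stepT, ← Finset.sum_add_distrib]
  exact Finset.sum_congr rfl fun s _ => map_add _ _ _

theorem stepT_neg (M : CMod 𝒜) {n : ℤ} (S : DiscreteQuotient X) (m : S → M.X n) :
    stepT M S (-m) = -stepT M S m := by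
  rw [stepT, stepT, ← Finset.sum_neg_distrib]
  exact Finset.sum_congr rfl fun s _ => map_neg _ _

/-- The elements congruent to a step function modulo `L`. -/
def stepSub (M : CMod 𝒜) (n : ℤ) (L : AddSubgroup (TC (fnC X (unitC 𝒜)) M n)) :
    AddSubgroup (TC (fnC X (unitC 𝒜)) M n) where
  carrier := {z | ∃ (S : DiscreteQuotient X) (m : S → M.X n), z - stepT M S m ∈ L}
  zero_mem' := ⟨⊤, (fun _ => 0), by
    have : stepT M (⊤ : DiscreteQuotient X) (fun _ => (0 : M.X n)) = 0 :=
      Finset.sum_eq_zero fun s _ => map_zero _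
    rw [this, sub_zero]; exact L.zero_mem⟩
  add_mem' := by
    rintro z z' ⟨S, m, h⟩ ⟨S', m', h'⟩
    refine ⟨S ⊓ S', (fun s => m (DiscreteQuotient.ofLE inf_le_left s)) +
      (fun s => m' (DiscreteQuotient.ofLE inf_le_right s)), ?_⟩
    rw [stepT_add, stepT_ofLE, stepT_ofLE, add_sub_add_comm]
    exact L.add_mem h h'
  neg_mem' := by
    rintro z ⟨S, m, h⟩
    refine ⟨S, -m, ?_⟩
    rw [stepT_neg, neg_sub_neg, ← neg_sub]
    exact L.neg_mem h

/-- The discrete quotient on which a function is constant modulo an open subgroup. -/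
def quotOf {Y : Type*} [AddCommGroup Y] [TopologicalSpace Y] [IsTopologicalAddGroup Y]
    (f : C(X, Y)) (L : AddSubgroup Y) (hL : IsOpen (L : Set Y)) : DiscreteQuotient X where
  toSetoid :=
    { r := fun x y => f x - f y ∈ L
      iseqv := ⟨fun x => by rw [sub_self]; exact L.zero_mem,
        fun {x y} h => by rw [← neg_sub]; exact L.neg_mem h,
        fun {x y z} h h' => by
          rw [← sub_add_sub_cancel (f x) (f y) (f z)]; exact L.add_mem h h'⟩ }
  isOpen_setOfPred_rel x := hL.preimage (continuous_const.sub f.continuous)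

theorem quotOf_out {Y : Type*} [AddCommGroup Y] [TopologicalSpace Y] [IsTopologicalAddGroup Y]
    (f : C(X, Y)) (L : AddSubgroup Y) (hL : IsOpen (L : Set Y)) (x : X) :
    f x - f (Quotient.out ((quotOf f L hL).proj x)) ∈ L := by
  have : (quotOf f L hL).toSetoid (Quotient.out ((quotOf f L hL).proj x)) x :=
    Quotient.exact (Quotient.out_eq _)
  exact (quotOf f L hL).toSetoid.symm this

theorem mem_stepSub (M : CMod 𝒜) (p : ℕ) (F : OpenSub M.toGMod) {n : ℤ}
    (z : TC (fnC X (unitC 𝒜)) M n) :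
    z ∈ stepSub M n (TC.W (cPow 𝒜 X p) F n) := by
  set L := TC.W (cPow 𝒜 X p) F n with hL
  have hopen : IsOpen (stepSub M n L : Set (TC (fnC X (unitC 𝒜)) M n)) :=
    AddSubgroup.isOpen_mono (fun z hz => ⟨⊤, (fun _ => 0), by
      have : stepT M (⊤ : DiscreteQuotient X) (fun _ => (0 : M.X n)) = 0 :=
        Finset.sum_eq_zero fun s _ => map_zero _
      rw [this, sub_zero]; exact hz⟩) (TC.isOpen_W (cPow 𝒜 X p) F n)
  refine TC.mem_of_mk_all (f := AddMonoidHom.id _) continuous_id _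
    (AddSubgroup.isClosed_of_isOpen _ hopen) (fun {i j} h α m => ?_) z
  let S := quotOf α ((uPow 𝒜 p).N i) ((uPow 𝒜 p).isOpen i)
  refine ⟨S, fun s => uact M h (α (Quotient.out s)) m, ?_⟩
  have key : stepT M S (fun s => uact M h (α (Quotient.out s)) m) =
      TC.mk (fnC X (unitC 𝒜)) M h (∑ s : S, (fnC X (unitC 𝒜)).act (add_zero i)
        (α (Quotient.out s) : (unitC 𝒜).X i) (ind S s)) m := by
    rw [stepT, map_sum, AddMonoidHom.finsetSum_apply]
    exact Finset.sum_congr rfl fun s _ => (TC.mk_bal _ _ _ _ _ _ _).symm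
  rw [key, AddMonoidHom.id_apply, ← AddMonoidHom.sub_apply, ← map_sub]
  refine TC.mk_mem_W h (Or.inl fun x => ?_)
  have hx : (∑ s : S, (fnC X (unitC 𝒜)).act (add_zero i)
      (α (Quotient.out s) : (unitC 𝒜).X i) (ind S s)) x = α (Quotient.out (S.proj x)) := by
    classical
    rw [ContinuousMap.sum_apply, Finset.sum_eq_single (S.proj x)]
    · change uact (unitC 𝒜) (add_zero i) (α (Quotient.out (S.proj x)))
        (ind (𝒜 := 𝒜) S (S.proj x) x) = _
      rw [ind_apply, if_pos rfl, uact_uone]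
    · intro s _ hs
      change uact (unitC 𝒜) (add_zero i) (α (Quotient.out s)) (ind (𝒜 := 𝒜) S s x) = _
      rw [ind_apply, if_neg hs.symm, map_zero]
    · simp
  rw [ContinuousMap.sub_apply, hx]
  exact quotOf_out α _ _ x

theorem phi_mem_fnSub (M : CMod 𝒜) {p : ℕ} {F : OpenSub M.toGMod}
    (hp : ∀ {d j i : ℤ} (h : d + j = i), ∀ a ∈ (uPow 𝒜 p).N d, ∀ x : M.X j,
      M.act h a x ∈ F.N i) {n : ℤ} {z : TC (fnC X (unitC 𝒜)) M n}
    (hz : z ∈ TC.W (cPow 𝒜 X p) F n) : phi M n z ∈ fnSub X (F.N n) := by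
  refine TC.mem_of_mk (continuous_phi M n) _
    (AddSubgroup.isClosed_of_isOpen _ (isOpen_fnSub _ (F.isOpen n))) _ _
    (fun {i j} h α m hαm x => ?_) hz
  rw [phi_mk]
  rcases hαm with hα | hm
  · exact hp h _ (hα x) m
  · exact F.act_mem h _ hm

theorem mem_W_of_phi (M : CMod 𝒜) {p : ℕ} {F : OpenSub M.toGMod}
    (hp : ∀ {d j i : ℤ} (h : d + j = i), ∀ a ∈ (uPow 𝒜 p).N d, ∀ x : M.X j,
      M.act h a x ∈ F.N i) {n : ℤ} {z : TC (fnC X (unitC 𝒜)) M n}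
    (hz : phi M n z ∈ fnSub X (F.N n)) : z ∈ TC.W (cPow 𝒜 X p) F n := by
  obtain ⟨S, m, h⟩ := mem_stepSub M p F z
  have h1 := phi_mem_fnSub M hp h
  rw [map_sub] at h1
  have h2 := (fnSub X (F.N n)).sub_mem hz h1
  rw [sub_sub_cancel] at h2
  have h3 : stepT M S m ∈ TC.W (cPow 𝒜 X p) F n := by
    refine sum_mem fun s _ => TC.mk_mem_W _ (Or.inr ?_)
    obtain ⟨x, rfl⟩ := S.proj_surjective s
    rw [← phi_stepT M S m x]
    exact h2 x
  have := add_mem h h3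
  rwa [sub_add_cancel] at this

theorem exists_uPow_le (F : OpenSub (unitC 𝒜).toGMod) : ∃ p : ℕ, uPow 𝒜 p ≤ F := by
  obtain ⟨p, hp⟩ := (unitC 𝒜).exists_pow F
  refine ⟨p, fun n a ha => ?_⟩
  have := hp (add_zero n) a ha (uone 𝒜)
  rwa [show (unitC 𝒜).act (add_zero n) a (uone 𝒜) = a from Subtype.ext (mul_one _)] at this

/-- Neighbourhoods of `0` in `C(X, 𝒜) ⊗̂ M`. -/
theorem exists_fn_le_tensor (M : CMod 𝒜) (n : ℤ) {U : Set (TC (fnC X (unitC 𝒜)) M n)}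
    (hU : U ∈ 𝓝 0) : ∃ F : OpenSub M.toGMod, ∀ z, phi M n z ∈ fnSub X (F.N n) → z ∈ U := by
  obtain ⟨⟨E, F⟩, -, h⟩ := (TC.hasBasis n).mem_iff.1 hU
  obtain ⟨E', hE'⟩ := OpenSub.exists_fn_le (unitC 𝒜) E
  obtain ⟨p, hp⟩ := exists_uPow_le E'
  obtain ⟨q, hq⟩ := M.exists_pow F
  refine ⟨F, fun z hz => h ?_⟩
  have hq' : ∀ {d j i : ℤ} (h : d + j = i), ∀ a ∈ (uPow 𝒜 (p ⊔ q)).N d, ∀ x : M.X j,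
      M.act h a x ∈ F.N i := fun {d j i} h a ha x =>
    hq h a (mpow_mono 𝒜 le_sup_right d ha) x
  refine TC.mem_of_mk (f := AddMonoidHom.id _) continuous_id _
    (AddSubgroup.isClosed_of_isOpen _ (TC.isOpen_W E F n)) _ _
    (fun {i j} hij α m hαm => ?_) (mem_W_of_phi M hq' hz)
  exact TC.mk_mem_W hij (hαm.imp (fun hα => hE' _ fun x =>
    hp _ (mpow_mono 𝒜 le_sup_left i (hα x))) id)

theorem phi_injective (M : CMod 𝒜) (n : ℤ) : Function.Injective (phi (X := X) M n) := by
  rw [injective_iff_map_eq_zero]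
  intro z hz
  by_contra hne
  obtain ⟨F, hF⟩ := exists_fn_le_tensor M n
    (isClosed_singleton.isOpen_compl.mem_nhds (show (0 : TC (fnC X (unitC 𝒜)) M n) ∈ {z}ᶜ from
      fun h => hne h.symm))
  exact hF z (by rw [hz]; exact zero_mem _) rfl

theorem phi_isUniformInducing (M : CMod 𝒜) (n : ℤ) : IsUniformInducing (phi (X := X) M n) := by
  have h : Filter.comap (phi (X := X) M n) (𝓝 0) = 𝓝 0 := by
    refine le_antisymm (fun U hU => ?_) ?_
    · obtain ⟨F, hF⟩ := exists_fn_le_tensor M n hU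
      exact ⟨_, (isOpen_fnSub _ (F.isOpen n)).mem_nhds (zero_mem _), hF⟩
    · have := (continuous_phi (X := X) M n).tendsto 0
      rw [map_zero] at this
      exact this.le_comap
  refine ⟨?_⟩
  rw [uniformity_eq_comap_nhds_zero, uniformity_eq_comap_nhds_zero, Filter.comap_comap, ← h,
    Filter.comap_comap]
  congr 1
  ext p
  simp

theorem phi_surjective (M : CMod 𝒜) (n : ℤ) : Function.Surjective (phi (X := X) M n) := by
  have hd : DenseRange (phi (X := X) M n) := by
    intro f
    rw [mem_closure_iff_nhds]
    intro U hU
    have hU' : (fun g => f - g) ⁻¹' U ∈ 𝓝 (0 : C(X, M.X n)) :=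
      (continuous_const.sub continuous_id).continuousAt.preimage_mem_nhds (by simpa using hU)
    obtain ⟨F, hF⟩ := OpenSub.exists_fn_le_deg M n hU'
    let S := quotOf f (F.N n) (F.isOpen n)
    refine ⟨phi M n (stepT M S fun s => f (Quotient.out s)), ?_, _, rfl⟩
    have : f - phi M n (stepT M S fun s => f (Quotient.out s)) ∈ fnSub X (F.N n) := fun x => by
      rw [ContinuousMap.sub_apply, phi_stepT]
      exact quotOf_out f _ _ x
    have := hF this
    rwa [Set.mem_preimage, sub_sub_cancel] at this
  have hc : IsClosed (Set.range (phi (X := X) M n)) :=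
    (phi_isUniformInducing M n).isComplete_range.isClosed
  intro f
  have := hd f
  rwa [hc.closure_eq] at this

/-- The isomorphism `C(X, 𝒜) ⊗̂ M ≅ C(X, M)`, degree by degree. -/
def phiEquiv (M : CMod 𝒜) (n : ℤ) : TC (fnC X (unitC 𝒜)) M n ≃+ C(X, M.X n) :=
  AddEquiv.ofBijective (phi M n) ⟨phi_injective M n, phi_surjective M n⟩

theorem phiEquiv_apply (M : CMod 𝒜) {n : ℤ} (z : TC (fnC X (unitC 𝒜)) M n) :
    phiEquiv M n z = phi M n z := rfl

@[simp] theorem phi_symm (M : CMod 𝒜) {n : ℤ} (f : C(X, M.X n)) :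
    phi M n ((phiEquiv M n).symm f) = f := (phiEquiv M n).apply_symm_apply f

@[simp] theorem symm_phi (M : CMod 𝒜) {n : ℤ} (z : TC (fnC X (unitC 𝒜)) M n) :
    (phiEquiv M n).symm (phi M n z) = z := (phiEquiv M n).symm_apply_apply z

theorem continuous_phi_symm (M : CMod 𝒜) (n : ℤ) :
    Continuous (phiEquiv (X := X) M n).symm := by
  rw [(phi_isUniformInducing M n).isInducing.continuous_iff]
  have : phi M n ∘ (phiEquiv (X := X) M n).symm = id := funext fun f => phi_symm M f
  rw [this]
  exact continuous_id

end Phi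

end

noncomputable section

section Action

variable {k : Type w} {A : Type u} [CommRing k] [CommRing A] [Algebra k A]
  (𝒜 : ℤ → Submodule k A) [GradedAlgebra 𝒜] [IsLocalRing (𝒜 0)]

/-- A right action of the topological group `G` on the ring `A` by ring automorphisms (that is, an
action of `Gᵐᵒᵖ`, written `a ^ g = op g • a`) is a continuous action on the graded ring `𝒜` if it
preserves degrees and if it is (jointly) continuous in every degree for the `𝔪`-adic topology. -/
class ContAction (G : Type u) [Group G] [TopologicalSpace G] [MulSemiringAction Gᵐᵒᵖ A] :
    Prop where
  smul_mem : ∀ (g : G) {d : ℤ} {a : A}, a ∈ 𝒜 d → MulOpposite.op g • a ∈ 𝒜 d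
  continuous_smul : ∀ d : ℤ, @Continuous (𝒜 d × G) (𝒜 d)
    (@instTopologicalSpaceProd _ _ (mtop 𝒜 d) _) (mtop 𝒜 d)
    fun p => ⟨MulOpposite.op p.2 • (p.1 : A), smul_mem p.2 p.1.2⟩

variable {G : Type u} [Group G] [TopologicalSpace G] [MulSemiringAction Gᵐᵒᵖ A]
  [ContAction 𝒜 G] [EvenPeriodic 𝒜] [IsAdicComplete (IsLocalRing.maximalIdeal (𝒜 0)) (𝒜 0)]

/-- The action `a ↦ a ^ g` on homogeneous elements. -/
def gact (g : G) (d : ℤ) : 𝒜 d →+ 𝒜 d :=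
  AddMonoidHom.mk' (fun a => ⟨MulOpposite.op g • (a : A), ContAction.smul_mem g a.2⟩)
    fun _ _ => Subtype.ext (smul_add _ _ _)

/-- The action `a ↦ a ^ g` on the unit object. -/
def ract (g : G) (d : ℤ) : (unitC 𝒜).X d →+ (unitC 𝒜).X d := gact 𝒜 g d

theorem continuous_ract (d : ℤ) :
    Continuous fun p : (unitC 𝒜).X d × G => ract 𝒜 p.2 d p.1 :=
  ContAction.continuous_smul (𝒜 := 𝒜) (G := G) d

theorem ract_one (d : ℤ) (a : (unitC 𝒜).X d) : ract 𝒜 (1 : G) d a = a :=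
  Subtype.ext (one_smul Gᵐᵒᵖ (Subtype.val (p := (· ∈ 𝒜 d)) a))

theorem ract_mul (g h : G) (d : ℤ) (a : (unitC 𝒜).X d) :
    ract 𝒜 h d (ract 𝒜 g d a) = ract 𝒜 (g * h) d a :=
  Subtype.ext (mul_smul (MulOpposite.op h) (MulOpposite.op g)
    (Subtype.val (p := (· ∈ 𝒜 d)) a)).symm

theorem ract_uact (g : G) {d e f : ℤ} (h : d + e = f) (a : (unitC 𝒜).X d)
    (b : (unitC 𝒜).X e) :
    ract 𝒜 g f (uact (unitC 𝒜) h a b) = uact (unitC 𝒜) h (ract 𝒜 g d a) (ract 𝒜 g e b) :=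
  Subtype.ext (smul_mul' (MulOpposite.op g) (Subtype.val (p := (· ∈ 𝒜 d)) a)
    (Subtype.val (p := (· ∈ 𝒜 e)) b))

theorem ract_uone (g : G) : ract 𝒜 g 0 (uone 𝒜) = uone 𝒜 :=
  Subtype.ext (smul_one (MulOpposite.op g))

theorem smul_maxIdeal_le (g : G) :
    (maxIdeal 𝒜).map (MulSemiringAction.toRingHom Gᵐᵒᵖ A (MulOpposite.op g)) ≤ maxIdeal 𝒜 := by
  rw [maxIdeal, Ideal.map_map, Ideal.map_le_iff_le_comap]
  intro a ha
  have h1 : gact 𝒜 g 0 a ∈ IsLocalRing.maximalIdeal (𝒜 0) := by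
    rw [IsLocalRing.mem_maximalIdeal, mem_nonunits_iff] at ha ⊢
    intro hu
    obtain ⟨b, hb⟩ := isUnit_iff_exists_inv.1 hu
    refine ha (isUnit_iff_exists_inv.2 ⟨gact 𝒜 g⁻¹ 0 b, Subtype.ext ?_⟩)
    have h2 : (MulOpposite.op g • (a : A)) * (b : A) = 1 := congrArg Subtype.val hb
    have h3 : MulOpposite.op g⁻¹ • ((MulOpposite.op g • (a : A)) * (b : A)) = (1 : A) := by
      rw [h2, smul_one]
    rw [smul_mul', smul_smul, ← MulOpposite.op_mul, mul_inv_cancel, MulOpposite.op_one,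
      one_smul] at h3
    exact h3
  exact Ideal.mem_map_of_mem (algebraMap (𝒜 0) A) h1

theorem ract_mem (g : G) (p : ℕ) (d : ℤ) {a : (unitC 𝒜).X d} (ha : a ∈ (uPow 𝒜 p).N d) :
    ract 𝒜 g d a ∈ (uPow 𝒜 p).N d := by
  have h := Ideal.mem_map_of_mem (MulSemiringAction.toRingHom Gᵐᵒᵖ A (MulOpposite.op g))
    (show Subtype.val (p := (· ∈ 𝒜 d)) a ∈ maxIdeal 𝒜 ^ p from ha)
  rw [Ideal.map_pow] at h
  exact Ideal.pow_right_mono (smul_maxIdeal_le 𝒜 g) p h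

end Action

section Twisted

variable {k : Type w} {A : Type u} [CommRing k] [CommRing A] [Algebra k A]
  (𝒜 : ℤ → Submodule k A) [GradedAlgebra 𝒜] [IsLocalRing (𝒜 0)] [EvenPeriodic 𝒜]
  [IsAdicComplete (IsLocalRing.maximalIdeal (𝒜 0)) (𝒜 0)]
  (G : Type u) [Group G] [TopologicalSpace G] [IsTopologicalGroup G] [CompactSpace G] [T2Space G]
  [TotallyDisconnectedSpace G] [MulSemiringAction Gᵐᵒᵖ A] [ContAction 𝒜 G]

/-- Complete twisted right `𝒜`-`G`-modules: a complete Hausdorff filtered `𝒜`-module with a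
continuous right action `x ↦ x g` of `G` that satisfies `(a x) g = a ^ g (x g)`. -/
structure TwMod where
  M : CMod 𝒜
  ract : G → ∀ n : ℤ, M.X n →+ M.X n
  ract_one : ∀ n x, ract 1 n x = x
  ract_mul : ∀ g h n x, ract h n (ract g n x) = ract (g * h) n x
  semilinear : ∀ (g : G) {d j i : ℤ} (h : d + j = i) (a : 𝒜 d) (x : M.X j),
    ract g i (M.act h a x) = M.act h (gact 𝒜 g d a) (ract g j x)
  continuous_ract : ∀ n, Continuous fun p : M.X n × G => ract p.2 n p.1

namespace TwMod

variable {𝒜 G}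

/-- The morphisms are the equivariant continuous `𝒜`-linear maps. -/
@[ext] structure Hom (V W : TwMod 𝒜 G) where
  hom : V.M ⟶ W.M
  equi : ∀ g n x, hom.f n (V.ract g n x) = W.ract g n (hom.f n x)

instance : Category (TwMod 𝒜 G) where
  Hom := Hom
  id V := ⟨𝟙 V.M, fun _ _ _ => rfl⟩
  comp φ ψ := ⟨φ.hom ≫ ψ.hom, fun g n x => by
    rw [CMod.comp_f, φ.equi, ψ.equi, CMod.comp_f]⟩

theorem hom_ext {V W : TwMod 𝒜 G} {φ ψ : V ⟶ W} (h : φ.hom = ψ.hom) : φ = ψ := Hom.ext h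

/-- An isomorphism of modules whose underlying map is equivariant. -/
def mkIso {V W : TwMod 𝒜 G} (e : V.M ≅ W.M)
    (he : ∀ g n x, e.hom.f n (V.ract g n x) = W.ract g n (e.hom.f n x)) : V ≅ W where
  hom := ⟨e.hom, he⟩
  inv := ⟨e.inv, fun g n x => by
    have h1 : ∀ y, e.inv.f n (e.hom.f n y) = y := fun y => by
      rw [← CMod.comp_f, e.hom_inv_id, CMod.id_f]
    have h2 : ∀ y, e.hom.f n (e.inv.f n y) = y := fun y => by
      rw [← CMod.comp_f, e.inv_hom_id, CMod.id_f]
    rw [← h1 (V.ract g n (e.inv.f n x)), he, h2]⟩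
  hom_inv_id := hom_ext e.hom_inv_id
  inv_hom_id := hom_ext e.inv_hom_id

variable (V W U : TwMod 𝒜 G)

theorem continuous_ract_left (g : G) (n : ℤ) : Continuous (V.ract g n) :=
  (V.continuous_ract n).comp (continuous_id.prodMk continuous_const)

theorem continuous_ract_right (n : ℤ) (x : V.M.X n) : Continuous fun g => V.ract g n x :=
  (V.continuous_ract n).comp (continuous_const.prodMk continuous_id)

/-- The map `x ↦ (g ↦ x g)`. -/
def orb (n : ℤ) : V.M.X n →+ C(G, V.M.X n) :=
  AddMonoidHom.mk' (fun x => ⟨fun g => V.ract g n x, V.continuous_ract_right n x⟩)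
    fun _ _ => ContinuousMap.ext fun g => map_add (V.ract g n) _ _

@[simp] theorem orb_apply (n : ℤ) (x : V.M.X n) (g : G) : V.orb n x g = V.ract g n x := rfl

theorem continuous_orb (n : ℤ) : Continuous (V.orb n) :=
  ContinuousMap.continuous_of_continuous_uncurry _ (V.continuous_ract n)

/-- The largest `G`-stable submodule of an open submodule is open. -/
def core (F : OpenSub V.M.toGMod) : OpenSub V.M.toGMod where
  N n := (fnSub G (F.N n)).comap (V.orb n)
  isOpen n := (isOpen_fnSub _ (F.isOpen n)).preimage (V.continuous_orb n)
  act_mem {d j i} h a x hx g := by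
    change V.ract g i (V.M.act h a x) ∈ F.N i
    rw [V.semilinear]
    exact F.act_mem h _ (hx g)

theorem core_mem {F : OpenSub V.M.toGMod} {n : ℤ} {x : V.M.X n} (hx : x ∈ (V.core F).N n)
    (g : G) : V.ract g n x ∈ F.N n := hx g

/-- The map `(x, y) ↦ (g ↦ x g ⊗ y g)`. -/
def orbMk {i j n : ℤ} (h : i + j = n) : V.M.X i →+ W.M.X j →+ C(G, TC V.M W.M n) :=
  AddMonoidHom.mk' (fun x => AddMonoidHom.mk'
    (fun y => ⟨fun g => TC.mk V.M W.M h (V.ract g i x) (W.ract g j y),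
      (TC.continuous_mk V.M W.M h).comp
        ((V.continuous_ract_right i x).prodMk (W.continuous_ract_right j y))⟩)
    fun y y' => ContinuousMap.ext fun g => by
      rw [ContinuousMap.add_apply, ContinuousMap.coe_mk, ContinuousMap.coe_mk,
        ContinuousMap.coe_mk, map_add, map_add])
    fun x x' => by
      refine AddMonoidHom.ext fun y => ContinuousMap.ext fun g => ?_
      change TC.mk V.M W.M h (V.ract g i (x + x')) (W.ract g j y) =
        TC.mk V.M W.M h (V.ract g i x) (W.ract g j y) +
        TC.mk V.M W.M h (V.ract g i x') (W.ract g j y)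
      rw [map_add, map_add, AddMonoidHom.add_apply]

theorem orbMk_apply {i j n : ℤ} (h : i + j = n) (x : V.M.X i) (y : W.M.X j) (g : G) :
    orbMk V W h x y g = TC.mk V.M W.M h (V.ract g i x) (W.ract g j y) := rfl

theorem orbMk_cont {n : ℤ} (L : AddSubgroup C(G, TC V.M W.M n))
    (hL : IsOpen (L : Set C(G, TC V.M W.M n))) : ∃ (F : OpenSub V.M.toGMod)
      (F' : OpenSub W.M.toGMod), ∀ {i j : ℤ} (h : i + j = n) (x : V.M.X i) (y : W.M.X j),
      (x ∈ F.N i ∨ y ∈ F'.N j) → orbMk V W h x y ∈ L := by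
  obtain ⟨L', hL', hle⟩ := exists_fnSub (hL.mem_nhds L.zero_mem)
  obtain ⟨F, F', hF⟩ := TC.exists_W L' hL'
  refine ⟨V.core F, W.core F', fun {i j} h x y hxy => ?_⟩
  have : orbMk V W h x y ∈ fnSub G L' := by
    intro g
    rw [orbMk_apply]
    refine hF (TC.mk_mem_W h ?_)
    rcases hxy with hx | hy
    · exact Or.inl (V.core_mem hx g)
    · exact Or.inr (W.core_mem hy g)
  exact hle this

/-- The bilinear map `(x, y) ↦ (g ↦ x g ⊗ y g)`. -/
def orbBilin (n : ℤ) : Bilin V.M W.M n C(G, TC V.M W.M n) where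
  b h := orbMk V W h
  bal {d i j i' j'} h₁ h₂ h h' a x y := by
    refine ContinuousMap.ext fun g => ?_
    rw [orbMk_apply, orbMk_apply, V.semilinear, W.semilinear]
    exact TC.mk_bal h₁ h₂ h h' (gact 𝒜 g d a) (V.ract g i x) (W.ract g j y)
  cont L hL := orbMk_cont V W L hL

/-- The map `z ↦ (g ↦ z g)` for the diagonal action on the tensor product. -/
def orbT (n : ℤ) : TC V.M W.M n →+ C(G, TC V.M W.M n) := TC.lift (orbBilin V W n)

theorem continuous_orbT (n : ℤ) : Continuous (orbT V W n) := TC.continuous_lift _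

theorem orbT_mk {i j n : ℤ} (h : i + j = n) (x : V.M.X i) (y : W.M.X j) (g : G) :
    orbT V W n (TC.mk V.M W.M h x y) g = TC.mk V.M W.M h (V.ract g i x) (W.ract g j y) :=
  (DFunLike.congr_fun (TC.lift_mk (orbBilin V W n) h x y) g).trans rfl

/-- The diagonal action `(x ⊗ y) g = x g ⊗ y g`. -/
def ractT (g : G) (n : ℤ) : TC V.M W.M n →+ TC V.M W.M n :=
  AddMonoidHom.mk' (fun z => orbT V W n z g) fun z z' => by
    rw [map_add, ContinuousMap.add_apply]

theorem ractT_mk {i j n : ℤ} (h : i + j = n) (x : V.M.X i) (y : W.M.X j) (g : G) :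
    ractT V W g n (TC.mk V.M W.M h x y) = TC.mk V.M W.M h (V.ract g i x) (W.ract g j y) :=
  orbT_mk V W h x y g

theorem continuous_ractT (n : ℤ) :
    Continuous fun p : TC V.M W.M n × G => ractT V W p.2 n p.1 :=
  ContinuousEval.continuous_eval.comp
    (((continuous_orbT V W n).comp continuous_fst).prodMk continuous_snd)

theorem continuous_ractT_left (g : G) (n : ℤ) : Continuous (ractT V W g n) :=
  (continuous_ractT V W n).comp (continuous_id.prodMk continuous_const)

/-- The completed tensor product of twisted modules, with the diagonal action. -/
@[reducible] def tensor : TwMod 𝒜 G where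
  M := tensorC V.M W.M
  ract := ractT V W
  ract_one n z := by
    refine DFunLike.congr_fun (f := ractT V W 1 n) (g := AddMonoidHom.id _)
      (TC.ext (continuous_ractT_left V W 1 n) continuous_id fun h x y => ?_) z
    rw [ractT_mk, V.ract_one, W.ract_one, AddMonoidHom.id_apply]
  ract_mul g g' n z := by
    refine DFunLike.congr_fun (f := (ractT V W g' n).comp (ractT V W g n))
      (g := ractT V W (g * g') n)
      (TC.ext ((continuous_ractT_left V W g' n).comp (continuous_ractT_left V W g n))
        (continuous_ractT_left V W _ n) fun h x y => ?_) z
    rw [AddMonoidHom.comp_apply, ractT_mk, ractT_mk, ractT_mk, V.ract_mul, W.ract_mul]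
  semilinear g {d n m} h a z := by
    refine DFunLike.congr_fun (f := (ractT V W g m).comp (TC.act h a))
      (g := (TC.act h (gact 𝒜 g d a)).comp (ractT V W g n))
      (TC.ext ((continuous_ractT_left V W g m).comp (TC.continuous_act h a))
        ((TC.continuous_act h _).comp (continuous_ractT_left V W g n)) fun {i j} hij x y => ?_) z
    rw [AddMonoidHom.comp_apply, AddMonoidHom.comp_apply, ractT_mk,
      TC.act_mk h a hij rfl (by omega), ractT_mk, TC.act_mk h _ hij rfl (by omega), V.semilinear]
  continuous_ract n := continuous_ractT V W n

theorem tensor_ract_mk {i j n : ℤ} (h : i + j = n) (x : V.M.X i) (y : W.M.X j) (g : G) :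
    (tensor V W).ract g n (TC.mk V.M W.M h x y) =
      TC.mk V.M W.M h (V.ract g i x) (W.ract g j y) := ractT_mk V W h x y g

variable (𝒜 G) in
/-- The unit object: `𝒜` with the given action. -/
@[reducible] def unit : TwMod 𝒜 G where
  M := unitC 𝒜
  ract := GradedTwist.ract 𝒜
  ract_one n x := GradedTwist.ract_one 𝒜 n x
  ract_mul g h n x := GradedTwist.ract_mul 𝒜 g h n x
  semilinear g _ _ _ h a x := GradedTwist.ract_uact 𝒜 g h a x
  continuous_ract n := GradedTwist.continuous_ract 𝒜 n

variable {V W U}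

theorem equi2 {P : TwMod 𝒜 G} (φ : tensorC V.M W.M ⟶ P.M)
    (h : ∀ (g : G) {i j n : ℤ} (h : i + j = n) (x : V.M.X i) (y : W.M.X j),
      φ.f n (TC.mk V.M W.M h (V.ract g i x) (W.ract g j y)) =
        P.ract g n (φ.f n (TC.mk V.M W.M h x y))) (g : G) (n : ℤ) (z : (tensor V W).M.X n) :
    φ.f n ((tensor V W).ract g n z) = P.ract g n (φ.f n z) := by
  refine DFunLike.congr_fun (f := (φ.f n).comp (ractT V W g n))
    (g := (P.ract g n).comp (φ.f n)) (TC.ext ((φ.cont n).comp (continuous_ractT_left V W g n))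
      ((P.continuous_ract_left g n).comp (φ.cont n)) fun {i j} hij x y => ?_) z
  rw [AddMonoidHom.comp_apply, AddMonoidHom.comp_apply, ractT_mk]
  exact h g hij x y

theorem equi3 {P : TwMod 𝒜 G} (φ : tensorC (tensorC V.M W.M) U.M ⟶ P.M)
    (h : ∀ (g : G) {i j l p n : ℤ} (h₁ : i + j = l) (h₂ : l + p = n) (x : V.M.X i) (y : W.M.X j)
      (z : U.M.X p), φ.f n (TC.mk (tensorC V.M W.M) U.M h₂ (TC.mk V.M W.M h₁ (V.ract g i x)
        (W.ract g j y)) (U.ract g p z)) =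
        P.ract g n (φ.f n (TC.mk (tensorC V.M W.M) U.M h₂ (TC.mk V.M W.M h₁ x y) z)))
    (g : G) (n : ℤ) (z : (tensor (tensor V W) U).M.X n) :
    φ.f n ((tensor (tensor V W) U).ract g n z) = P.ract g n (φ.f n z) := by
  refine DFunLike.congr_fun (f := (φ.f n).comp (ractT (tensor V W) U g n))
    (g := (P.ract g n).comp (φ.f n))
    (TC.ext3 ((φ.cont n).comp (continuous_ractT_left (tensor V W) U g n))
      ((P.continuous_ract_left g n).comp (φ.cont n)) fun {i j l p} h₁ h₂ x y z => ?_) z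
  have := ractT_mk (tensor V W) U h₂ (TC.mk V.M W.M h₁ x y) z g
  rw [tensor_ract_mk V W h₁ x y g] at this
  exact (congrArg (φ.f n) this).trans (h g h₁ h₂ x y z)

/-- The tensor product of morphisms. -/
def tensorHom {V' W' : TwMod 𝒜 G} (φ : V ⟶ V') (ψ : W ⟶ W') : tensor V W ⟶ tensor V' W' :=
  ⟨tensorHomC φ.hom ψ.hom, equi2 (P := tensor V' W') _ fun g i j n h x y => by
    rw [tensorHomC_mk, tensorHomC_mk, φ.equi, ψ.equi]
    exact (tensor_ract_mk V' W' h _ _ g).symm⟩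

instance : MonoidalCategoryStruct (TwMod 𝒜 G) where
  tensorObj := tensor
  tensorHom := tensorHom
  whiskerLeft V _ _ φ := tensorHom (𝟙 V) φ
  whiskerRight φ V := tensorHom φ (𝟙 V)
  tensorUnit := unit 𝒜 G
  associator V W U := mkIso (V := tensor (tensor V W) U) (W := tensor V (tensor W U))
    (assocIso V.M W.M U.M) (equi3 (P := tensor V (tensor W U)) _ fun g i j l p n h₁ h₂ x y z => by
      rw [assocIso_mk _ _ _ h₁ h₂ rfl (by omega), assocIso_mk _ _ _ h₁ h₂ rfl (by omega),
        ← tensor_ract_mk W U]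
      exact (tensor_ract_mk V (tensor W U) _ x (TC.mk W.M U.M rfl y z) g).symm)
  leftUnitor V := mkIso (V := tensor (unit 𝒜 G) V) (leftIso V.M)
    (equi2 (V := unit 𝒜 G) (P := V) _ fun g i j n h a x => by
      refine (leftIso_mk V.M h _ _).trans ?_
      refine Eq.trans ?_ (congrArg (V.ract g n) (leftIso_mk V.M h a x)).symm
      exact (V.semilinear g h a x).symm)
  rightUnitor V := mkIso (V := tensor V (unit 𝒜 G)) (rightIso V.M)
    (equi2 (W := unit 𝒜 G) (P := V) _ fun g i j n h x a => by
      refine (rightIso_mk V.M h (by omega) _ _).trans ?_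
      refine Eq.trans ?_ (congrArg (V.ract g n) (rightIso_mk V.M h (by omega) x a)).symm
      exact (V.semilinear g _ a x).symm)

instance : MonoidalCategory (TwMod 𝒜 G) := MonoidalCategory.ofTensorHom
  (id_tensorHom_id := fun V W => hom_ext (MonoidalCategory.id_tensorHom_id V.M W.M))
  (tensorHom_comp_tensorHom := fun f₁ f₂ g₁ g₂ =>
    hom_ext (MonoidalCategory.tensorHom_comp_tensorHom f₁.hom f₂.hom g₁.hom g₂.hom))
  (associator_naturality := fun f₁ f₂ f₃ =>
    hom_ext (MonoidalCategory.associator_naturality f₁.hom f₂.hom f₃.hom))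
  (leftUnitor_naturality := fun f => hom_ext (MonoidalCategory.leftUnitor_naturality f.hom))
  (rightUnitor_naturality := fun f => hom_ext (MonoidalCategory.rightUnitor_naturality f.hom))
  (pentagon := fun V W U P => hom_ext (MonoidalCategory.pentagon V.M W.M U.M P.M))
  (triangle := fun V W => hom_ext (MonoidalCategory.triangle V.M W.M))

instance : SymmetricCategory (TwMod 𝒜 G) where
  braiding V W := mkIso (V := tensor V W) (W := tensor W V) (braidIso V.M W.M)
    (equi2 (P := tensor W V) _ fun g i j n h x y => by
      refine (braidHom_mk V.M W.M h (by omega) _ _).trans ?_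
      refine Eq.trans ?_ (congrArg ((tensor W V).ract g n)
        (braidHom_mk V.M W.M h (by omega : j + i = n) x y)).symm
      rw [map_zsmul, tensor_ract_mk W V])
  braiding_naturality_right V _ _ f :=
    hom_ext (BraidedCategory.braiding_naturality_right V.M f.hom)
  braiding_naturality_left f V := hom_ext (BraidedCategory.braiding_naturality_left f.hom V.M)
  hexagon_forward V W U := hom_ext (BraidedCategory.hexagon_forward V.M W.M U.M)
  hexagon_reverse V W U := hom_ext (BraidedCategory.hexagon_reverse V.M W.M U.M)
  symmetry V W := hom_ext (SymmetricCategory.symmetry V.M W.M)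

end TwMod

end Twisted

end

noncomputable section

section Hopf

variable {k : Type w} {A : Type u} [CommRing k] [CommRing A] [Algebra k A]
  {𝒜 : ℤ → Submodule k A} [GradedAlgebra 𝒜] [IsLocalRing (𝒜 0)] [EvenPeriodic 𝒜]
  [IsAdicComplete (IsLocalRing.maximalIdeal (𝒜 0)) (𝒜 0)]
  {G : Type u} [Group G] [TopologicalSpace G] [IsTopologicalGroup G] [CompactSpace G] [T2Space G]
  [TotallyDisconnectedSpace G] [MulSemiringAction Gᵐᵒᵖ A] [ContAction 𝒜 G]

variable (𝒜 G) in
/-- The ring `C = C(G, 𝒜)` as a module over `𝒜` through the right unit `η_R`, which sends an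
element of `𝒜` to a constant function. -/
@[reducible] def cR : CMod 𝒜 := fnC G (unitC 𝒜)

variable (𝒜 G) in
/-- The left unit `η_L : 𝒜 ⟶ C`, `η_L(a)(g) = a ^ g`. -/
def etaL (d : ℤ) : 𝒜 d →+ C(G, (unitC 𝒜).X d) :=
  AddMonoidHom.mk' (fun a => ⟨fun g => ract 𝒜 g d a,
    (continuous_ract 𝒜 d).comp (continuous_const.prodMk continuous_id)⟩)
    fun a b => ContinuousMap.ext fun g => map_add (ract 𝒜 g d) a b

theorem etaL_apply (d : ℤ) (a : 𝒜 d) (g : G) : etaL 𝒜 G d a g = ract 𝒜 g d a := rfl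

theorem etaL_mem (p : ℕ) {d : ℤ} {a : 𝒜 d} (ha : a ∈ (unitPow 𝒜 p).N d) (g : G) :
    etaL 𝒜 G d a g ∈ (uPow 𝒜 p).N d := ract_mem 𝒜 g p d ha

variable (G) in
/-- The functions from `G` to `M` with the action `(a f)(g) = a ^ g f(g)`. -/
@[reducible] def fnLG (M : CMod 𝒜) : GMod 𝒜 where
  X n := C(G, M.X n)
  act {d j i} h := (pact M h).comp (etaL 𝒜 G d)
  one_act {j} h f := by
    refine ContinuousMap.ext fun g => ?_
    change uact M h (ract 𝒜 g 0 (uone 𝒜)) (f g) = f g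
    rw [ract_uone, uone_uact]
  mul_act {d e f j l i} h₁ h₂ h₃ h₄ a b φ := by
    refine ContinuousMap.ext fun g => ?_
    have h5 := ract_uact 𝒜 g h₁ a b
    refine (congrArg (fun t => uact M h₄ t (φ g)) h5).trans ?_
    exact uact_mul M h₁ h₂ h₃ h₄ _ _ _

/-- The functions with values in an open submodule. -/
def OpenSub.fnL {M : CMod 𝒜} (F : OpenSub M.toGMod) : OpenSub (fnLG G M) where
  N n := fnSub G (F.N n)
  isOpen n := isOpen_fnSub _ (F.isOpen n)
  act_mem h _ _ hf g := F.act_mem h _ (hf g)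

variable (G) in
/-- The module `C(G, M)` with the action `(a f)(g) = a ^ g f(g)`. -/
@[reducible] def fnL (M : CMod 𝒜) : CMod 𝒜 where
  toGMod := fnLG G M
  lin n U hU := by
    obtain ⟨F, hF⟩ := OpenSub.exists_fn_le_deg M n hU
    exact ⟨F.fnL, hF⟩
  adic E := by
    obtain ⟨F₀, h₀⟩ := OpenSub.exists_fn_le_deg M 0 ((E.isOpen 0).mem_nhds (zero_mem _))
    obtain ⟨F₁, h₁⟩ := OpenSub.exists_fn_le_deg M 1 ((E.isOpen 1).mem_nhds (zero_mem _))
    obtain ⟨p, hp⟩ := M.exists_pow (F₀ ⊓ F₁)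
    refine ⟨p, fun {d j i} h a ha f => ?_⟩
    refine le_of_zero_one (fnLG G M) _ _ ((F₀ ⊓ F₁).fnL).act_mem E.act_mem
      (fun f hf => h₀ fun x => (hf x).1) (fun f hf => h₁ fun x => (hf x).2) i ?_
    exact fun g => hp h _ (etaL_mem p ha g) (f g)

variable (𝒜 G) in
/-- The ring `C = C(G, 𝒜)` as a module over `𝒜` through the left unit `η_L`. -/
@[reducible] def cL : CMod 𝒜 := fnL G (unitC 𝒜)

/-- The bilinear map `(β, x) ↦ α β ⊗ x`. -/
def cmulBilin (M : CMod 𝒜) {d n m : ℤ} (h : d + n = m) (α : C(G, (unitC 𝒜).X d)) :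
    Bilin (cR 𝒜 G) M n (TC (cR 𝒜 G) M m) where
  b {i j} hij := (TC.mk (cR 𝒜 G) M (by omega : (d + i) + j = m)).comp (pact (unitC 𝒜) rfl α)
  bal {e i j i' j'} h₁ h₂ h₃ h₄ a β x := by
    rw [AddMonoidHom.comp_apply, AddMonoidHom.comp_apply]
    have key : pact (unitC 𝒜) (rfl : d + i' = d + i') α ((cR 𝒜 G).act h₁ a β) =
        (cR 𝒜 G).act (by omega : e + (d + i) = d + i') a (pact (unitC 𝒜) rfl α β) :=
      ContinuousMap.ext fun g => Subtype.ext (mul_left_comm _ _ _)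
    rw [key]
    exact TC.mk_bal (M := cR 𝒜 G) _ h₂ _ (by omega) a (pact (unitC 𝒜) rfl α β) x
  cont L hL := by
    obtain ⟨E, F, hF⟩ := TC.exists_W L hL
    obtain ⟨E', hE'⟩ := OpenSub.exists_fn_le (unitC 𝒜) E
    refine ⟨OpenSub.fn G E', F, fun {i j} hij β x hx => ?_⟩
    rw [AddMonoidHom.comp_apply]
    refine hF (TC.mk_mem_W _ (hx.imp (fun hβ => hE' _ fun g => ?_) id))
    exact E'.act_mem (rfl : d + i = d + i) (α g) (hβ g)

/-- Left multiplication by an element of `C` on `C ⊗̂ M`. -/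
def cmul (M : CMod 𝒜) {d n m : ℤ} (h : d + n = m) (α : C(G, (unitC 𝒜).X d)) :
    TC (cR 𝒜 G) M n →+ TC (cR 𝒜 G) M m := TC.lift (cmulBilin M h α)

theorem continuous_cmul (M : CMod 𝒜) {d n m : ℤ} (h : d + n = m) (α : C(G, (unitC 𝒜).X d)) :
    Continuous (cmul M h α) := TC.continuous_lift _

theorem cmul_mk (M : CMod 𝒜) {d n m i j i' : ℤ} (h : d + n = m) (α : C(G, (unitC 𝒜).X d))
    (hij : i + j = n) (hi : d + i = i') (h' : i' + j = m) (β : C(G, (unitC 𝒜).X i))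
    (x : M.X j) : cmul M h α (TC.mk (cR 𝒜 G) M hij β x) =
      TC.mk (cR 𝒜 G) M h' (pact (unitC 𝒜) hi α β) x := by
  subst hi
  exact TC.lift_mk _ _ _ _

theorem phi_cmul (M : CMod 𝒜) {d n m : ℤ} (h : d + n = m) (α : C(G, (unitC 𝒜).X d))
    (z : TC (cR 𝒜 G) M n) : phi M m (cmul M h α z) = pact M h α (phi M n z) := by
  have hc : Continuous (pact M h α) := by
    refine continuous_of_open _ fun L hL => ?_
    obtain ⟨F, hF⟩ := OpenSub.exists_fn_le_deg M m (hL.mem_nhds L.zero_mem)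
    exact ⟨fnSub G (F.N n), isOpen_fnSub _ (F.isOpen n),
      fun f hf => hF fun g => F.act_mem h _ (hf g)⟩
  have hl : Continuous ((phi M m).comp (cmul M h α)) := by
    rw [AddMonoidHom.coe_comp]
    exact (continuous_phi (X := G) M m).comp (continuous_cmul M h α)
  have hr : Continuous ((pact M h α).comp (phi M n)) := by
    rw [AddMonoidHom.coe_comp]
    exact hc.comp (continuous_phi (X := G) M n)
  refine DFunLike.congr_fun (f := (phi M m).comp (cmul M h α))
    (g := (pact M h α).comp (phi M n)) (TC.ext hl hr fun {i j} hij β x => ?_) z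
  refine ContinuousMap.ext fun g => ?_
  have hm : (d + i) + j = m := by omega
  have h1 := congrArg (fun z => phi M m z g) (cmul_mk M h α hij rfl hm β x)
  have h2 := phi_mk M hm (pact (unitC 𝒜) rfl α β) x g
  have h3 := congrArg (uact M h (α g)) (phi_mk M hij β x g)
  exact (h1.trans h2).trans ((uact_mul M rfl hij h hm (α g) (β g) x).trans h3.symm)

theorem phi_ext {M : CMod 𝒜} {n : ℤ} {z z' : TC (cR 𝒜 G) M n}
    (h : ∀ g, phi M n z g = phi M n z' g) : z = z' :=
  phi_injective M n (ContinuousMap.ext h)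

variable (G) in
/-- `C ⊗̂ M`, with the left action of `𝒜` that comes from the left unit `η_L` of `C`, before
checking completeness. The tensor product is formed with the right unit `η_R`. -/
@[reducible] def leftG (M : CMod 𝒜) : GMod 𝒜 where
  X n := TC (cR 𝒜 G) M n
  act {d j i} h := AddMonoidHom.mk' (fun a => cmul M h (etaL 𝒜 G d a)) fun a b => by
    refine AddMonoidHom.ext fun z => phi_ext fun g => ?_
    rw [AddMonoidHom.add_apply, map_add (phi M i), ContinuousMap.add_apply, phi_cmul, phi_cmul,
      phi_cmul, map_add (etaL 𝒜 G d), map_add (pact M h)]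
    rfl
  one_act {j} h z := phi_ext fun g => by
    rw [AddMonoidHom.mk'_apply, phi_cmul]
    exact DFunLike.congr_fun ((fnLG G M).one_act h (phi M j z)) g
  mul_act h₁ h₂ h₃ h₄ a b z := phi_ext fun g => by
    rw [AddMonoidHom.mk'_apply, AddMonoidHom.mk'_apply, AddMonoidHom.mk'_apply, phi_cmul,
      phi_cmul, phi_cmul]
    exact DFunLike.congr_fun ((fnLG G M).mul_act h₁ h₂ h₃ h₄ a b (phi M _ z)) g

theorem leftG_act (M : CMod 𝒜) {d j i : ℤ} (h : d + j = i) (a : 𝒜 d) (z : TC (cR 𝒜 G) M j) :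
    (leftG G M).act h a z = cmul M h (etaL 𝒜 G d a) z := rfl

theorem phi_leftG_act (M : CMod 𝒜) {d j i : ℤ} (h : d + j = i) (a : 𝒜 d)
    (z : TC (cR 𝒜 G) M j) (g : G) :
    phi M i ((leftG G M).act h a z) g = M.act h (gact 𝒜 g d a) (phi M j z g) := by
  rw [leftG_act, phi_cmul]
  rfl

/-- The open submodule of `C ⊗̂ M` that corresponds to the functions with values in `F`. -/
def OpenSub.left {M : CMod 𝒜} (F : OpenSub M.toGMod) : OpenSub (leftG G M) where
  N n := (fnSub G (F.N n)).comap (phi M n)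
  isOpen n := (isOpen_fnSub _ (F.isOpen n)).preimage (continuous_phi M n)
  act_mem h a z hz g := by
    rw [phi_leftG_act]
    exact F.act_mem h _ (hz g)

theorem OpenSub.mem_left {M : CMod 𝒜} {F : OpenSub M.toGMod} {n : ℤ} {z : TC (cR 𝒜 G) M n} :
    z ∈ F.left.N n ↔ ∀ g, phi M n z g ∈ F.N n := Iff.rfl

variable (G) in
/-- `C ⊗̂ M`, with the left action of `𝒜` that comes from the left unit `η_L` of `C`. -/
@[reducible] def leftC (M : CMod 𝒜) : CMod 𝒜 where
  toGMod := leftG G M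
  lin n U hU := by
    obtain ⟨F, hF⟩ := exists_fn_le_tensor M n hU
    exact ⟨F.left, hF⟩
  adic E := by
    obtain ⟨F₀, h₀⟩ := exists_fn_le_tensor M 0 ((E.isOpen 0).mem_nhds (zero_mem _))
    obtain ⟨F₁, h₁⟩ := exists_fn_le_tensor M 1 ((E.isOpen 1).mem_nhds (zero_mem _))
    obtain ⟨p, hp⟩ := M.exists_pow (F₀ ⊓ F₁)
    refine ⟨p, fun {d j i} h a ha z => ?_⟩
    refine le_of_zero_one (leftG G M) _ _ ((F₀ ⊓ F₁).left).act_mem E.act_mem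
      (fun f hf => h₀ _ fun x => (hf x).1) (fun f hf => h₁ _ fun x => (hf x).2) i ?_
    intro g
    rw [phi_leftG_act]
    exact hp h _ (etaL_mem p ha g) _

/-- Iterating the comparison maps identifies `C ⊗̂ (C ⊗̂ M)` with the functions on `G × G`. -/
def phi2 (M : CMod 𝒜) (n : ℤ) (w : TC (cR 𝒜 G) (leftC G M) n) (g₁ g₂ : G) : M.X n :=
  phi M n (phi (leftC G M) n w g₁) g₂

theorem phi2_ext {M : CMod 𝒜} {n : ℤ} {w w' : TC (cR 𝒜 G) (leftC G M) n}
    (h : ∀ g₁ g₂, phi2 M n w g₁ g₂ = phi2 M n w' g₁ g₂) : w = w' :=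
  phi_ext fun g₁ => phi_ext fun g₂ => h g₁ g₂

theorem phi2_add (M : CMod 𝒜) {n : ℤ} (w w' : TC (cR 𝒜 G) (leftC G M) n) (g₁ g₂ : G) :
    phi2 M n (w + w') g₁ g₂ = phi2 M n w g₁ g₂ + phi2 M n w' g₁ g₂ := by
  rw [phi2, map_add, ContinuousMap.add_apply, map_add, ContinuousMap.add_apply]
  rfl

theorem continuous_phi2 (M : CMod 𝒜) (n : ℤ) (g₁ g₂ : G) :
    Continuous fun w => phi2 M n w g₁ g₂ :=
  (ContinuousEval.continuous_eval.comp ((continuous_phi M n).prodMk continuous_const)).comp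
    (ContinuousEval.continuous_eval.comp
      ((continuous_phi (leftC G M) n).prodMk (continuous_const (y := g₁))))

theorem phi2_mk (M : CMod 𝒜) {i j l n q : ℤ} (h : i + q = n) (h' : l + j = q) (h'' : i + q = n)
    (α : C(G, (unitC 𝒜).X i)) (β : C(G, (unitC 𝒜).X l)) (x : M.X j) (g₁ g₂ : G) :
    phi2 M n (TC.mk (cR 𝒜 G) (leftC G M) h α (TC.mk (cR 𝒜 G) M h' β x)) g₁ g₂ =
      uact M h'' (ract 𝒜 g₂ i (α g₁)) (uact M h' (β g₂) x) := by
  rw [phi2, phi_mk]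
  refine (phi_leftG_act M h (α g₁) _ g₂).trans ?_
  rw [phi_mk]
  rfl

theorem exists_phi2 (M : CMod 𝒜) {n : ℤ} (L : AddSubgroup (TC (cR 𝒜 G) (leftC G M) n))
    (hL : IsOpen (L : Set (TC (cR 𝒜 G) (leftC G M) n))) : ∃ F : OpenSub M.toGMod,
      ∀ w, (∀ g₁ g₂, phi2 M n w g₁ g₂ ∈ F.N n) → w ∈ L := by
  obtain ⟨E, hE⟩ := exists_fn_le_tensor (leftC G M) n (hL.mem_nhds L.zero_mem)
  obtain ⟨F, hF⟩ := exists_fn_le_tensor M n ((E.isOpen n).mem_nhds (zero_mem _))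
  exact ⟨F, fun w hw => hE w fun g₁ => hF _ fun g₂ => hw g₁ g₂⟩

/-- The map `ψ̃ : C(G, 𝒜) ⟶ C(G × G, 𝒜)`, `ψ̃(α)(g₁, g₂) = α(g₁ g₂)`, with values in the
functions from `G` to `C(G, 𝒜)`. -/
def psiTilde (n : ℤ) : C(G, (unitC 𝒜).X n) →+ C(G, (cL 𝒜 G).X n) :=
  AddMonoidHom.mk' (fun α => ContinuousMap.curry
    ⟨fun p : G × G => α (p.1 * p.2), α.continuous.comp continuous_mul⟩) fun _ _ => rfl

theorem psiTilde_apply {n : ℤ} (α : C(G, (unitC 𝒜).X n)) (g₁ g₂ : G) :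
    (psiTilde n α g₁ : C(G, (unitC 𝒜).X n)) g₂ = α (g₁ * g₂) := rfl

variable (𝒜 G) in
/-- The isomorphism `m : C ⊗̂ C ≅ C(G × G, 𝒜)` with
`m(α ⊗ β)(g₁, g₂) = α(g₁) ^ g₂ * β(g₂)`, see `mIso_mk`. In `C ⊗̂ C` the first factor is a module
through `η_R` and the second one through `η_L`. -/
def mIso (n : ℤ) : TC (cR 𝒜 G) (cL 𝒜 G) n ≃+ C(G, (cL 𝒜 G).X n) := phiEquiv (cL 𝒜 G) n

theorem mIso_mk {i j n : ℤ} (h : i + j = n) (α β) (g₁ g₂ : G) :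
    (mIso 𝒜 G n (TC.mk (cR 𝒜 G) (cL 𝒜 G) h α β) g₁ : C(G, (unitC 𝒜).X n)) g₂ =
      gmul 𝒜 h (gact 𝒜 g₂ i (α g₁)) ((β : C(G, (unitC 𝒜).X j)) g₂) := by
  have := phi_mk (cL 𝒜 G) h α β g₁
  exact (DFunLike.congr_fun this g₂).trans rfl

/-- The comultiplication `ψ = m⁻¹ ψ̃ : C ⟶ C ⊗̂ C`. -/
def psi (n : ℤ) : C(G, (unitC 𝒜).X n) →+ TC (cR 𝒜 G) (cL 𝒜 G) n :=
  (mIso 𝒜 G n).symm.toAddMonoidHom.comp (psiTilde n)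

theorem phi_psi {n : ℤ} (α : C(G, (unitC 𝒜).X n)) (g₁ g₂ : G) :
    (phi (cL 𝒜 G) n (psi n α) g₁ : C(G, (unitC 𝒜).X n)) g₂ = α (g₁ * g₂) := by
  have : phi (cL 𝒜 G) n (psi n α) = psiTilde n α := phi_symm (cL 𝒜 G) (psiTilde n α)
  rw [this]
  rfl

/-- For fixed `x`, the bilinear map `(α, β) ↦ α ⊗ (β ⊗ x)`. -/
def insBilin (M : CMod 𝒜) {p j n : ℤ} (h : p + j = n) (x : M.X j) :
    Bilin (cR 𝒜 G) (cL 𝒜 G) p (TC (cR 𝒜 G) (leftC G M) n) where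
  b {i l} hil := (TC.mk (cR 𝒜 G) (leftC G M) (by omega : i + (l + j) = n)).compl₂
    ((TC.mk (cR 𝒜 G) M (rfl : l + j = l + j)).flip x)
  bal {d i l i' l'} h₁ h₂ h₃ h₄ a α β := by
    rw [AddMonoidHom.compl₂_apply, AddMonoidHom.compl₂_apply, AddMonoidHom.flip_apply,
      AddMonoidHom.flip_apply]
    refine (TC.mk_bal (N := leftC G M) h₁ (by omega : d + (l + j) = l' + j) _ (by omega) a α
      (TC.mk (cR 𝒜 G) M (rfl : l + j = l + j) β x)).trans ?_
    refine congrArg (TC.mk (cR 𝒜 G) (leftC G M) (by omega : i + (l' + j) = n) α) ?_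
    exact cmul_mk M _ _ _ h₂ _ β x
  cont L hL := by
    obtain ⟨F, hF⟩ := exists_phi2 M L hL
    obtain ⟨q, hq⟩ := M.exists_pow F
    refine ⟨cPow 𝒜 G q, OpenSub.fnL (uPow 𝒜 q), fun {i l} hil α β hαβ => ?_⟩
    rw [AddMonoidHom.compl₂_apply, AddMonoidHom.flip_apply]
    refine hF _ fun g₁ g₂ => ?_
    rw [phi2_mk M _ rfl (by omega)]
    rcases hαβ with hα | hβ
    · exact hq _ _ (ract_mem 𝒜 g₂ q i (hα g₁)) _
    · exact F.act_mem _ _ (hq _ _ (hβ g₂) x)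

/-- The map `C ⊗̂ C ⟶ C ⊗̂ (C ⊗̂ M)`, `α ⊗ β ↦ α ⊗ (β ⊗ x)`. -/
def ins (M : CMod 𝒜) {p j n : ℤ} (h : p + j = n) (x : M.X j) :
    TC (cR 𝒜 G) (cL 𝒜 G) p →+ TC (cR 𝒜 G) (leftC G M) n := TC.lift (insBilin M h x)

theorem ins_mk (M : CMod 𝒜) {p i j l q n : ℤ} (h : p + j = n) (x : M.X j) (hil : i + l = p)
    (hlj : l + j = q) (hiq : i + q = n) (α : C(G, (unitC 𝒜).X i)) (β : C(G, (unitC 𝒜).X l)) :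
    ins M h x (TC.mk (cR 𝒜 G) (cL 𝒜 G) hil α β) =
      TC.mk (cR 𝒜 G) (leftC G M) hiq α (TC.mk (cR 𝒜 G) M hlj β x) := by
  subst hlj
  exact TC.lift_mk _ _ _ _

theorem phi2_ins (M : CMod 𝒜) {p j n : ℤ} (h : p + j = n) (x : M.X j)
    (z : TC (cR 𝒜 G) (cL 𝒜 G) p) (g₁ g₂ : G) :
    phi2 M n (ins M h x z) g₁ g₂ =
      uact M h ((phi (cL 𝒜 G) p z g₁ : C(G, (unitC 𝒜).X p)) g₂) x := by
  let f : TC (cR 𝒜 G) (cL 𝒜 G) p →+ M.X n :=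
    AddMonoidHom.mk' (fun z => phi2 M n (ins M h x z) g₁ g₂) fun z z' => by
      rw [map_add, phi2_add]
  let f' : TC (cR 𝒜 G) (cL 𝒜 G) p →+ M.X n :=
    AddMonoidHom.mk' (fun z => uact M h ((phi (cL 𝒜 G) p z g₁ : C(G, (unitC 𝒜).X p)) g₂) x)
      fun z z' => by
        rw [map_add, ContinuousMap.add_apply, ContinuousMap.add_apply, map_add,
          AddMonoidHom.add_apply]
  have hf : Continuous f := (continuous_phi2 M n g₁ g₂).comp (TC.continuous_lift _)
  have hf' : Continuous f' := by
    have h1 : Continuous fun z => phi (X := G) (cL 𝒜 G) p z g₁ :=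
      ContinuousEval.continuous_eval.comp
        ((continuous_phi (cL 𝒜 G) p).prodMk (continuous_const (y := g₁)))
    have h2 : Continuous fun z =>
        (phi (X := G) (cL 𝒜 G) p z g₁ : C(G, (unitC 𝒜).X p)) g₂ :=
      ContinuousEval.continuous_eval.comp (h1.prodMk (continuous_const (y := g₂)))
    exact (continuous_uact M h).comp (h2.prodMk continuous_const)
  refine DFunLike.congr_fun (f := f) (g := f') (TC.ext hf hf' fun {i l} hil α β => ?_) z
  change phi2 M n (ins M h x _) g₁ g₂ = uact M h _ x
  rw [ins_mk M h x hil rfl (by omega), phi2_mk M _ _ (by omega), phi_mk]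
  exact (uact_mul M hil rfl _ h (ract 𝒜 g₂ i (α g₁)) (β g₂) x).symm

/-- The map `(α, x) ↦ ψ(α) ⊗ x`, with values in `C ⊗̂ (C ⊗̂ M)`. -/
def insPsi (M : CMod 𝒜) {p j n : ℤ} (h : p + j = n) :
    C(G, (unitC 𝒜).X p) →+ M.X j →+ TC (cR 𝒜 G) (leftC G M) n :=
  AddMonoidHom.mk' (fun α => AddMonoidHom.mk' (fun x => ins M h x (psi p α))
    fun x x' => phi2_ext fun g₁ g₂ => by
      rw [phi2_add, phi2_ins, phi2_ins, phi2_ins, map_add])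
    fun α α' => AddMonoidHom.ext fun x => by
      rw [AddMonoidHom.mk'_apply, map_add, map_add]
      rfl

theorem phi2_insPsi (M : CMod 𝒜) {p j n : ℤ} (h : p + j = n) (α : C(G, (unitC 𝒜).X p))
    (x : M.X j) (g₁ g₂ : G) :
    phi2 M n (insPsi M h α x) g₁ g₂ = uact M h (α (g₁ * g₂)) x := by
  change phi2 M n (ins M h x (psi p α)) g₁ g₂ = _
  rw [phi2_ins, phi_psi]

theorem insPsi_bal (M : CMod 𝒜) {d i j i' j' n : ℤ} (h₁ : d + i = i') (h₂ : d + j = j')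
    (h : i' + j = n) (h' : i + j' = n) (a : 𝒜 d) (α : C(G, (unitC 𝒜).X i)) (x : M.X j) :
    insPsi M h ((cR 𝒜 G).act h₁ a α) x = insPsi M h' α (M.act h₂ a x) :=
  phi2_ext fun g₁ g₂ => by
    rw [phi2_insPsi, phi2_insPsi]
    exact DFunLike.congr_fun ((evBilin G M n).bal h₁ h₂ h h' a α x) (g₁ * g₂)

theorem insPsi_cont (M : CMod 𝒜) {n : ℤ} (L : AddSubgroup (TC (cR 𝒜 G) (leftC G M) n))
    (hL : IsOpen (L : Set (TC (cR 𝒜 G) (leftC G M) n))) :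
    ∃ (E : OpenSub (cR 𝒜 G).toGMod) (F : OpenSub M.toGMod), ∀ {i j : ℤ} (h : i + j = n)
      (α : (cR 𝒜 G).X i) (x : M.X j), (α ∈ E.N i ∨ x ∈ F.N j) → insPsi M h α x ∈ L := by
  obtain ⟨F, hF⟩ := exists_phi2 M L hL
  obtain ⟨q, hq⟩ := M.exists_pow F
  refine ⟨cPow 𝒜 G q, F, fun {p j} h α x hαx => hF _ fun g₁ g₂ => ?_⟩
  rw [phi2_insPsi]
  rcases hαx with hα | hx
  · exact hq _ _ (hα _) x
  · exact F.act_mem _ _ hx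

/-- The bilinear map `(α, x) ↦ ψ(α) ⊗ x`, with values in `C ⊗̂ (C ⊗̂ M)`. -/
def psiBilin (M : CMod 𝒜) (n : ℤ) : Bilin (cR 𝒜 G) M n (TC (cR 𝒜 G) (leftC G M) n) where
  b h := insPsi M h
  bal h₁ h₂ h h' a α x := insPsi_bal M h₁ h₂ h h' a α x
  cont L hL := insPsi_cont M L hL

/-- The map `ψ ⊗ 1 : C ⊗̂ M ⟶ (C ⊗̂ C) ⊗̂ M = C ⊗̂ (C ⊗̂ M)`. -/
def psiT (M : CMod 𝒜) (n : ℤ) : TC (cR 𝒜 G) M n →+ TC (cR 𝒜 G) (leftC G M) n :=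
  TC.lift (psiBilin M n)

theorem psiT_mk (M : CMod 𝒜) {p j n : ℤ} (h : p + j = n) (α : C(G, (unitC 𝒜).X p)) (x : M.X j) :
    psiT M n (TC.mk (cR 𝒜 G) M h α x) = ins M h x (psi p α) := TC.lift_mk _ _ _ _

theorem phi2_psiT (M : CMod 𝒜) {n : ℤ} (z : TC (cR 𝒜 G) M n) (g₁ g₂ : G) :
    phi2 M n (psiT M n z) g₁ g₂ = phi M n z (g₁ * g₂) := by
  let f : TC (cR 𝒜 G) M n →+ M.X n :=
    AddMonoidHom.mk' (fun z => phi2 M n (psiT M n z) g₁ g₂) fun z z' => by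
      rw [map_add, phi2_add]
  let f' : TC (cR 𝒜 G) M n →+ M.X n :=
    AddMonoidHom.mk' (fun z => phi M n z (g₁ * g₂)) fun z z' => by
      rw [map_add, ContinuousMap.add_apply]
  refine DFunLike.congr_fun (f := f) (g := f') (TC.ext
    ((continuous_phi2 M n g₁ g₂).comp (TC.continuous_lift _))
    (ContinuousEval.continuous_eval.comp ((continuous_phi M n).prodMk continuous_const))
    fun {p j} h α x => ?_) z
  change phi2 M n (psiT M n _) g₁ g₂ = phi M n _ (g₁ * g₂)
  rw [psiT_mk, phi2_ins, phi_psi, phi_mk]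

variable (𝒜 G) in
/-- The counit `ε : C ⟶ 𝒜`, `ε(α) = α(1)`. -/
def eps : cR 𝒜 G ⟶ unitC 𝒜 where
  f _ := AddMonoidHom.mk' (fun α => α 1) fun _ _ => rfl
  cont _ := ContinuousEval.continuous_eval.comp (continuous_id.prodMk continuous_const)
  map_act _ _ _ := rfl

/-- The map `C ⊗̂ M ⟶ 𝒜 ⊗̂ M = M` induced by the counit. -/
def epsT (M : CMod 𝒜) : tensorC (cR 𝒜 G) M ⟶ M :=
  tensorHomC (eps 𝒜 G) (𝟙 M) ≫ (leftIso M).hom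

theorem epsT_eq (M : CMod 𝒜) {n : ℤ} (z : TC (cR 𝒜 G) M n) :
    (epsT M).f n z = phi M n z 1 := by
  let f' : TC (cR 𝒜 G) M n →+ M.X n :=
    AddMonoidHom.mk' (fun z => phi M n z 1) fun z z' => by
      rw [map_add, ContinuousMap.add_apply]
  refine DFunLike.congr_fun (f := (epsT M).f n) (g := f') (TC.ext ((epsT M).cont n)
    (ContinuousEval.continuous_eval.comp ((continuous_phi M n).prodMk continuous_const))
    fun {p j} h α x => ?_) z
  change _ = phi M n _ 1
  rw [phi_mk, epsT, CMod.comp_f, tensorHomC_mk, CMod.id_f, leftIso_mk]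
  rfl

/-- The map `1 ⊗ φ : C ⊗̂ M ⟶ C ⊗̂ N`. -/
def oneT {M N : CMod 𝒜} (φ : M ⟶ N) : tensorC (cR 𝒜 G) M ⟶ tensorC (cR 𝒜 G) N :=
  tensorHomC (𝟙 (cR 𝒜 G)) φ

theorem phi_oneT {M N : CMod 𝒜} (φ : M ⟶ N) {n : ℤ} (z : TC (cR 𝒜 G) M n) (g : G) :
    phi N n ((oneT φ).f n z) g = φ.f n (phi M n z g) := by
  let f : TC (cR 𝒜 G) M n →+ N.X n :=
    AddMonoidHom.mk' (fun z => phi N n ((oneT φ).f n z) g) fun z z' => by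
      rw [map_add, map_add, ContinuousMap.add_apply]
  let f' : TC (cR 𝒜 G) M n →+ N.X n :=
    AddMonoidHom.mk' (fun z => φ.f n (phi M n z g)) fun z z' => by
      rw [map_add, ContinuousMap.add_apply, map_add]
  refine DFunLike.congr_fun (f := f) (g := f') (TC.ext
    (ContinuousEval.continuous_eval.comp
      (((continuous_phi N n).comp ((oneT φ).cont n)).prodMk continuous_const))
    ((φ.cont n).comp
      (ContinuousEval.continuous_eval.comp ((continuous_phi M n).prodMk continuous_const)))
    fun {p j} h α x => ?_) z
  change phi N n ((oneT φ).f n _) g = φ.f n (phi M n _ g)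
  rw [phi_mk, oneT, tensorHomC_mk, CMod.id_f, phi_mk]
  exact (φ.map_act h _ _).symm

end Hopf

end

noncomputable section

section Comodules

variable {k : Type w} {A : Type u} [CommRing k] [CommRing A] [Algebra k A]
  (𝒜 : ℤ → Submodule k A) [GradedAlgebra 𝒜] [IsLocalRing (𝒜 0)] [EvenPeriodic 𝒜]
  [IsAdicComplete (IsLocalRing.maximalIdeal (𝒜 0)) (𝒜 0)]
  (G : Type u) [Group G] [TopologicalSpace G] [IsTopologicalGroup G] [CompactSpace G] [T2Space G]
  [TotallyDisconnectedSpace G] [MulSemiringAction Gᵐᵒᵖ A] [ContAction 𝒜 G]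

/-- Complete left `C`-comodules, `C = C(G, 𝒜)`: a complete Hausdorff filtered `𝒜`-module `M` with
a continuous left `𝒜`-linear map `ρ : M ⟶ C ⊗̂ M` that is coassociative, `(ψ ⊗ 1) ρ = (1 ⊗ ρ) ρ`,
and counital, `(ε ⊗ 1) ρ = 1`. -/
structure Comod where
  M : CMod 𝒜
  ρ : M ⟶ leftC G M
  coassoc : ∀ n x, psiT M n (ρ.f n x) = (oneT (G := G) ρ).f n (ρ.f n x)
  counit : ∀ n x, (epsT (G := G) M).f n (ρ.f n x) = x

namespace Comod

variable {𝒜 G}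

/-- The morphisms are the continuous `𝒜`-linear maps that commute with the coactions. -/
@[ext] structure Hom (V W : Comod 𝒜 G) where
  hom : V.M ⟶ W.M
  comm : ∀ n x, W.ρ.f n (hom.f n x) = (oneT (G := G) hom).f n (V.ρ.f n x)

/-- The map `x ↦ ρ(x)(g)`. -/
def ev (V : Comod 𝒜 G) (g : G) (n : ℤ) : V.M.X n →+ V.M.X n :=
  AddMonoidHom.mk' (fun x => phi V.M n (V.ρ.f n x) g) fun x y => by
    rw [map_add, map_add, ContinuousMap.add_apply]

theorem phi_rho (V : Comod 𝒜 G) (g : G) (n : ℤ) (x : V.M.X n) :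
    phi V.M n (V.ρ.f n x) g = V.ev g n x := rfl

theorem continuous_ev (V : Comod 𝒜 G) (g : G) (n : ℤ) : Continuous (V.ev g n) :=
  ContinuousEval.continuous_eval.comp
    (((continuous_phi V.M n).comp (V.ρ.cont n)).prodMk (continuous_const (y := g)))

theorem phi2_oneT_rho (M : CMod 𝒜) (ρ : M ⟶ leftC G M) {n : ℤ} (x : M.X n) (g₁ g₂ : G) :
    phi2 M n ((oneT (G := G) ρ).f n (ρ.f n x)) g₁ g₂ =
      phi M n (ρ.f n (phi M n (ρ.f n x) g₁)) g₂ := by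
  rw [phi2, phi_oneT]

theorem ev_mul (V : Comod 𝒜 G) (g h : G) (n : ℤ) (x : V.M.X n) :
    V.ev h n (V.ev g n x) = V.ev (g * h) n x := by
  have := congrArg (fun w => phi2 V.M n w g h) (V.coassoc n x)
  simp only [] at this
  rw [phi2_psiT, phi2_oneT_rho] at this
  exact this.symm

theorem ev_one (V : Comod 𝒜 G) (n : ℤ) (x : V.M.X n) : V.ev 1 n x = x :=
  (epsT_eq V.M (V.ρ.f n x)).symm.trans (V.counit n x)

theorem ev_act (V : Comod 𝒜 G) (g : G) {d j i : ℤ} (h : d + j = i) (a : 𝒜 d) (x : V.M.X j) :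
    V.ev g i (V.M.act h a x) = V.M.act h (gact 𝒜 g d a) (V.ev g j x) :=
  (congrArg (fun z => phi V.M i z g) (V.ρ.map_act h a x)).trans
    (phi_leftG_act V.M h a (V.ρ.f j x) g)

/-- A criterion for being a comodule. -/
@[reducible] def ofEv (M : CMod 𝒜) (ρ : M ⟶ leftC G M)
    (hmul : ∀ g h n x, phi M n (ρ.f n (phi M n (ρ.f n x) g)) h = phi M n (ρ.f n x) (g * h))
    (hone : ∀ n x, phi M n (ρ.f n x) 1 = x) : Comod 𝒜 G where
  M := M
  ρ := ρ
  coassoc n x := phi2_ext fun g₁ g₂ => by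
    rw [phi2_psiT, phi2_oneT_rho, hmul]
  counit n x := by rw [epsT_eq, hone]

theorem comm_iff {V W : Comod 𝒜 G} (φ : V.M ⟶ W.M) {n : ℤ} (x : V.M.X n) :
    W.ρ.f n (φ.f n x) = (oneT (G := G) φ).f n (V.ρ.f n x) ↔
      ∀ g, W.ev g n (φ.f n x) = φ.f n (V.ev g n x) := by
  constructor
  · intro h g
    have := congrArg (fun z => phi W.M n z g) h
    exact this.trans (phi_oneT φ (V.ρ.f n x) g)
  · intro h
    refine phi_ext fun g => ?_
    exact (h g).trans (phi_oneT φ (V.ρ.f n x) g).symm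

/-- A criterion for being a morphism of comodules. -/
@[reducible] def Hom.ofEv {V W : Comod 𝒜 G} (φ : V.M ⟶ W.M)
    (h : ∀ g n x, φ.f n (V.ev g n x) = W.ev g n (φ.f n x)) : Hom V W :=
  ⟨φ, fun n x => (comm_iff φ x).2 fun g => (h g n x).symm⟩

theorem Hom.equi {V W : Comod 𝒜 G} (φ : Hom V W) (g : G) (n : ℤ) (x : V.M.X n) :
    φ.hom.f n (V.ev g n x) = W.ev g n (φ.hom.f n x) :=
  ((comm_iff φ.hom x).1 (φ.comm n x) g).symm

instance : Category (Comod 𝒜 G) where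
  Hom := Hom
  id V := Hom.ofEv (𝟙 V.M) fun _ _ _ => rfl
  comp φ ψ := Hom.ofEv (φ.hom ≫ ψ.hom) fun g n x => by
    rw [CMod.comp_f, φ.equi, ψ.equi, CMod.comp_f]

theorem hom_ext {V W : Comod 𝒜 G} {φ ψ : V ⟶ W} (h : φ.hom = ψ.hom) : φ = ψ := Hom.ext h

/-- An isomorphism of modules whose underlying map is a morphism of comodules. -/
def mkIso {V W : Comod 𝒜 G} (e : V.M ≅ W.M)
    (he : ∀ g n x, e.hom.f n (V.ev g n x) = W.ev g n (e.hom.f n x)) : V ≅ W where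
  hom := Hom.ofEv e.hom he
  inv := Hom.ofEv e.inv fun g n x => by
    have h1 : ∀ y, e.inv.f n (e.hom.f n y) = y := fun y => by
      rw [← CMod.comp_f, e.hom_inv_id, CMod.id_f]
    have h2 : ∀ y, e.hom.f n (e.inv.f n y) = y := fun y => by
      rw [← CMod.comp_f, e.inv_hom_id, CMod.id_f]
    rw [← h1 (V.ev g n (e.inv.f n x)), he, h2]
  hom_inv_id := hom_ext e.hom_inv_id
  inv_hom_id := hom_ext e.inv_hom_id

section Mult

variable (M N : CMod 𝒜)

/-- The pointwise tensor product of functions. -/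
def fnTensor {i j n : ℤ} (h : i + j = n) :
    C(G, M.X i) →+ C(G, N.X j) →+ C(G, TC M N n) :=
  AddMonoidHom.mk' (fun f => AddMonoidHom.mk'
    (fun f' => ⟨fun g => TC.mk M N h (f g) (f' g),
      (TC.continuous_mk M N h).comp (f.continuous.prodMk f'.continuous)⟩)
    fun f' f'' => ContinuousMap.ext fun g => map_add (TC.mk M N h (f g)) (f' g) (f'' g))
    fun f f₁ => by
      refine AddMonoidHom.ext fun f' => ContinuousMap.ext fun g => ?_
      change TC.mk M N h (f g + f₁ g) (f' g) =
        TC.mk M N h (f g) (f' g) + TC.mk M N h (f₁ g) (f' g)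
      rw [map_add, AddMonoidHom.add_apply]

theorem fnTensor_apply {i j n : ℤ} (h : i + j = n) (f : C(G, M.X i)) (f' : C(G, N.X j))
    (g : G) : fnTensor M N h f f' g = TC.mk M N h (f g) (f' g) := rfl

/-- The biadditive map `(C ⊗̂ M) × (C ⊗̂ N) ⟶ C ⊗̂ (M ⊗̂ N)`,
`(α ⊗ x, β ⊗ y) ↦ α β ⊗ (x ⊗ y)`, see `multMk_mk`. -/
def multMk {i j n : ℤ} (h : i + j = n) :
    TC (cR 𝒜 G) M i →+ TC (cR 𝒜 G) N j →+ TC (cR 𝒜 G) (tensorC M N) n :=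
  ((fnTensor M N h).compl₂ (phi N j)).compr₂ (phiEquiv (tensorC M N) n).symm.toAddMonoidHom
    |>.comp (phi M i)

theorem phi_multMk {i j n : ℤ} (h : i + j = n) (z : TC (cR 𝒜 G) M i) (w : TC (cR 𝒜 G) N j)
    (g : G) : phi (tensorC M N) n (multMk M N h z w) g =
      TC.mk M N h (phi M i z g) (phi N j w g) := by
  have : phi (tensorC M N) n (multMk M N h z w) = fnTensor M N h (phi M i z) (phi N j w) :=
    phi_symm (tensorC M N) _
  rw [this, fnTensor_apply]

theorem multMk_mk {i j n i₁ i₂ j₁ j₂ p q : ℤ} (h : i + j = n) (hi : i₁ + i₂ = i)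
    (hj : j₁ + j₂ = j) (hp : i₁ + j₁ = p) (hq : i₂ + j₂ = q) (hn : p + q = n)
    (α : C(G, (unitC 𝒜).X i₁)) (x : M.X i₂) (β : C(G, (unitC 𝒜).X j₁)) (y : N.X j₂) :
    multMk M N h (TC.mk (cR 𝒜 G) M hi α x) (TC.mk (cR 𝒜 G) N hj β y) =
      TC.mk (cR 𝒜 G) (tensorC M N) hn (pact (unitC 𝒜) hp α β) (TC.mk M N hq x y) := by
  refine phi_ext fun g => ?_
  rw [phi_multMk, phi_mk, phi_mk, phi_mk, pact_apply]
  have e₁ := uact_mul (tensorC M N) hp (rfl : j₁ + q = j₁ + q) (by omega) hn (α g) (β g)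
    (TC.mk M N hq x y)
  have e₂ : uact (tensorC M N) (rfl : j₁ + q = j₁ + q) (β g) (TC.mk M N hq x y) =
      TC.mk M N (by omega : i₂ + j = j₁ + q) x (uact N hj (β g) y) :=
    (tensorG_act_mk _ _ hq rfl (by omega) x y).trans (TC.mk_bal _ _ _ _ _ _ _)
  rw [e₁, e₂]
  exact (tensorG_act_mk _ _ _ hi h x _).symm

/-- The bilinear map underlying `mult`. -/
def multBilin (n : ℤ) : Bilin (leftC G M) (leftC G N) n (TC (cR 𝒜 G) (tensorC M N) n) where
  b h := multMk M N h
  bal {d i j i' j'} h₁ h₂ h h' a z w := phi_ext fun g => by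
    rw [phi_multMk, phi_multMk, phi_leftG_act, phi_leftG_act]
    exact TC.mk_bal h₁ h₂ h h' (gact 𝒜 g d a) (phi M i z g) (phi N j w g)
  cont L hL := by
    obtain ⟨E, hE⟩ := exists_fn_le_tensor (tensorC M N) n (hL.mem_nhds L.zero_mem)
    obtain ⟨F, F', hF⟩ := TC.exists_W (E.N n) (E.isOpen n)
    refine ⟨F.left, F'.left, fun {i j} h z w hzw => hE _ fun g => ?_⟩
    rw [phi_multMk]
    refine hF (TC.mk_mem_W h ?_)
    rcases hzw with hz | hw
    · exact Or.inl (OpenSub.mem_left.1 hz g)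
    · exact Or.inr (OpenSub.mem_left.1 hw g)

/-- The map `(C ⊗̂ M) ⊗̂ (C ⊗̂ N) ⟶ C ⊗̂ (M ⊗̂ N)` that multiplies the factors in `C`. -/
def mult : tensorC (leftC G M) (leftC G N) ⟶ leftC G (tensorC M N) where
  f n := TC.lift (multBilin M N n)
  cont n := TC.continuous_lift _
  map_act {d n m} h a z := by
    refine DFunLike.congr_fun (f := (TC.lift (multBilin M N m)).comp
        (TC.act (M := leftC G M) (N := leftC G N) h a))
      (g := ((leftC G (tensorC M N)).act h a).comp (TC.lift (multBilin M N n)))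
      (TC.ext ((TC.continuous_lift _).comp (TC.continuous_act h a))
        (((leftC G (tensorC M N)).continuous_act h a).comp (TC.continuous_lift _))
        fun {i j} hij x y => ?_) z
    rw [AddMonoidHom.comp_apply, TC.act_mk h a hij rfl (by omega), TC.lift_mk]
    refine Eq.trans ?_ (congrArg ((leftC G (tensorC M N)).act h a)
      (TC.lift_mk (multBilin M N n) hij x y)).symm
    refine phi_ext fun g => ?_
    refine (phi_multMk M N _ _ _ g).trans ?_
    refine Eq.trans ?_ (phi_leftG_act (tensorC M N) h a _ g).symm
    refine Eq.trans ?_ (congrArg ((tensorC M N).act h (gact 𝒜 g d a))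
      (phi_multMk M N hij x y g)).symm
    rw [phi_leftG_act]
    exact (TC.act_mk h _ hij rfl (by omega) _ _).symm

theorem mult_mk {i j n : ℤ} (h : i + j = n) (z : TC (cR 𝒜 G) M i) (w : TC (cR 𝒜 G) N j) :
    (mult M N).f n (TC.mk (leftC G M) (leftC G N) h z w) = multMk M N h z w :=
  TC.lift_mk _ _ _ _

end Mult

variable (V W U : Comod 𝒜 G)

/-- The coaction on the tensor product of comodules. -/
def tensorRho : tensorC V.M W.M ⟶ leftC G (tensorC V.M W.M) :=
  tensorHomC V.ρ W.ρ ≫ mult V.M W.M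

theorem phi_tensorRho_mk {i j n : ℤ} (h : i + j = n) (x : V.M.X i) (y : W.M.X j) (g : G) :
    phi (tensorC V.M W.M) n ((tensorRho V W).f n (TC.mk V.M W.M h x y)) g =
      TC.mk V.M W.M h (V.ev g i x) (W.ev g j y) := by
  rw [tensorRho, CMod.comp_f, tensorHomC_mk, mult_mk, phi_multMk]
  rfl

/-- The map `z ↦ ρ(z)(g)` for the tensor product. -/
def evT (g : G) (n : ℤ) : TC V.M W.M n →+ TC V.M W.M n :=
  AddMonoidHom.mk' (fun z => phi (tensorC V.M W.M) n ((tensorRho V W).f n z) g) fun z z' => by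
    rw [map_add, map_add, ContinuousMap.add_apply]

theorem continuous_evT (g : G) (n : ℤ) : Continuous (evT V W g n) :=
  ContinuousEval.continuous_eval.comp
    (((continuous_phi (tensorC V.M W.M) n).comp ((tensorRho V W).cont n)).prodMk
      (continuous_const (y := g)))

theorem evT_mk {i j n : ℤ} (h : i + j = n) (x : V.M.X i) (y : W.M.X j) (g : G) :
    evT V W g n (TC.mk V.M W.M h x y) = TC.mk V.M W.M h (V.ev g i x) (W.ev g j y) :=
  phi_tensorRho_mk V W h x y g

/-- The completed tensor product of comodules, with the coaction
`V ⊗̂ W ⟶ (C ⊗̂ V) ⊗̂ (C ⊗̂ W) ⟶ C ⊗̂ (V ⊗̂ W)`. -/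
@[reducible] def tensor : Comod 𝒜 G :=
  ofEv (tensorC V.M W.M) (tensorRho V W)
    (fun g g' n z => by
      refine DFunLike.congr_fun (f := (evT V W g' n).comp (evT V W g n))
        (g := evT V W (g * g') n)
        (TC.ext ((continuous_evT V W g' n).comp (continuous_evT V W g n))
          (continuous_evT V W _ n) fun h x y => ?_) z
      rw [AddMonoidHom.comp_apply, evT_mk, evT_mk, evT_mk, V.ev_mul, W.ev_mul])
    (fun n z => by
      refine DFunLike.congr_fun (f := evT V W 1 n) (g := AddMonoidHom.id _)
        (TC.ext (continuous_evT V W 1 n) continuous_id fun h x y => ?_) z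
      rw [evT_mk, V.ev_one, W.ev_one, AddMonoidHom.id_apply])

theorem tensor_ev_mk {i j n : ℤ} (h : i + j = n) (x : V.M.X i) (y : W.M.X j) (g : G) :
    (tensor V W).ev g n (TC.mk V.M W.M h x y) = TC.mk V.M W.M h (V.ev g i x) (W.ev g j y) :=
  evT_mk V W h x y g

variable (𝒜 G) in
/-- The coaction `a ↦ η_L(a) ⊗ 1` on the unit object. -/
def unitRho : unitC 𝒜 ⟶ leftC G (unitC 𝒜) where
  f n := ((TC.mk (cR 𝒜 G) (unitC 𝒜) (add_zero n)).flip (uone 𝒜)).comp (etaL 𝒜 G n)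
  cont n := by
    have h : Continuous fun a : (unitC 𝒜).X n => (etaL 𝒜 G n a : C(G, (unitC 𝒜).X n)) :=
      ContinuousMap.continuous_of_continuous_uncurry _ (continuous_ract 𝒜 n)
    exact (TC.continuous_mk_left (M := cR 𝒜 G) (N := unitC 𝒜) (add_zero n) (uone 𝒜)).comp h
  map_act {d j i} h a x := by
    refine phi_ext fun g => ?_
    refine (phi_mk (unitC 𝒜) _ _ _ g).trans ?_
    refine Eq.trans ?_ (phi_leftG_act (unitC 𝒜) h a _ g).symm
    refine Eq.trans ?_ (congrArg ((unitC 𝒜).act h (gact 𝒜 g d a))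
      (phi_mk (unitC 𝒜) (add_zero j) (etaL 𝒜 G j x) (uone 𝒜) g)).symm
    rw [uact_uone, uact_uone]
    exact ract_uact 𝒜 g h a x

theorem phi_unitRho {n : ℤ} (a : (unitC 𝒜).X n) (g : G) :
    phi (unitC 𝒜) n ((unitRho 𝒜 G).f n a) g = ract 𝒜 g n a := by
  refine (phi_mk (unitC 𝒜) (add_zero n) (etaL 𝒜 G n a) (uone 𝒜) g).trans ?_
  rw [uact_uone]
  rfl

variable (𝒜 G) in
/-- The unit object: `𝒜` with the coaction given by `η_L`. -/
@[reducible] def unit : Comod 𝒜 G :=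
  ofEv (unitC 𝒜) (unitRho 𝒜 G)
    (fun g h n x => by
      rw [phi_unitRho, phi_unitRho, phi_unitRho, ract_mul])
    (fun n x => by rw [phi_unitRho, ract_one])

theorem unit_ev (g : G) (n : ℤ) (a : (unitC 𝒜).X n) :
    (unit 𝒜 G).ev g n a = ract 𝒜 g n a := phi_unitRho a g

variable {V W U}

theorem equi2 {P : Comod 𝒜 G} (φ : tensorC V.M W.M ⟶ P.M)
    (h : ∀ (g : G) {i j n : ℤ} (h : i + j = n) (x : V.M.X i) (y : W.M.X j),
      φ.f n (TC.mk V.M W.M h (V.ev g i x) (W.ev g j y)) =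
        P.ev g n (φ.f n (TC.mk V.M W.M h x y))) (g : G) (n : ℤ) (z : (tensor V W).M.X n) :
    φ.f n ((tensor V W).ev g n z) = P.ev g n (φ.f n z) := by
  refine DFunLike.congr_fun (f := (φ.f n).comp (evT V W g n))
    (g := (P.ev g n).comp (φ.f n)) (TC.ext ((φ.cont n).comp (continuous_evT V W g n))
      ((P.continuous_ev g n).comp (φ.cont n)) fun {i j} hij x y => ?_) z
  rw [AddMonoidHom.comp_apply, AddMonoidHom.comp_apply, evT_mk]
  exact h g hij x y

theorem equi3 {P : Comod 𝒜 G} (φ : tensorC (tensorC V.M W.M) U.M ⟶ P.M)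
    (h : ∀ (g : G) {i j l p n : ℤ} (h₁ : i + j = l) (h₂ : l + p = n) (x : V.M.X i) (y : W.M.X j)
      (z : U.M.X p), φ.f n (TC.mk (tensorC V.M W.M) U.M h₂ (TC.mk V.M W.M h₁ (V.ev g i x)
        (W.ev g j y)) (U.ev g p z)) =
        P.ev g n (φ.f n (TC.mk (tensorC V.M W.M) U.M h₂ (TC.mk V.M W.M h₁ x y) z)))
    (g : G) (n : ℤ) (z : (tensor (tensor V W) U).M.X n) :
    φ.f n ((tensor (tensor V W) U).ev g n z) = P.ev g n (φ.f n z) := by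
  refine DFunLike.congr_fun (f := (φ.f n).comp (evT (tensor V W) U g n))
    (g := (P.ev g n).comp (φ.f n))
    (TC.ext3 ((φ.cont n).comp (continuous_evT (tensor V W) U g n))
      ((P.continuous_ev g n).comp (φ.cont n)) fun {i j l p} h₁ h₂ x y z => ?_) z
  have := evT_mk (tensor V W) U h₂ (TC.mk V.M W.M h₁ x y) z g
  rw [tensor_ev_mk V W h₁ x y g] at this
  exact (congrArg (φ.f n) this).trans (h g h₁ h₂ x y z)

/-- The tensor product of morphisms. -/
def tensorHom {V' W' : Comod 𝒜 G} (φ : V ⟶ V') (ψ : W ⟶ W') : tensor V W ⟶ tensor V' W' :=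
  Hom.ofEv (tensorHomC φ.hom ψ.hom) (equi2 (P := tensor V' W') _ fun g i j n h x y => by
    rw [tensorHomC_mk, tensorHomC_mk, φ.equi, ψ.equi]
    exact (tensor_ev_mk V' W' h _ _ g).symm)

instance : MonoidalCategoryStruct (Comod 𝒜 G) where
  tensorObj := tensor
  tensorHom := tensorHom
  whiskerLeft V _ _ φ := tensorHom (𝟙 V) φ
  whiskerRight φ V := tensorHom φ (𝟙 V)
  tensorUnit := unit 𝒜 G
  associator V W U := mkIso (V := tensor (tensor V W) U) (W := tensor V (tensor W U))
    (assocIso V.M W.M U.M) (equi3 (P := tensor V (tensor W U)) _ fun g i j l p n h₁ h₂ x y z => by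
      rw [assocIso_mk _ _ _ h₁ h₂ rfl (by omega), assocIso_mk _ _ _ h₁ h₂ rfl (by omega),
        ← tensor_ev_mk W U]
      exact (tensor_ev_mk V (tensor W U) _ x (TC.mk W.M U.M rfl y z) g).symm)
  leftUnitor V := mkIso (V := tensor (unit 𝒜 G) V) (leftIso V.M)
    (equi2 (V := unit 𝒜 G) (P := V) _ fun g i j n h a x => by
      rw [unit_ev]
      refine (leftIso_mk V.M h _ _).trans ?_
      refine Eq.trans ?_ (congrArg (V.ev g n) (leftIso_mk V.M h a x)).symm
      exact (V.ev_act g h a x).symm)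
  rightUnitor V := mkIso (V := tensor V (unit 𝒜 G)) (rightIso V.M)
    (equi2 (W := unit 𝒜 G) (P := V) _ fun g i j n h x a => by
      rw [unit_ev]
      refine (rightIso_mk V.M h (by omega) _ _).trans ?_
      refine Eq.trans ?_ (congrArg (V.ev g n) (rightIso_mk V.M h (by omega) x a)).symm
      exact (V.ev_act g _ a x).symm)

instance : MonoidalCategory (Comod 𝒜 G) := MonoidalCategory.ofTensorHom
  (id_tensorHom_id := fun V W => hom_ext (MonoidalCategory.id_tensorHom_id V.M W.M))
  (tensorHom_comp_tensorHom := fun f₁ f₂ g₁ g₂ =>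
    hom_ext (MonoidalCategory.tensorHom_comp_tensorHom f₁.hom f₂.hom g₁.hom g₂.hom))
  (associator_naturality := fun f₁ f₂ f₃ =>
    hom_ext (MonoidalCategory.associator_naturality f₁.hom f₂.hom f₃.hom))
  (leftUnitor_naturality := fun f => hom_ext (MonoidalCategory.leftUnitor_naturality f.hom))
  (rightUnitor_naturality := fun f => hom_ext (MonoidalCategory.rightUnitor_naturality f.hom))
  (pentagon := fun V W U P => hom_ext (MonoidalCategory.pentagon V.M W.M U.M P.M))
  (triangle := fun V W => hom_ext (MonoidalCategory.triangle V.M W.M))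

instance : SymmetricCategory (Comod 𝒜 G) where
  braiding V W := mkIso (V := tensor V W) (W := tensor W V) (braidIso V.M W.M)
    (equi2 (P := tensor W V) _ fun g i j n h x y => by
      refine (braidHom_mk V.M W.M h (by omega) _ _).trans ?_
      refine Eq.trans ?_ (congrArg ((tensor W V).ev g n)
        (braidHom_mk V.M W.M h (by omega : j + i = n) x y)).symm
      rw [map_zsmul, tensor_ev_mk W V])
  braiding_naturality_right V _ _ f :=
    hom_ext (BraidedCategory.braiding_naturality_right V.M f.hom)
  braiding_naturality_left f V := hom_ext (BraidedCategory.braiding_naturality_left f.hom V.M)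
  hexagon_forward V W U := hom_ext (BraidedCategory.hexagon_forward V.M W.M U.M)
  hexagon_reverse V W U := hom_ext (BraidedCategory.hexagon_reverse V.M W.M U.M)
  symmetry V W := hom_ext (SymmetricCategory.symmetry V.M W.M)

end Comod

end Comodules

end

end GradedTwist

/-! Everything rests on one isomorphism. For a complete module $M$ and $C = C(G,R)$, the map `phi`
from $C \widehat\otimes_R M$ to $C(G,M)$, $\alpha\otimes m \mapsto (g \mapsto \alpha(g)m)$, is in
each degree an isomorphism of topological groups onto the continuous functions with uniform
convergence. A coaction is therefore a continuous map $M \to C(G,M)$, that is, a family of operators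
$x \mapsto \rho(x)(g)$ (`Comod.ev`), and each axiom of comodules becomes an axiom of twisted modules
once it is evaluated at elements of $G$.

Why `phi` is an isomorphism: let $F$ be an open submodule of $M$ and choose $p$ with $\mathfrak m^p
M \subseteq F$. A function $\alpha$ is constant modulo $\mathfrak m^p$ on the classes of a discrete
quotient of $G$, which is finite because $G$ is compact. Scalars move across the tensor sign, so
modulo the closure of $C(G,\mathfrak m^p)\otimes M + C\otimes F$ every element is a finite sum of
tensors $1_s\otimes m_s$ (`mem_stepSub`). The image of such a sum is the step function with values
$m_s$; if that function takes values in $F$, then all $m_s$ lie in $F$ and the sum lies in the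
closure too. Hence this closure is exactly the preimage of the functions with values in $F$
(`phi_mem_fnSub`, `mem_W_of_phi`). So `phi` is injective and induces the topology of its source.
Step functions are dense in $C(G,M)$, and the image is complete, hence closed, so `phi` is also
surjective.

The dictionary is as follows. Linearity of $\rho$ for the action through $\eta_L$ reads $(ax)g =
a^g(xg)$, because $\eta_L(a)(g) = a^g$ (`phi_leftG_act`). Elements of
$C\widehat\otimes_R(C\widehat\otimes_R M)$ are determined by functions on $G\times G$ (`phi2_ext`);
there $(\psi\otimes 1)\rho(x)$ has the value $\rho(x)(g_1g_2)$ and $(1\otimes\rho)\rho(x)$ has the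
value $\rho(\rho(x)(g_1))(g_2)$, so coassociativity is the law $(xg_1)g_2 = x(g_1g_2)$ of a right
action (`phi2_psiT`, `Comod.phi2_oneT_rho`). The counit evaluates at the identity of $G$
(`epsT_eq`), which gives $x\cdot 1 = x$. A module map commutes with coactions exactly when it
commutes with all the operators (`Comod.comm_iff`). Finally, continuity of $M_n \to C(G,M_n)$ is the
same as joint continuity of $M_n\times G\to M_n$, by currying in one direction and by continuity of
evaluation, for compact $G$, in the other.

The passage between the two structures changes neither the modules nor the maps. It respects tensor
products because multiplication in $C$ is pointwise: $\alpha\beta\otimes(x\otimes y)$ evaluated at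
$g$ is $\alpha(g)x\otimes\beta(g)y$, so the product coaction is the diagonal action
(`TwMod.evT_toComod`). All comparison maps are identities of modules. Associativity, unit and
symmetry isomorphisms on both sides come from the same isomorphisms of complete modules, so every
coherence diagram reduces to composition with identities. -/

noncomputable section

namespace GradedTwist

open MonoidalCategory

variable {k : Type w} {A : Type u} [CommRing k] [CommRing A] [Algebra k A]
  {𝒜 : ℤ → Submodule k A} [GradedAlgebra 𝒜] [IsLocalRing (𝒜 0)] [EvenPeriodic 𝒜]
  [IsAdicComplete (IsLocalRing.maximalIdeal (𝒜 0)) (𝒜 0)]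
  {G : Type u} [Group G] [TopologicalSpace G] [IsTopologicalGroup G] [CompactSpace G] [T2Space G]
  [TotallyDisconnectedSpace G] [MulSemiringAction Gᵐᵒᵖ A] [ContAction 𝒜 G]

/-! ### From continuous actions to coactions. -/

namespace TwMod

variable (V : TwMod 𝒜 G)

/-- The coaction of a twisted module: `ρ(x) ∈ C ⊗̂ M` corresponds to the orbit map `g ↦ x g`
under the isomorphism of `C ⊗̂ M` with the continuous functions from `G` to `M`. -/
def rho : V.M ⟶ leftC G V.M where
  f n := (phiEquiv V.M n).symm.toAddMonoidHom.comp (V.orb n)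
  -- Joint continuity of the action makes $x \mapsto (g \mapsto xg)$ continuous for uniform
  -- convergence, and the inverse of `phi` is continuous because $C\widehat\otimes_R M$ carries
  -- exactly that topology.
  cont n := (continuous_phi_symm V.M n).comp (V.continuous_orb n)
  -- Elements of $C\widehat\otimes_R M$ are compared by their values at each $g$. There the left
  -- action through $\eta_L$ is multiplication by $a^g$, so linearity of the coaction is the
  -- semilinearity of the group action.
  map_act {d j i} h a x := phi_ext fun g => by
    refine (DFunLike.congr_fun (phi_symm V.M (V.orb i (V.M.act h a x))) g).trans ?_
    refine Eq.trans ?_ (phi_leftG_act V.M h a _ g).symm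
    refine (V.semilinear g h a x).trans (congrArg (V.M.act h (gact 𝒜 g d a)) ?_)
    exact (DFunLike.congr_fun (phi_symm V.M (V.orb j x)) g).symm

/-- The inverse of `phi` in the construction of `rho` cancels against `phi`. This formula determines
the coaction, since an element of $C\widehat\otimes_R M$ is determined by its values, and later
arguments use it in place of the construction. -/
theorem phi_rho (n : ℤ) (x : V.M.X n) (g : G) : phi V.M n (V.rho.f n x) g = V.ract g n x :=
  DFunLike.congr_fun (phi_symm V.M (V.orb n x)) g

/-- The comodule of a twisted module. -/
@[reducible] def toComod : Comod 𝒜 G :=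
  -- `Comod.ofEv` asks for coassociativity evaluated at $(g,h)$ and for the counit law evaluated at
  -- the identity. With the values of the coaction inserted these are $(xg)h = x(gh)$ and $x\cdot 1
  -- = x$.
  Comod.ofEv V.M V.rho (fun g h n x => by rw [phi_rho, phi_rho, phi_rho, V.ract_mul])
    fun n x => by rw [phi_rho, V.ract_one]

/-- The bridge between the two structures, by which every comparison below is verified. The equality
is not definitional: the coaction passes through the inverse of a bijection, which cancels only
propositionally. This is why comparison isomorphisms are needed although their underlying module
maps are identities. -/
theorem toComod_ev (g : G) (n : ℤ) (x : V.M.X n) : V.toComod.ev g n x = V.ract g n x :=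
  V.phi_rho n x g

end TwMod

/-! ### From coactions to continuous actions. -/

namespace Comod

variable (V : Comod 𝒜 G)

/-- Compactness of $G$ enters here: under uniform convergence, evaluation $C(G,M_n)\times G \to M_n$
is jointly continuous. Composing it with the continuous map $x \mapsto \rho(x)$, read in $C(G,M_n)$
through `phi`, gives continuity in both variables at once, which is more than the continuity of each
single operator in `continuous_ev`. It is the counterpart of `TwMod.continuous_orb`. -/
theorem continuous_ev_uncurry (n : ℤ) : Continuous fun p : V.M.X n × G => V.ev p.2 n p.1 :=
  ContinuousEval.continuous_eval.comp
    ((((continuous_phi V.M n).comp (V.ρ.cont n)).comp continuous_fst).prodMk continuous_snd)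

/-- The twisted module of a comodule, with `x g = ρ(x)(g)`. -/
@[reducible] def toTwMod : TwMod 𝒜 G where
  M := V.M
  ract := V.ev
  -- The next three fields are the comodule axioms after evaluation: the counit law gives the action
  -- of the identity, coassociativity at a pair of group elements gives multiplicativity, and
  -- linearity of the coaction through $\eta_L$ gives semilinearity.
  ract_one := V.ev_one
  ract_mul := V.ev_mul
  semilinear g _ _ _ h a x := V.ev_act g h a x
  continuous_ract := V.continuous_ev_uncurry

end Comod

/-! ### The equivalence of categories. -/

variable (𝒜 G) in
/-- The functor from twisted modules to comodules, the identity on the underlying modules. -/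
def twistedToComod : TwMod 𝒜 G ⥤ Comod 𝒜 G where
  obj V := V.toComod
  -- The condition on a comodule map is an equation in $C\widehat\otimes_R W$. By injectivity of
  -- `phi` it suffices to check it at every $g$, where it is the equivariance of `φ`.
  map {V W} φ := Comod.Hom.ofEv φ.hom fun g n x => by
    rw [TwMod.toComod_ev, TwMod.toComod_ev, φ.equi]

variable (𝒜 G) in
/-- The functor from comodules to twisted modules, the identity on the underlying modules. -/
def comodToTwisted : Comod 𝒜 G ⥤ TwMod 𝒜 G where
  obj V := V.toTwMod
  -- Equivariance under $g$ is the compatibility with the coactions evaluated at $g$; this direction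
  -- does not need the injectivity of `phi`.
  map φ := ⟨φ.hom, φ.equi⟩

variable (𝒜 G) in
/-- The equivalence between twisted modules and comodules. -/
def twistedEquivComod : TwMod 𝒜 G ≌ Comod 𝒜 G where
  functor := twistedToComod 𝒜 G
  inverse := comodToTwisted 𝒜 G
  unitIso := NatIso.ofComponents
    -- The round trip returns the same module, with an action that agrees with the original one by
    -- `TwMod.toComod_ev`. The two twisted modules are not definitionally equal, so the isomorphism
    -- is the identity of modules together with a proof of equivariance.
    (fun V => TwMod.mkIso (V := V) (W := V.toComod.toTwMod) (Iso.refl V.M) fun g n x =>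
      (V.toComod_ev g n x).symm)
    -- Naturality compares a map followed by an identity with an identity followed by the same map.
    -- On the underlying modules the two composites agree by definition.
    fun _ => TwMod.hom_ext rfl
  counitIso := NatIso.ofComponents
    -- The coaction rebuilt from the operators $x \mapsto \rho(x)(g)$ has the same values as $\rho$
    -- at every $g$, hence corresponds to it under the identity of the module. This is where a
    -- coaction is recovered from its evaluations.
    (fun V => Comod.mkIso (V := V.toTwMod.toComod) (W := V) (Iso.refl V.M) fun g n x =>
      V.toTwMod.toComod_ev g n x)
    fun _ => Comod.hom_ext rfl
  -- In the triangle identity every factor is an identity on the underlying module.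
  functor_unitIso_comp _ := Comod.hom_ext rfl

/-! ### Compatibility with tensor products and symmetries. -/

/-- The comparison of the units. -/
def unitComparison : 𝟙_ (Comod 𝒜 G) ≅ (twistedToComod 𝒜 G).obj (𝟙_ (TwMod 𝒜 G)) :=
  Comod.mkIso (V := Comod.unit 𝒜 G) (W := (TwMod.unit 𝒜 G).toComod) (Iso.refl (unitC 𝒜))
    -- Both coactions take the value $a^g$ at $g$: for the unit comodule this is $\eta_L(a)\otimes
    -- 1$ evaluated at $g$, for the unit twisted module it is the given action on $R$, recovered
    -- through `TwMod.toComod_ev`.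
    fun g n a => (Comod.unit_ev g n a).trans ((TwMod.unit 𝒜 G).toComod_ev g n a).symm

/-- This is the multiplicative content of the theorem. The tensor coaction multiplies the factors in
$C$, and multiplication in $C$ is pointwise, so evaluating at $g$ the product of $\rho(x)$ and
$\rho(y)$ gives $xg\otimes yg$. Both sides are continuous and additive on the completed tensor
product, hence they agree everywhere once they agree on pure tensors. -/
theorem TwMod.evT_toComod (V W : TwMod 𝒜 G) (g : G) (n : ℤ) :
    Comod.evT V.toComod W.toComod g n = ractT V W g n :=
  TC.ext (Comod.continuous_evT V.toComod W.toComod g n) (continuous_ractT_left V W g n)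
    fun {i j} h x y => by
      rw [Comod.evT_mk V.toComod W.toComod h x y g, ractT_mk, toComod_ev, toComod_ev]

/-- The form of the preceding equality that `Comod.mkIso` requires. Tensoring before or after the
passage to comodules yields two coactions on one module; the first has `Comod.evT` as its evaluation
by definition, and for the second the evaluation is the diagonal action by `TwMod.toComod_ev`. -/
theorem TwMod.tensor_toComod_ev (V W : TwMod 𝒜 G) (g : G) (n : ℤ) (z : TC V.M W.M n) :
    (Comod.tensor V.toComod W.toComod).ev g n z = (TwMod.tensor V W).toComod.ev g n z :=
  (DFunLike.congr_fun (TwMod.evT_toComod V W g n) z).trans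
    ((TwMod.tensor V W).toComod_ev g n z).symm

/-- The comparison of the tensor products. -/
def tensorComparison (V W : TwMod 𝒜 G) :
    Comod.tensor V.toComod W.toComod ≅ (TwMod.tensor V W).toComod :=
  Comod.mkIso (V := Comod.tensor V.toComod W.toComod) (W := (TwMod.tensor V W).toComod)
    -- Both comodules have the module $V\widehat\otimes_R W$, and agreement of all evaluations makes
    -- its identity map an isomorphism of comodules.
    (Iso.refl (tensorC V.M W.M)) (TwMod.tensor_toComod_ev V W)

/-- The identity law of the monoidal structure, restated for `tensorHomC`. In the coherence diagrams
below, whiskered comparison maps unfold to tensor products of identities in this notation, and this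
is the rewriting rule that removes them. -/
theorem tensorHomC_id (M N : CMod 𝒜) : tensorHomC (𝟙 M) (𝟙 N) = 𝟙 (tensorC M N) :=
  MonoidalCategory.id_tensorHom_id M N

/-- A morphism of comodules is determined by its map of modules, so each axiom of a strong monoidal
functor is an equation between maps of complete modules. There the comparison maps are identities,
and the associators and unitors of both categories are the same isomorphisms `assocIso`, `leftIso`
and `rightIso`. -/
instance twistedToComodMonoidal : (twistedToComod 𝒜 G).Monoidal :=
  Functor.CoreMonoidal.toMonoidal
    { εIso := unitComparison
      μIso := tensorComparison
      -- In both categories whiskering a morphism is `tensorHomC` of its module map with an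
      -- identity, so on either side of the square the same map is composed with an identity.
      μIso_hom_natural_left := fun _ _ => Comod.hom_ext rfl
      μIso_hom_natural_right := fun _ _ => Comod.hom_ext rfl
      associativity := fun V W U => Comod.hom_ext <| by
        -- Passing to module maps turns the hexagon for the associators into this equation: the
        -- tensor comparisons, whiskered or not, are identities, and one associator remains on each
        -- side.
        change tensorHomC (𝟙 (tensorC V.M W.M)) (𝟙 U.M) ≫ 𝟙 (tensorC (tensorC V.M W.M) U.M) ≫
          (assocIso V.M W.M U.M).hom = (assocIso V.M W.M U.M).hom ≫
            tensorHomC (𝟙 V.M) (𝟙 (tensorC W.M U.M)) ≫ 𝟙 (tensorC V.M (tensorC W.M U.M))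
        rw [tensorHomC_id, tensorHomC_id, Category.id_comp, Category.id_comp, Category.comp_id,
          Category.comp_id]
      left_unitality := fun V => Comod.hom_ext <| by
        -- The factors on the right are the whiskered unit comparison, the tensor comparison and the
        -- image of the left unitor of twisted modules; only the last one is not an identity on
        -- modules.
        change (leftIso V.M).hom = tensorHomC (𝟙 (unitC 𝒜)) (𝟙 V.M) ≫
          𝟙 (tensorC (unitC 𝒜) V.M) ≫ (leftIso V.M).hom
        rw [tensorHomC_id, Category.id_comp, Category.id_comp]
      right_unitality := fun V => Comod.hom_ext <| by
        -- The same three factors occur with the unit object on the right.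
        change (rightIso V.M).hom = tensorHomC (𝟙 V.M) (𝟙 (unitC 𝒜)) ≫
          𝟙 (tensorC V.M (unitC 𝒜)) ≫ (rightIso V.M).hom
        rw [tensorHomC_id, Category.id_comp, Category.id_comp] }

/-- The symmetries of both categories have the same underlying map `braidIso`, Koszul sign included.
The square relating them to the tensor comparisons therefore has two equal sides and two identities.
-/
instance twistedToComodBraided : (twistedToComod 𝒜 G).Braided where
  braided V W := Comod.hom_ext <| by
    change 𝟙 (tensorC V.M W.M) ≫ (braidIso V.M W.M).hom =
      (braidIso V.M W.M).hom ≫ 𝟙 (tensorC W.M V.M)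
    rw [Category.id_comp, Category.comp_id]

end GradedTwist

end

/-- Profiniteness of $G$ is expressed as compact, Hausdorff and totally disconnected, and the right
action on the ring as an action of the opposite group. Both categories carry instances of
`SymmetricCategory`. For a functor between symmetric monoidal categories compatibility with the
symmetries is the braided condition, and `Functor.Braided` includes the strong monoidal structure;
as it is data, its existence is stated with `Nonempty`. -/
theorem mainTheorem8 {k : Type w} [CommRing k] {A : Type u} [CommRing A] [Algebra k A]
    (𝒜 : ℤ → Submodule k A) [GradedAlgebra 𝒜] [GradedTwist.EvenPeriodic 𝒜]
    [IsLocalRing (𝒜 0)] [IsAdicComplete (IsLocalRing.maximalIdeal (𝒜 0)) (𝒜 0)]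
    (G : Type u) [Group G] [TopologicalSpace G] [IsTopologicalGroup G] [CompactSpace G]
    [T2Space G] [TotallyDisconnectedSpace G]
    [MulSemiringAction Gᵐᵒᵖ A] [SMulCommClass Gᵐᵒᵖ k A] [GradedTwist.ContAction 𝒜 G] :
    ∃ e : GradedTwist.TwMod 𝒜 G ≌ GradedTwist.Comod 𝒜 G, Nonempty e.functor.Braided :=
  -- The functor of this equivalence is `twistedToComod` by definition, so the braided structure
  -- found for that functor applies as it stands.
  ⟨GradedTwist.twistedEquivComod 𝒜 G, ⟨GradedTwist.twistedToComodBraided⟩⟩
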